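/- **Theorem (Hua's formula).** Let $\Gamma$ be a finite quiver without loops, with vertices $1,\dots,n$. For $i\ne j$ let $b_{ij}$ be the number of edges between $i$ and $j$, and let $T$ be the Tits form on $\mathbb Z^n$, $T(v)=\sum_i v_i^2-\sum_{i<j}b_{ij}v_iv_j$ (the quadratic form with matrix $\frac12C$, where $C$ is the matrix with $c_{ii}=2$ and $c_{ij}=-b_{ij}$ for $i\neq j$). Put $\varphi_m(t)=\prod_{i=1}^m(1-t^i)$. For a tuple of partitions $\lambda=(\lambda^1,\dots,\lambda^n)$ put $|\lambda|=(|\lambda^1|,\dots,|\lambda^n|)$ and $\lambda_k=(\lambda^1_k,\dots,\lambda^n_k)$, where $\lambda^i_k$ is the $k$-th largest part of $\lambda^i$ (or $0$), and let $$r_\lambda(q)=\prod_{k\ge1}\frac{q^{-T(\lambda_k)}}{\prod_{i=1}^n\varphi_{\lambda^i_k-\lambda^i_{k+1}}(q^{-1})},\qquad r_\alpha=\sum_{|\lambda|=\alpha}r_\lambda\in\mathbb Q(q),\qquad r(q)=\sum_{\alpha\in\mathbb N^n}r_\alpha(q)x^\alpha\in\mathbb Q(q)[[x_1,\dots,x_n]].$$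 On $\mathbb Q(q)[[x_1,\dots,x_n]]$ let $\psi_k$ ($k\ge1$) be the Adams operations, $\psi_k\big(\sum_\alpha f_\alpha(q)x^\alpha\big)=\sum_\alpha f_\alpha(q^k)x^{k\alpha}$. For $f$ with zero constant term let $\operatorname{Exp}(f)=\exp\big(\sum_{k\ge1}\frac1k\psi_k(f)\big)$; for $f$ with constant term $1$ let $\operatorname{Log}(f)=\sum_{k\ge1}\frac{\mu(k)}k\psi_k(\log f)$, where $\mu$ is the Möbius function, and $\operatorname{Pow}(f,g)=\operatorname{Exp}(g\operatorname{Log}(f))$. Then there are (necessarily unique) polynomials $m_\alpha,a_\alpha\in\mathbb Z[q]$, $\alpha\in\mathbb N^n$, such that for every finite field $\mathbb F_q$ the values $m_\alpha(q)$ and $a_\alpha(q)$ are the numbers of isomorphism classes of, respectively, representations and absolutely indecomposable representations of $\Gamma$ over $\mathbb F_q$ of dimension $\alpha$. (A representation is absolutely indecomposable if it is indecomposable after extension of scalars to an algebraic closure.) Their generating functions $m(q)=\sum_\alpha m_\alpha(q)x^\alpha$ and $a(q)=\sum_\alpha a_\alpha(q)x^\alpha$ satisfy $$a(q)=(q-1)\operatorname{Log}(r(q))\qquad\text{and}\qquad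 m(q)=\operatorname{Pow}(r(q),q-1).$$ -/

import Mathlib

open scoped TensorProduct

/-! ### Representations of quivers -/

universe u v w

/-- A representation of the quiver `V` over the field `F`: a vector space at every vertex and
a linear map for every arrow. -/
structure QuiverRep (F : Type w) [Field F] (V : Type u) [Quiver.{v + 1} V] where
  obj : V → Type w
  [addCommGroup : ∀ i, AddCommGroup (obj i)]
  [module : ∀ i, Module F (obj i)]
  map : ∀ {i j : V}, (i ⟶ j) → (obj i →ₗ[F] obj j)

namespace QuiverRep

attribute [instance] QuiverRep.addCommGroup QuiverRep.module

variable {F : Type w} [Field F] {V : Type u} [Quiver.{v + 1} V]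

/-- `M` and `N` are isomorphic: there are linear isomorphisms at all the vertices that commute
with the maps at all the arrows. -/
def IsIso (M N : QuiverRep F V) : Prop :=
  ∃ φ : ∀ i, M.obj i ≃ₗ[F] N.obj i,
    ∀ (i j : V) (e : i ⟶ j) (x : M.obj i), φ j (M.map e x) = N.map e (φ i x)

theorem isIso_equivalence : Equivalence (IsIso (F := F) (V := V)) where
  refl M := ⟨fun i => LinearEquiv.refl F (M.obj i), fun _ _ _ _ => rfl⟩
  symm := by
    rintro M N ⟨φ, h⟩
    refine ⟨fun i => (φ i).symm, fun i j e x => ?_⟩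
    rw [LinearEquiv.symm_apply_eq, h, LinearEquiv.apply_symm_apply]
  trans := by
    rintro M N P ⟨φ, h⟩ ⟨χ, k⟩
    refine ⟨fun i => (φ i).trans (χ i), fun i j e x => ?_⟩
    simp [h, k]

/-- `M` is finite dimensional with dimension vector `α`. -/
def HasDim (M : QuiverRep F V) (α : V →₀ ℕ) : Prop :=
  ∀ i, Module.Finite F (M.obj i) ∧ Module.finrank F (M.obj i) = α i

/-- The family of subspaces `U` is a subrepresentation of `M`. -/
def IsSubrep (M : QuiverRep F V) (U : ∀ i, Submodule F (M.obj i)) : Prop :=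
  ∀ (i j : V) (e : i ⟶ j), ∀ x ∈ U i, M.map e x ∈ U j

/-- `M` is nonzero and is not the direct sum of two nonzero subrepresentations. -/
def IsIndecomposable (M : QuiverRep F V) : Prop :=
  (∃ i, Nontrivial (M.obj i)) ∧
    ∀ U W : ∀ i, Submodule F (M.obj i), M.IsSubrep U → M.IsSubrep W →
      (∀ i, IsCompl (U i) (W i)) → (∀ i, U i = ⊥) ∨ (∀ i, W i = ⊥)

/-- Extension of scalars `L ⊗ M`. -/
noncomputable def baseChange (L : Type w) [Field L] [Algebra F L] (M : QuiverRep F V) :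
    QuiverRep L V where
  obj i := L ⊗[F] M.obj i
  map e := (M.map e).baseChange L

/-- `M` stays indecomposable over the algebraic closure of the base field. -/
def IsAbsolutelyIndecomposable (M : QuiverRep F V) : Prop :=
  (M.baseChange (AlgebraicClosure F)).IsIndecomposable

/-- The isomorphism relation among the representations with the property `P`. -/
def isoSetoid (P : QuiverRep F V → Prop) : Setoid {M : QuiverRep F V // P M} where
  r M N := IsIso M.1 N.1
  iseqv := ⟨fun M => isIso_equivalence.refl M.1, fun h => isIso_equivalence.symm h,
    fun h k => isIso_equivalence.trans h k⟩

variable (F V) in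
/-- The number of isomorphism classes of representations over `F` of dimension `α`. -/
noncomputable def numReps (α : V →₀ ℕ) : ℕ :=
  Nat.card (Quotient (isoSetoid fun M : QuiverRep F V => M.HasDim α))

variable (F V) in
/-- The number of isomorphism classes of absolutely indecomposable representations over `F` of
dimension `α`. -/
noncomputable def numAbsIndecReps (α : V →₀ ℕ) : ℕ :=
  Nat.card (Quotient (isoSetoid fun M : QuiverRep F V =>
    M.HasDim α ∧ M.IsAbsolutelyIndecomposable))

end QuiverRep

/-! ### The Tits form and the rational functions `r_α` -/

namespace Hua

section Tits

variable (V : Type u) [Quiver.{v + 1} V] [Fintype V] [DecidableEq V]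

/-- The Cartan matrix `C` of the underlying graph: `2` on the diagonal, and minus the number of
edges between `i` and `j` off the diagonal. -/
noncomputable def cartanMatrix : Matrix V V ℤ :=
  Matrix.of fun i j =>
    if i = j then 2 else -((Nat.card (i ⟶ j) : ℤ) + (Nat.card (j ⟶ i) : ℤ))

variable {V}

/-- The Tits form `T(v) = ½ vᵀ C v`; the division is exact, see `two_mul_titsForm`. -/
noncomputable def titsForm (v : V → ℤ) : ℤ :=
  (∑ i, ∑ j, cartanMatrix V i j * v i * v j) / 2

theorem sum_cartanMatrix (v : V → ℤ) :
    ∑ i, ∑ j, cartanMatrix V i j * v i * v j =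
      2 * (∑ i, v i ^ 2 - ∑ i, ∑ j, if i = j then 0 else (Nat.card (i ⟶ j) : ℤ) * v i * v j) := by
  have h1 : ∀ i j, cartanMatrix V i j * v i * v j =
      (if i = j then 2 * v i ^ 2 else 0) -
      (if i = j then 0 else (Nat.card (i ⟶ j) : ℤ) * v i * v j) -
      (if j = i then 0 else (Nat.card (j ⟶ i) : ℤ) * v j * v i) := by
    intro i j
    by_cases h : i = j
    · subst h; simp [cartanMatrix]; ring
    · simp [cartanMatrix, h, Ne.symm h]; ring
  simp only [h1, Finset.sum_sub_distrib]
  rw [Finset.sum_comm (f := fun i j =>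
    if j = i then 0 else (Nat.card (j ⟶ i) : ℤ) * v j * v i)]
  simp only [Finset.sum_ite_eq, Finset.mem_univ, if_true, ← Finset.mul_sum]
  ring

theorem two_mul_titsForm (v : V → ℤ) :
    2 * titsForm v = ∑ i, ∑ j, cartanMatrix V i j * v i * v j := by
  rw [titsForm, sum_cartanMatrix]
  simp

end Tits

/-- The `k`-th largest part of a partition, `k = 0, 1, …`, and `0` past the last part. -/
def part {n : ℕ} (p : n.Partition) (k : ℕ) : ℕ :=
  (p.parts.sort (· ≥ ·)).getD k 0

/-- `φ_m(t) = (1 - t)(1 - t²)⋯(1 - t^m)`, for `t` in the field of rational functions. -/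
noncomputable def phi (m : ℕ) (t : RatFunc ℚ) : RatFunc ℚ :=
  ∏ i ∈ Finset.range m, (1 - t ^ (i + 1))

section R

variable {V : Type u} [Quiver.{v + 1} V] [Fintype V] [DecidableEq V]

/-- `r_lam(q)` for a multipartition `lam` with `|lam| = α`. The product is over all `k ≥ 0` (the
first part has index `0`); the factors with `k` at least the sum of the `α i` are `1`. -/
noncomputable def rMulti {α : V →₀ ℕ} (lam : ∀ i, (α i).Partition) : RatFunc ℚ :=
  ∏ k ∈ Finset.range (∑ i, α i),
    (RatFunc.X ^ (-titsForm fun i => (part (lam i) k : ℤ)) /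
      ∏ i, phi (part (lam i) k - part (lam i) (k + 1)) (RatFunc.X)⁻¹)

variable (V) in
/-- The generating function `r(q) = ∑_α r_α(q) x^α`, where `r_α` is the sum of `r_lam` over the
multipartitions `lam` with `|lam| = α`. -/
noncomputable def rSeries : MvPowerSeries V (RatFunc ℚ) :=
  fun α => ∑ lam : ∀ i, (α i).Partition, rMulti lam

end R

/-! ### The λ-ring of formal power series over the rational functions -/

theorem expand_comap {n : ℕ} (hn : n ≠ 0) :
    nonZeroDivisors (Polynomial ℚ) ≤
      (nonZeroDivisors (Polynomial ℚ)).comap (Polynomial.expand ℚ n) := by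
  intro p hp
  rw [Submonoid.mem_comap, mem_nonZeroDivisors_iff_ne_zero]
  rw [mem_nonZeroDivisors_iff_ne_zero] at hp
  rwa [Ne, Polynomial.expand_eq_zero (Nat.pos_of_ne_zero hn)]

/-- The Adams operation `f(q) ↦ f(q^n)` on rational functions, for `n ≥ 1`. -/
noncomputable def adamsCoeff (n : ℕ) (hn : n ≠ 0) : RatFunc ℚ →+* RatFunc ℚ :=
  RatFunc.mapRingHom (Polynomial.expand ℚ n) (expand_comap hn)

variable {σ : Type u}

/-- The Adams operation `ψ_n` on power series, for `n ≥ 1`: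
`ψ_n (f(q) x^α) = f(q^n) x^(n α)`. -/
noncomputable def adams (n : ℕ) (hn : n ≠ 0) (f : MvPowerSeries σ (RatFunc ℚ)) :
    MvPowerSeries σ (RatFunc ℚ) :=
  MvPowerSeries.expand n hn (MvPowerSeries.map (adamsCoeff n hn) f)

/-- `Ψ(f) = ∑_{n ≥ 1} ψ_n(f) / n` for `f` without constant term. The sum is taken coefficientwise:
if `β ≠ 0`, then `x^β` occurs in `ψ_n(f)` only for `n` at most the degree of `β`. -/
noncomputable def Psi (f : MvPowerSeries σ (RatFunc ℚ)) : MvPowerSeries σ (RatFunc ℚ) :=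
  fun β => ∑ n ∈ Finset.range β.degree,
    (1 / ((n + 1 : ℕ) : RatFunc ℚ)) * MvPowerSeries.coeff β (adams (n + 1) n.succ_ne_zero f)

/-- `Ψ⁻¹(f) = ∑_{n ≥ 1} μ(n) ψ_n(f) / n` for `f` without constant term, with the Möbius
function `μ`. -/
noncomputable def PsiInv (f : MvPowerSeries σ (RatFunc ℚ)) : MvPowerSeries σ (RatFunc ℚ) :=
  fun β => ∑ n ∈ Finset.range β.degree,
    ((ArithmeticFunction.moebius (n + 1) : RatFunc ℚ) / ((n + 1 : ℕ) : RatFunc ℚ)) *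
      MvPowerSeries.coeff β (adams (n + 1) n.succ_ne_zero f)

/-- The plethystic exponential `Exp(f) = exp(∑_{n ≥ 1} ψ_n(f) / n)` of a power series without
constant term. -/
noncomputable def Exp (f : MvPowerSeries σ (RatFunc ℚ)) : MvPowerSeries σ (RatFunc ℚ) :=
  (PowerSeries.exp (RatFunc ℚ)).subst (Psi f)

/-- The plethystic logarithm `Log(f) = ∑_{n ≥ 1} μ(n) ψ_n(log f) / n` of a power series with
constant term `1`. Note that `PowerSeries.log` is the series of `log (1 + X)`. -/
noncomputable def Log (f : MvPowerSeries σ (RatFunc ℚ)) : MvPowerSeries σ (RatFunc ℚ) :=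
  PsiInv ((PowerSeries.log (RatFunc ℚ)).subst (f - 1))

/-- The power structure `Pow(f, g) = Exp(g Log(f))` for a power series `f` with constant term `1`
and an arbitrary power series `g`. -/
noncomputable def Pow (f g : MvPowerSeries σ (RatFunc ℚ)) : MvPowerSeries σ (RatFunc ℚ) :=
  Exp (g * Log f)

/-- The generating function `∑_α p_α(q) x^α` of a family of integer polynomials. -/
noncomputable def genSeries (p : (σ →₀ ℕ) → Polynomial ℤ) : MvPowerSeries σ (RatFunc ℚ) :=
  fun α => algebraMap (Polynomial ℚ) (RatFunc ℚ) ((p α).map (Int.castRingHom ℚ))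

variable (σ) in
/-- The constant power series `q - 1`. -/
noncomputable def qSubOne : MvPowerSeries σ (RatFunc ℚ) :=
  MvPowerSeries.C (RatFunc.X - 1)

end Hua

/-! Fix a finite field with q elements and count in two ways the pairs of a representation on
coordinate spaces of dimension α and a nilpotent endomorphism of it. Let G_α be the product of the
groups GL of size α_i.

Choose the endomorphism first and put λ_k = rank N^k - rank N^(k+1) at each vertex. The number of N
with given ranks is `card_hasRanks`, and an arrow i → j admits q^(Σ_k λ^i_k λ^j_k) intertwining maps
(`card_intertwiners`). The powers of q combine to q^(-T(λ_k)), so the number of pairs is |G_α|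
r_α(q) (`card_nilPairs`).

Choose the representation first: by orbits and stabilizers the number is |G_α| times the sum of |Nil
End M| / |Aut M| over the isomorphism classes M (`IndecFamily.rValue_eq`). Let M be the sum of n_j
copies of indecomposables X_j of dimension γ_j whose residue fields have q^(d_j) elements. Modulo
its radical, End M is a product of matrix algebras over these fields, so the quotient is the product
of w(q^(d_j), n_j) with w(q, n) = q^(-n) / φ_n(q^(-1)) (`card_isNilpotent_div_card_isUnit`,
`card_nilpotent`). Since log Σ w(q, n) x^n = Σ x^n / (n (q^n - 1)) (`derivative_nilWeight`), log r
is the sum of x^(n γ_j) / (n (q^(n d_j) - 1)) over j and n. By Krull–Schmidt, log m is the sum of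
x^(n γ_j) / n.

Galois descent brings in the absolutely indecomposable representations. Each X_j has an endomorphism
annihilated by an irreducible polynomial of degree d_j that generates the residue field. Over the
field with q^k elements the absolutely indecomposable representations are exactly its eigenspaces in
the extensions of the X_j, so a_α(q^k) is the sum of d_j over the j with d_j ∣ k and γ_j = d_j α
(`IndecFamily.numAbsIndecReps_eq`). The two logarithms become the sums of a_α(q^k) x^(kα) / (k (q^k
- 1)) and of a_α(q^k) x^(kα) / k (`isLog_numReps`), which is the theorem at every prime power.

To return to rational functions: the coefficients of (q - 1) Log r and of its Exp have natural
numbers as values at all prime powers, which makes them polynomials over ℚ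
(`exists_polynomial_of_integral_values`). Their coefficients are integers because the quotients of
integer polynomials by monic ones are preserved by Log and Exp, a consequence of Dwork's lemma
(`Log_mem_coeffsIn`, `exp_mem_coeffsIn`). `exists_polynomials_of_counts` puts this together. -/

namespace Hua

open Finset

/-! ### Logarithmic derivatives of formal power series -/

section Euler

variable {σ : Type*} {R : Type*} [CommRing R]

open MvPowerSeries in
/-- The Euler operator: it multiplies the coefficient of `x^α` by the degree of `α`. -/
noncomputable def euler : Derivation R (MvPowerSeries σ R) (MvPowerSeries σ R) :=
  Derivation.mk'
    { toFun := fun f => fun α => (α.degree : R) * coeff α f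
      map_add' := fun f g => by
        ext α
        change (α.degree : R) * coeff α (f + g) = α.degree * coeff α f + α.degree * coeff α g
        rw [map_add, mul_add]
      map_smul' := fun r f => by
        ext α
        change (α.degree : R) * coeff α (r • f) = r * (α.degree * coeff α f)
        rw [coeff_smul]; ring } (by
    classical
    intro f g
    ext α
    change (α.degree : R) * coeff α (f * g) = coeff α (f • _ + g • _)
    rw [map_add, smul_eq_mul, smul_eq_mul, mul_comm g, coeff_mul, coeff_mul, coeff_mul,
      Finset.mul_sum, ← Finset.sum_add_distrib]
    refine Finset.sum_congr rfl fun p hp => ?_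
    change _ = coeff p.1 f * ((p.2.degree : R) * coeff p.2 g) +
      ((p.1.degree : R) * coeff p.1 f) * coeff p.2 g
    rw [← HasAntidiagonal.mem_antidiagonal.1 hp, map_add]
    push_cast; ring)

open MvPowerSeries

@[simp] theorem coeff_euler (f : MvPowerSeries σ R) (α : σ →₀ ℕ) :
    coeff α (euler f) = (α.degree : R) * coeff α f := rfl

theorem coeff_pow_eq_zero_of_degree_lt {g : MvPowerSeries σ R} (hg : constantCoeff g = 0)
    {α : σ →₀ ℕ} {n : ℕ} (h : α.degree < n) : coeff α (g ^ n) = 0 := by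
  apply coeff_of_lt_order
  have h1 : (1 : ℕ∞) ≤ g.order := one_le_order_iff_constCoeff_eq_zero.2 hg
  calc (α.degree : ℕ∞) < n := by exact_mod_cast h
    _ = n • (1 : ℕ∞) := by simp
    _ ≤ n • g.order := nsmul_le_nsmul_right h1 n
    _ ≤ (g ^ n).order := le_order_pow n

/-- The powers `g ^ n` with n above the degree of α do not reach x^α. Any larger bound `N` is
allowed, so that one truncation serves all the coefficients in a convolution. -/
theorem coeff_subst_eq_sum {g : MvPowerSeries σ R} (hg : constantCoeff g = 0)
    (P : PowerSeries R) {α : σ →₀ ℕ} {N : ℕ} (h : α.degree ≤ N) :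
    coeff α (P.subst g) = coeff α (∑ n ∈ range (N + 1), PowerSeries.coeff n P • g ^ n) := by
  rw [PowerSeries.coeff_subst (PowerSeries.HasSubst.of_constantCoeff_zero hg),
    finsum_eq_sum_of_support_subset (s := range (N + 1))]
  · simp [map_sum]
  · intro n hn
    rw [Finset.coe_range, Set.mem_Iio]
    by_contra hN
    apply hn
    simp only
    rw [coeff_pow_eq_zero_of_degree_lt hg (by omega), smul_zero]

/-- The chain rule: it holds for truncations of `P` by the Leibniz rule, and a fixed coefficient
sees only a truncation. -/
theorem euler_subst {g : MvPowerSeries σ R} (hg : constantCoeff g = 0) (P : PowerSeries R) :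
    euler (P.subst g) = (PowerSeries.derivative R P).subst g * euler g := by
  classical
  ext α
  have h1 : coeff α ((PowerSeries.derivative R P).subst g * euler g) =
      coeff α ((∑ n ∈ range (α.degree + 1),
        PowerSeries.coeff n (PowerSeries.derivative R P) • g ^ n) * euler g) := by
    rw [coeff_mul, coeff_mul]
    refine Finset.sum_congr rfl fun p hp => ?_
    rw [coeff_subst_eq_sum hg _ (N := α.degree)]
    rw [← HasAntidiagonal.mem_antidiagonal.1 hp, map_add]
    omega
  rw [h1, coeff_euler, coeff_subst_eq_sum hg P (Nat.le_succ _), ← coeff_euler, map_sum,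
    sum_range_succ', Finset.sum_mul]
  simp only [map_sum, map_add]
  have h0 : euler (PowerSeries.coeff 0 P • g ^ 0) = 0 := by simp
  rw [h0, map_zero, add_zero]
  refine Finset.sum_congr rfl fun n _ => ?_
  congr 1
  rw [Derivation.map_smul, Derivation.leibniz_pow, PowerSeries.coeff_derivative]
  simp only [Nat.add_sub_cancel, smul_eq_mul, ← Nat.cast_smul_eq_nsmul R, smul_smul,
    smul_mul_assoc]
  push_cast; rfl

/-- `g` is the logarithm of `f`. -/
structure IsLog (f g : MvPowerSeries σ R) : Prop where
  left : constantCoeff f = 1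
  right : constantCoeff g = 0
  -- In characteristic 0 this equation is a recursion on the degree, so together with the two
  -- constant terms it makes f and g determine each other. No composition of exp and log is needed.
  euler_eq : euler f = f * euler g

/-- Reduces an identity of logarithms to the differential equation P' = P Q' in one variable. It
serves exp, log, the geometric series and the series of `nilWeight`. -/
theorem isLog_subst {P Q : PowerSeries R} (hP : PowerSeries.constantCoeff P = 1)
    (hQ : PowerSeries.constantCoeff Q = 0)
    (h : PowerSeries.derivative R P = P * PowerSeries.derivative R Q)
    {g : MvPowerSeries σ R} (hg : constantCoeff g = 0) : IsLog (P.subst g) (Q.subst g) := by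
  have hs := PowerSeries.HasSubst.of_constantCoeff_zero hg
  refine ⟨?_, PowerSeries.constantCoeff_subst_eq_zero hg _ hQ, ?_⟩
  · have := coeff_subst_eq_sum hg P (α := 0) (N := 0) (by simp)
    simpa [hP] using this
  · rw [euler_subst hg, euler_subst hg, h, PowerSeries.subst_mul hs, mul_assoc]

theorem IsLog.one : IsLog (1 : MvPowerSeries σ R) 0 :=
  ⟨by simp, by simp, by simp⟩

theorem IsLog.mul {f g f' g' : MvPowerSeries σ R} (h : IsLog f g) (h' : IsLog f' g') :
    IsLog (f * f') (g + g') := by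
  refine ⟨by simp [h.left, h'.left], by simp [h.right, h'.right], ?_⟩
  rw [Derivation.leibniz, h.euler_eq, h'.euler_eq, map_add, smul_eq_mul, smul_eq_mul]
  ring

theorem IsLog.prod {ι : Type*} {s : Finset ι} {f g : ι → MvPowerSeries σ R}
    (h : ∀ i ∈ s, IsLog (f i) (g i)) : IsLog (∏ i ∈ s, f i) (∑ i ∈ s, g i) := by
  classical
  induction s using Finset.induction_on with
  | empty => simpa using IsLog.one
  | insert i s hi ih =>
    rw [Finset.prod_insert hi, Finset.sum_insert hi]
    exact (h i (by simp)).mul (ih fun j hj => h j (by simp [hj]))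

end Euler

/-! ### Coefficient recursions for exponentials and logarithms -/

section ExpLog

variable {σ : Type*} {K : Type*} [Field K] [CharZero K]

open MvPowerSeries

theorem isLog_exp {g : MvPowerSeries σ K} (hg : constantCoeff g = 0) :
    IsLog ((PowerSeries.exp K).subst g) g := by
  have h := isLog_subst (P := PowerSeries.exp K) (Q := PowerSeries.X)
    PowerSeries.constantCoeff_exp (by simp) (by simp [PowerSeries.derivative_exp]) hg
  rwa [PowerSeries.subst_X (PowerSeries.HasSubst.of_constantCoeff_zero hg)] at h

theorem isLog_log {f : MvPowerSeries σ K} (hf : constantCoeff f = 1) :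
    IsLog f ((PowerSeries.log K).subst (f - 1)) := by
  have hg : constantCoeff (f - 1) = 0 := by simp [hf]
  have hs := PowerSeries.HasSubst.of_constantCoeff_zero hg
  have h := isLog_subst (P := 1 + PowerSeries.X) (Q := PowerSeries.log K) (by simp) (by simp) ?_ hg
  · have h1 : (1 : PowerSeries K).subst (f - 1) = (1 : MvPowerSeries σ K) := by
      rw [← PowerSeries.coe_substAlgHom hs, map_one]
    rwa [PowerSeries.subst_add hs, PowerSeries.subst_X hs, h1, add_sub_cancel] at h
  · rw [PowerSeries.deriv_log, map_add, add_mul, one_mul]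
    ext n
    cases n with
    | zero => simp
    | succ n => simp [PowerSeries.coeff_succ_X_mul, pow_succ, PowerSeries.coeff_one]

/-- The Euler equation divided by the degree. The term with `p.2 = 0` vanishes, so only coefficients
of f of smaller degree occur on the right. -/
theorem IsLog.coeff_left {f g : MvPowerSeries σ K} [DecidableEq σ] (h : IsLog f g) {α : σ →₀ ℕ}
    (hα : α ≠ 0) : coeff α f =
      (α.degree : K)⁻¹ * ∑ p ∈ antidiagonal α with p.2 ≠ 0,
        coeff p.1 f * (p.2.degree * coeff p.2 g) := by
  have h1 : (α.degree : K) ≠ 0 := by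
    rw [Ne, Nat.cast_eq_zero, Finsupp.degree_eq_zero_iff]; exact hα
  rw [eq_inv_mul_iff_mul_eq₀ h1, ← coeff_euler, h.euler_eq, coeff_mul, Finset.sum_filter]
  refine Finset.sum_congr rfl fun p _ => ?_
  split_ifs with hp
  · rfl
  · rw [not_not] at hp; simp [hp]

/-- The same recursion solved for g: the term `(0, α)` is isolated, and its factor is the constant
term 1 of f. -/
theorem IsLog.coeff_right {f g : MvPowerSeries σ K} [DecidableEq σ] (h : IsLog f g) {α : σ →₀ ℕ}
    (hα : α ≠ 0) : coeff α g = coeff α f -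
      (α.degree : K)⁻¹ * ∑ p ∈ antidiagonal α with p.2 ≠ 0 ∧ p.2 ≠ α,
        coeff p.1 f * (p.2.degree * coeff p.2 g) := by
  have h1 : (α.degree : K) ≠ 0 := by
    rw [Ne, Nat.cast_eq_zero, Finsupp.degree_eq_zero_iff]; exact hα
  have h2 := h.coeff_left hα
  rw [← Finset.sum_filter_add_sum_filter_not _ (fun p => p.2 ≠ α), Finset.filter_filter,
    Finset.filter_filter, mul_add] at h2
  have h3 : (antidiagonal α).filter (fun p => p.2 ≠ 0 ∧ ¬ p.2 ≠ α) = {(0, α)} := by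
    ext ⟨a, b⟩
    simp only [Finset.mem_filter, HasAntidiagonal.mem_antidiagonal, not_not, Finset.mem_singleton, Prod.mk.injEq]
    constructor
    · rintro ⟨h, -, rfl⟩; exact ⟨by simpa using h, rfl⟩
    · rintro ⟨rfl, rfl⟩; simpa using hα
  rw [h3, Finset.sum_singleton, coeff_zero_eq_constantCoeff_apply, h.left, one_mul,
    inv_mul_cancel_left₀ h1] at h2
  rw [h2]; ring

theorem degree_fst_lt {σ : Type*} [DecidableEq σ] {α : σ →₀ ℕ} {p : (σ →₀ ℕ) × (σ →₀ ℕ)}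
    (hp : p ∈ antidiagonal α) (h : p.2 ≠ 0) : p.1.degree < α.degree := by
  rw [← HasAntidiagonal.mem_antidiagonal.1 hp, map_add]
  have := (Finsupp.degree_eq_zero_iff p.2).not.2 h
  omega

theorem degree_snd_lt {σ : Type*} [DecidableEq σ] {α : σ →₀ ℕ} {p : (σ →₀ ℕ) × (σ →₀ ℕ)}
    (hp : p ∈ antidiagonal α) (h : p.2 ≠ α) : p.2.degree < α.degree := by
  have h2 := HasAntidiagonal.mem_antidiagonal.1 hp
  have : p.1 ≠ 0 := fun h0 => h (by rw [← h2, h0, zero_add])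
  have := (Finsupp.degree_eq_zero_iff p.1).not.2 this
  rw [← h2, map_add]; omega

theorem degree_fst_le {σ : Type*} [DecidableEq σ] {α : σ →₀ ℕ} {p : (σ →₀ ℕ) × (σ →₀ ℕ)}
    (hp : p ∈ antidiagonal α) : p.1.degree ≤ α.degree := by
  rw [← HasAntidiagonal.mem_antidiagonal.1 hp, map_add]; omega

/-- A relation between coefficients that is compatible with the field operations passes from
logarithms to exponentials. -/
theorem IsLog.rel_left {K' : Type*} [Field K'] [CharZero K'] {S : Subring (K × K')}
    (hinv : ∀ n : ℕ, ((n : K)⁻¹, (n : K')⁻¹) ∈ S)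
    {f g : MvPowerSeries σ K} {f' g' : MvPowerSeries σ K'} (h : IsLog f g) (h' : IsLog f' g')
    {n : ℕ} (hg : ∀ α, α.degree ≤ n → (coeff α g, coeff α g') ∈ S) (α : σ →₀ ℕ)
    (hα : α.degree ≤ n) : (coeff α f, coeff α f') ∈ S := by
  classical
  induction hd : α.degree using Nat.strong_induction_on generalizing α with
  | _ d ih =>
    by_cases h0 : α = 0
    · subst h0
      rw [coeff_zero_eq_constantCoeff_apply, coeff_zero_eq_constantCoeff_apply, h.left, h'.left]
      exact S.one_mem
    · rw [h.coeff_left h0, h'.coeff_left h0]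
      have : ∑ p ∈ antidiagonal α with p.2 ≠ 0, (coeff p.1 f, coeff p.1 f') *
          ((p.2.degree : K × K') * (coeff p.2 g, coeff p.2 g')) ∈ S := by
        refine S.sum_mem fun p hp => ?_
        rw [Finset.mem_filter] at hp
        have h1 := degree_fst_lt hp.1 hp.2
        have h2 : p.2.degree ≤ α.degree := by
          rw [← HasAntidiagonal.mem_antidiagonal.1 hp.1, map_add]; omega
        exact S.mul_mem (ih _ (hd ▸ h1) _ (by omega) rfl)
          (S.mul_mem (natCast_mem S _) (hg _ (by omega)))
      have h3 := S.mul_mem (hinv α.degree) this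
      convert h3 using 1
      ext <;> simp [Prod.fst_sum, Prod.snd_sum]

/-- A relation between coefficients that is compatible with the field operations passes from
exponentials to logarithms. -/
theorem IsLog.rel_right {K' : Type*} [Field K'] [CharZero K'] {S : Subring (K × K')}
    (hinv : ∀ n : ℕ, ((n : K)⁻¹, (n : K')⁻¹) ∈ S)
    {f g : MvPowerSeries σ K} {f' g' : MvPowerSeries σ K'} (h : IsLog f g) (h' : IsLog f' g')
    {n : ℕ} (hf : ∀ α, α.degree ≤ n → (coeff α f, coeff α f') ∈ S) (α : σ →₀ ℕ)
    (hα : α.degree ≤ n) : (coeff α g, coeff α g') ∈ S := by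
  classical
  induction hd : α.degree using Nat.strong_induction_on generalizing α with
  | _ d ih =>
    by_cases h0 : α = 0
    · subst h0
      rw [coeff_zero_eq_constantCoeff_apply, coeff_zero_eq_constantCoeff_apply, h.right, h'.right]
      exact S.zero_mem
    · rw [h.coeff_right h0, h'.coeff_right h0]
      have : ∑ p ∈ antidiagonal α with p.2 ≠ 0 ∧ p.2 ≠ α, (coeff p.1 f, coeff p.1 f') *
          ((p.2.degree : K × K') * (coeff p.2 g, coeff p.2 g')) ∈ S := by
        refine S.sum_mem fun p hp => ?_
        rw [Finset.mem_filter] at hp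
        have h1 := degree_snd_lt hp.1 hp.2.2
        have h2 := degree_fst_le hp.1
        exact S.mul_mem (hf _ (by omega))
          (S.mul_mem (natCast_mem S _) (ih _ (hd ▸ h1) _ (by omega) rfl))
      have h3 := S.sub_mem (hf _ hα) (S.mul_mem (hinv α.degree) this)
      convert h3 using 1
      ext <;> simp [Prod.fst_sum, Prod.snd_sum]

/-- The diagonal of `K × K`. -/
def diagSubring (K : Type*) [CommRing K] : Subring (K × K) :=
  RingHom.eqLocus (RingHom.fst K K) (RingHom.snd K K)

/-- Equality of coefficients is the relation given by the diagonal subring. -/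
theorem IsLog.agree_left {f g f' g' : MvPowerSeries σ K} (h : IsLog f g) (h' : IsLog f' g')
    {n : ℕ} (hg : ∀ α, α.degree ≤ n → coeff α g = coeff α g') (α : σ →₀ ℕ)
    (hα : α.degree ≤ n) : coeff α f = coeff α f' :=
  h.rel_left (S := diagSubring K) (fun _ => rfl) h' hg α hα

theorem IsLog.eq_of_log_eq {f g f' : MvPowerSeries σ K} (h : IsLog f g) (h' : IsLog f' g) :
    f = f' := by
  ext α; exact h.agree_left h' (n := α.degree) (fun _ _ => rfl) α le_rfl

end ExpLog

end Hua

namespace Hua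

open Finset Polynomial

/-! ### Values and integrality of rational functions -/

section RatFunc

theorem adamsCoeff_algebraMap {n : ℕ} (hn : n ≠ 0) (p : ℚ[X]) :
    adamsCoeff n hn (algebraMap ℚ[X] (RatFunc ℚ) p) = algebraMap ℚ[X] (RatFunc ℚ) (expand ℚ n p) := by
  have := RatFunc.map_apply_div (expand ℚ n) (expand_comap hn) p 1
  rwa [map_one, map_one, div_one, map_one, div_one] at this

/-- The Adams operation on rational functions, as a family indexed by all natural numbers. -/
noncomputable def psi (n : ℕ) : RatFunc ℚ →+* RatFunc ℚ :=
  if hn : n ≠ 0 then adamsCoeff n hn else RingHom.id _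

theorem psi_of_ne_zero {n : ℕ} (hn : n ≠ 0) : psi n = adamsCoeff n hn := dif_pos hn

theorem psi_algebraMap {n : ℕ} (hn : n ≠ 0) (p : ℚ[X]) :
    psi n (algebraMap ℚ[X] (RatFunc ℚ) p) = algebraMap ℚ[X] (RatFunc ℚ) (expand ℚ n p) := by
  rw [psi_of_ne_zero hn, adamsCoeff_algebraMap]

theorem exists_eq_div (f : RatFunc ℚ) : ∃ p s : ℚ[X], s ≠ 0 ∧
    f = algebraMap ℚ[X] (RatFunc ℚ) p / algebraMap ℚ[X] (RatFunc ℚ) s :=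
  ⟨f.num, f.denom, f.denom_ne_zero, (RatFunc.num_div_denom f).symm⟩

theorem psi_mul {m n : ℕ} (hm : m ≠ 0) (hn : n ≠ 0) (f : RatFunc ℚ) :
    psi (m * n) f = psi m (psi n f) := by
  obtain ⟨p, s, -, rfl⟩ := exists_eq_div f
  simp only [map_div₀, psi_algebraMap hm, psi_algebraMap hn, psi_algebraMap (mul_ne_zero hm hn),
    expand_expand]

theorem psi_one (f : RatFunc ℚ) : psi 1 f = f := by
  obtain ⟨p, s, -, rfl⟩ := exists_eq_div f
  simp only [map_div₀, psi_algebraMap one_ne_zero, expand_one]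

/-- The pairs of a rational function that is regular at `n` and its value at `n`. -/
def valSubring (n : ℕ) : Subring (RatFunc ℚ × ℚ) where
  -- Evaluation is a relation with cleared denominators, so no value has to be assigned at a pole,
  -- and being a subring expresses all its compatibilities at once.
  carrier := {x | ∃ p s : ℚ[X], s.eval (n : ℚ) ≠ 0 ∧
    x.1 * algebraMap ℚ[X] (RatFunc ℚ) s = algebraMap ℚ[X] (RatFunc ℚ) p ∧
    x.2 * s.eval (n : ℚ) = p.eval (n : ℚ)}
  one_mem' := ⟨1, 1, by simp, by simp, by simp⟩
  zero_mem' := ⟨0, 1, by simp, by simp, by simp⟩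
  mul_mem' := by
    rintro x y ⟨p, s, h1, h2, h3⟩ ⟨p', s', h1', h2', h3'⟩
    refine ⟨p * p', s * s', by simp [h1, h1'], ?_, ?_⟩
    · rw [map_mul, map_mul, ← h2, ← h2', Prod.fst_mul]; ring
    · rw [eval_mul, eval_mul, ← h3, ← h3', Prod.snd_mul]; ring
  add_mem' := by
    rintro x y ⟨p, s, h1, h2, h3⟩ ⟨p', s', h1', h2', h3'⟩
    refine ⟨p * s' + p' * s, s * s', by simp [h1, h1'], ?_, ?_⟩
    · rw [map_mul, map_add, map_mul, map_mul, ← h2, ← h2', Prod.fst_add]; ring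
    · rw [eval_mul, eval_add, eval_mul, eval_mul, ← h3, ← h3', Prod.snd_add]; ring
  neg_mem' := by
    rintro x ⟨p, s, h1, h2, h3⟩
    exact ⟨-p, s, h1, by simp [h2], by simp [h3]⟩

theorem algebraMap_mem_valSubring (n : ℕ) (p : ℚ[X]) :
    (algebraMap ℚ[X] (RatFunc ℚ) p, p.eval (n : ℚ)) ∈ valSubring n :=
  ⟨p, 1, by simp, by simp, by simp⟩

theorem X_mem_valSubring (n : ℕ) : (RatFunc.X, (n : ℚ)) ∈ valSubring n := by
  simpa using algebraMap_mem_valSubring n X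

theorem inv_mem_valSubring {n : ℕ} {f : RatFunc ℚ} {v : ℚ} (h : (f, v) ∈ valSubring n)
    (hv : v ≠ 0) : (f⁻¹, v⁻¹) ∈ valSubring n := by
  obtain ⟨p, s, h1, h2, h3⟩ := h
  have hp : p.eval (n : ℚ) ≠ 0 := h3 ▸ mul_ne_zero hv h1
  have hs0 : s ≠ 0 := by rintro rfl; simp at h1
  have hs : algebraMap ℚ[X] (RatFunc ℚ) s ≠ 0 := by simpa using hs0
  have hp0 : p ≠ 0 := by rintro rfl; simp at hp
  have hf : f ≠ 0 := by
    rintro rfl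
    rw [zero_mul] at h2
    exact hp0 ((map_eq_zero_iff _ (IsFractionRing.injective ℚ[X] (RatFunc ℚ))).1 h2.symm)
  refine ⟨s, p, hp, ?_, ?_⟩
  · rw [← h2]; exact inv_mul_cancel_left₀ hf _
  · rw [← h3]; exact inv_mul_cancel_left₀ hv _

theorem natCast_inv_mem_valSubring (n k : ℕ) : ((k : RatFunc ℚ)⁻¹, (k : ℚ)⁻¹) ∈ valSubring n := by
  by_cases hk : k = 0
  · subst hk
    simp only [Nat.cast_zero, inv_zero]
    exact (valSubring n).zero_mem
  · exact inv_mem_valSubring (natCast_mem (valSubring n) k) (by exact_mod_cast hk)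

/-- The value of f(q^k) at n is the value of f at n^k. This is why counts over all the extension
fields are needed together. -/
theorem psi_mem_valSubring {n k : ℕ} (hk : k ≠ 0) {f : RatFunc ℚ} {v : ℚ}
    (h : (f, v) ∈ valSubring (n ^ k)) : (psi k f, v) ∈ valSubring n := by
  obtain ⟨p, s, h1, h2, h3⟩ := h
  push_cast at h1 h3
  refine ⟨expand ℚ k p, expand ℚ k s, by rwa [expand_eval], ?_, by simpa only [expand_eval] using h3⟩
  rw [← psi_algebraMap hk, ← psi_algebraMap hk, ← h2, map_mul]

theorem eq_of_mem_valSubring {n : ℕ} {p s : ℚ[X]} {f : RatFunc ℚ} {v : ℚ}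
    (h : (f, v) ∈ valSubring n)
    (hf : f * algebraMap ℚ[X] (RatFunc ℚ) s = algebraMap ℚ[X] (RatFunc ℚ) p) :
    v * s.eval (n : ℚ) = p.eval (n : ℚ) := by
  obtain ⟨p', s', h1, h2, h3⟩ := h
  have h4 : p' * s = p * s' := by
    apply IsFractionRing.injective ℚ[X] (RatFunc ℚ)
    rw [map_mul, map_mul, ← h2, ← hf]; ring
  have h5 := congrArg (eval (n : ℚ)) h4
  rw [eval_mul, eval_mul, ← h3] at h5
  apply mul_right_cancel₀ h1
  linarith

/-- A rational function with integral values at infinitely many natural numbers is a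
polynomial. -/
theorem exists_polynomial_of_integral_values {f : RatFunc ℚ} {S : Set ℕ} (hS : S.Infinite)
    (h : ∀ n ∈ S, ∃ z : ℤ, (f, (z : ℚ)) ∈ valSubring n) :
    ∃ p : ℚ[X], f = algebraMap ℚ[X] (RatFunc ℚ) p := by
  set s := f.denom with hs
  have hm : s.Monic := RatFunc.monic_denom f
  have hs0 : algebraMap ℚ[X] (RatFunc ℚ) s ≠ 0 := by simpa using f.denom_ne_zero
  have hf : f * algebraMap ℚ[X] (RatFunc ℚ) s = algebraMap ℚ[X] (RatFunc ℚ) f.num := by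
    conv_lhs => rw [← RatFunc.num_div_denom f]
    exact div_mul_cancel₀ _ hs0
  -- Write f = A + B / s with deg B < deg s; the aim is B = 0.
  set A := f.num /ₘ s
  set B := f.num %ₘ s
  have hAB : B + s * A = f.num := modByMonic_add_div f.num s
  have hdeg : B.degree < s.degree := degree_modByMonic_lt _ hm
  -- The integer b clears the denominators of A, so b f(n) - b A(n) is an integer whenever f(n) is
  -- one.
  obtain ⟨b, hb0, hb⟩ := IsLocalization.integerNormalization_spec (nonZeroDivisors ℤ) A
  set A' := IsLocalization.integerNormalization (nonZeroDivisors ℤ) A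
  have hb0' : (b : ℚ) ≠ 0 := by
    have := nonZeroDivisors.ne_zero hb0
    exact_mod_cast this
  -- That integer is b B(n) / s(n), which tends to 0. So it vanishes for large n, and B has
  -- infinitely many roots.
  have hlim : Filter.Tendsto (fun n : ℕ => ((C (b : ℚ) * B).eval (n : ℚ)) / s.eval (n : ℚ))
      Filter.atTop (nhds 0) :=
    (div_tendsto_atTop_zero_of_degree_lt (C (b : ℚ) * B) s
      (by rwa [degree_C_mul hb0'])).comp tendsto_natCast_atTop_atTop
  have hev := hlim.eventually (Metric.ball_mem_nhds 0 one_pos)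
  have hs1 : ∀ᶠ n : ℕ in Filter.atTop, s.eval (n : ℚ) ≠ 0 := by
    rw [← Nat.cofinite_eq_atTop]
    refine Set.Finite.subset ((s.roots.toFinset.finite_toSet).preimage
      (f := fun n : ℕ => (n : ℚ)) Nat.cast_injective.injOn) ?_
    intro n hn
    have : s.eval (n : ℚ) = 0 := by simpa using hn
    simpa [hm.ne_zero, IsRoot] using this
  obtain ⟨N, hN⟩ := Filter.eventually_atTop.1 (hev.and hs1)
  have hB : B = 0 := by
    apply eq_zero_of_infinite_isRoot
    refine Set.Infinite.mono ?_ ((hS.sdiff (Set.finite_Iio N)).image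
      (f := fun n : ℕ => (n : ℚ)) Nat.cast_injective.injOn)
    rintro _ ⟨n, ⟨hnS, hnN⟩, rfl⟩
    obtain ⟨z, hz⟩ := h n hnS
    obtain ⟨h1, h2⟩ := hN n (by simpa using hnN)
    have h3 := eq_of_mem_valSubring hz hf
    have h4 : (b : ℚ) * A.eval (n : ℚ) = ((A'.eval (n : ℤ) : ℤ) : ℚ) := by
      have := congrArg (eval (n : ℚ)) hb
      rw [eval_smul, zsmul_eq_mul] at this
      rw [← this, ← Int.cast_natCast n, eval_intCast_map]
      simp
    rw [← hAB, eval_add, eval_mul] at h3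
    have h5 : ((b * z - A'.eval (n : ℤ) : ℤ) : ℚ) =
        (C (b : ℚ) * B).eval (n : ℚ) / s.eval (n : ℚ) := by
      rw [eq_div_iff h2]
      push_cast
      rw [← h4, eval_mul, eval_C]
      linear_combination (b : ℚ) * h3
    rw [dist_zero_right, ← h5, Int.norm_cast_rat] at h1
    have h6 : b * z - A'.eval (n : ℤ) = 0 := by
      rw [Int.norm_eq_abs] at h1
      exact Int.abs_lt_one_iff.1 (by exact_mod_cast h1)
    rw [h6, Int.cast_zero, eq_comm, div_eq_zero_iff, or_iff_left h2, eval_mul, eval_C] at h5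
    exact (mul_eq_zero.1 h5).resolve_left hb0'
  refine ⟨A, ?_⟩
  rw [hB, zero_add] at hAB
  rw [← hAB, map_mul, mul_comm] at hf
  exact mul_left_cancel₀ hs0 hf

/-- The inclusion of the integer polynomials into the rational functions. -/
noncomputable def intPoly : ℤ[X] →+* RatFunc ℚ :=
  (algebraMap ℚ[X] (RatFunc ℚ)).comp (mapRingHom (Int.castRingHom ℚ))

theorem intPoly_injective : Function.Injective intPoly :=
  (IsFractionRing.injective ℚ[X] (RatFunc ℚ)).comp
    (map_injective (Int.castRingHom ℚ) Int.cast_injective)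

/-- The rational functions that are quotients of integer polynomials by monic integer
polynomials. -/
noncomputable def monicSubring : Subring (RatFunc ℚ) where
  carrier := {f | ∃ p s : ℤ[X], s.Monic ∧ f * intPoly s = intPoly p}
  one_mem' := ⟨1, 1, monic_one, by simp⟩
  zero_mem' := ⟨0, 1, monic_one, by simp⟩
  mul_mem' := by
    rintro x y ⟨p, s, h1, h2⟩ ⟨p', s', h1', h2'⟩
    refine ⟨p * p', s * s', h1.mul h1', ?_⟩
    rw [map_mul, map_mul, ← h2, ← h2']; ring
  add_mem' := by
    rintro x y ⟨p, s, h1, h2⟩ ⟨p', s', h1', h2'⟩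
    refine ⟨p * s' + p' * s, s * s', h1.mul h1', ?_⟩
    rw [map_mul, map_add, map_mul, map_mul, ← h2, ← h2']; ring
  neg_mem' := by
    rintro x ⟨p, s, h1, h2⟩
    exact ⟨-p, s, h1, by simp [h2]⟩

theorem intPoly_mem (p : ℤ[X]) : intPoly p ∈ monicSubring :=
  ⟨p, 1, monic_one, by simp⟩

theorem intPoly_inv_mem {s : ℤ[X]} (hs : s.Monic) : (intPoly s)⁻¹ ∈ monicSubring :=
  ⟨1, s, hs, by
    rw [map_one]
    exact inv_mul_cancel₀ ((map_ne_zero_iff _ intPoly_injective).2 hs.ne_zero)⟩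

theorem psi_intPoly {n : ℕ} (hn : n ≠ 0) (p : ℤ[X]) : psi n (intPoly p) = intPoly (expand ℤ n p) := by
  simp only [intPoly, RingHom.comp_apply, psi_algebraMap hn, coe_mapRingHom, map_expand]

theorem psi_mem_monicSubring {n : ℕ} (hn : n ≠ 0) {f : RatFunc ℚ} (hf : f ∈ monicSubring) :
    psi n f ∈ monicSubring := by
  obtain ⟨p, s, h1, h2⟩ := hf
  refine ⟨expand ℤ n p, expand ℤ n s, h1.expand (Nat.pos_of_ne_zero hn), ?_⟩
  rw [← psi_intPoly hn, ← psi_intPoly hn, ← h2, map_mul]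

/-- Over the field with p elements f(x^p) = f(x)^p. -/
theorem dvd_expand_sub_pow {p : ℕ} [hp : Fact p.Prime] (f : ℤ[X]) :
    (p : ℤ[X]) ∣ expand ℤ p f - f ^ p := by
  have h : (C (p : ℤ) : ℤ[X]) ∣ expand ℤ p f - f ^ p := by
    rw [C_dvd_iff_dvd_coeff]
    intro i
    rw [← ZMod.intCast_zmod_eq_zero_iff_dvd, ← eq_intCast (Int.castRingHom (ZMod p)), ← coeff_map]
    rw [Polynomial.map_sub, Polynomial.map_pow, map_expand, ZMod.expand_card, sub_self, coeff_zero]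
  simpa using h

/-- The Adams operations lift the Frobenius endomorphisms. -/
theorem exists_psi_sub_pow {p : ℕ} (hp : p.Prime) {f : RatFunc ℚ} (hf : f ∈ monicSubring) :
    ∃ g ∈ monicSubring, psi p f - f ^ p = p * g := by
  have := Fact.mk hp
  obtain ⟨a, s, h1, h2⟩ := hf
  obtain ⟨c, hc⟩ := dvd_expand_sub_pow (p := p) a
  obtain ⟨d, hd⟩ := dvd_expand_sub_pow (p := p) s
  have hs : intPoly s ≠ 0 := (map_ne_zero_iff _ intPoly_injective).2 h1.ne_zero
  have hm := h1.expand (p := p) hp.pos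
  have hs' : intPoly (expand ℤ p s) ≠ 0 := (map_ne_zero_iff _ intPoly_injective).2 hm.ne_zero
  -- With a(q^p) = a^p + p c and s(q^p) = s^p + p d, the difference a(q^p)/s(q^p) - a^p/s^p has
  -- numerator p (c s^p - a^p d), and its denominator s(q^p) s^p is monic.
  refine ⟨intPoly (c * s ^ p - a ^ p * d) * (intPoly (expand ℤ p s))⁻¹ * (intPoly s ^ p)⁻¹, ?_, ?_⟩
  · rw [← map_pow]
    exact mul_mem (mul_mem (intPoly_mem _) (intPoly_inv_mem hm)) (intPoly_inv_mem (h1.pow p))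
  · have hf : f = intPoly a / intPoly s := by rw [← h2]; exact (mul_div_cancel_right₀ _ hs).symm
    have hc' := congrArg intPoly hc
    have hd' := congrArg intPoly hd
    simp only [map_sub, map_mul, map_pow, map_natCast] at hc' hd'
    rw [hf, map_div₀, psi_intPoly hp.ne_zero, psi_intPoly hp.ne_zero, div_pow]
    simp only [map_sub, map_mul, map_pow]
    have hsp : intPoly s ^ p ≠ 0 := pow_ne_zero _ hs
    generalize intPoly s ^ p = t at *
    field_simp
    linear_combination t * hc' - intPoly a ^ p * hd'

/-- Division by a monic polynomial can be carried out over ℤ and commutes with the passage to ℚ,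
where it is exact with quotient p. -/
theorem exists_intPoly_of_mem {p : ℚ[X]} (h : algebraMap ℚ[X] (RatFunc ℚ) p ∈ monicSubring) :
    ∃ P : ℤ[X], P.map (Int.castRingHom ℚ) = p := by
  obtain ⟨a, s, h1, h2⟩ := h
  have h3 : p * s.map (Int.castRingHom ℚ) = a.map (Int.castRingHom ℚ) := by
    apply IsFractionRing.injective ℚ[X] (RatFunc ℚ)
    rw [map_mul]; exact h2
  refine ⟨a /ₘ s, ?_⟩
  rw [map_divByMonic _ h1]
  exact (div_modByMonic_unique p 0 (h1.map _) ⟨by rw [zero_add, mul_comm, h3], by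
    rw [degree_zero, bot_lt_iff_ne_bot, Ne, degree_eq_bot]
    exact (h1.map _).ne_zero⟩).1

theorem eval_of_mem_valSubring {n : ℕ} {p : ℚ[X]} {v : ℚ}
    (h : (algebraMap ℚ[X] (RatFunc ℚ) p, v) ∈ valSubring n) : p.eval (n : ℚ) = v := by
  simpa using (eq_of_mem_valSubring h (s := 1) (p := p) (by simp)).symm

end RatFunc

end Hua

namespace Hua

open Finset

/-! ### Ghost components -/

section Ghost

variable {A : Type*} [CommRing A]

theorem natCast_dvd_of_prime_pow_dvd {n : ℕ} (hn : n ≠ 0) {x : A}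
    (h : ∀ p : ℕ, p.Prime → ((p ^ n.factorization p : ℕ) : A) ∣ x) : (n : A) ∣ x := by
  rw [← Nat.prod_factorization_pow_eq_self hn, Finsupp.prod, Nat.cast_prod]
  refine Finset.prod_dvd_of_coprime (fun p hp p' hp' hne => ?_) fun p hp =>
    h p (Nat.prime_of_mem_primeFactors hp)
  have h1 : Nat.Coprime (p ^ n.factorization p) (p' ^ n.factorization p') :=
    Nat.Coprime.pow _ _ ((Nat.coprime_primes (Nat.prime_of_mem_primeFactors hp)
      (Nat.prime_of_mem_primeFactors hp')).2 hne)
  have h2 := (Nat.isCoprime_iff_coprime.2 h1).map (Int.castRingHom A)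
  simpa using h2

/-- Dwork's lemma: if the `ψ n` are commuting lifts of Frobenius then `(ψ n a)` is a ghost
vector. -/
theorem exists_ghost (ψ : ℕ → A →+* A)
    (hmul : ∀ m n a, m ≠ 0 → n ≠ 0 → ψ (m * n) a = ψ m (ψ n a))
    (hfrob : ∀ p : ℕ, p.Prime → ∀ a, (p : A) ∣ ψ p a - a ^ p) (a : A) (N : ℕ) :
    ∃ c : ℕ → A, ∀ n, n ≠ 0 → n ≤ N → ψ n a = ∑ d ∈ n.divisors, (d : A) * c d ^ (n / d) := by
  induction N with
  | zero => exact ⟨fun _ => 0, fun n h h' => absurd (Nat.le_zero.1 h') h⟩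
  | succ N ih =>
    obtain ⟨c, hc⟩ := ih
    set n := N + 1 with hn
    have hn0 : n ≠ 0 := by omega
    -- The equation for n contains the new unknown only as n c_n, so exactly this divisibility is
    -- required. It is checked one prime power at a time.
    have key : (n : A) ∣ ψ n a - ∑ d ∈ n.properDivisors, (d : A) * c d ^ (n / d) := by
      refine natCast_dvd_of_prime_pow_dvd hn0 fun p hp => ?_
      by_cases hpn : p ∣ n
      swap
      · simp [Nat.factorization_eq_zero_of_not_dvd hpn]
      obtain ⟨m, hm⟩ := hpn
      have hm0 : m ≠ 0 := by rintro rfl; omega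
      have hmN : m ≤ N := by
        have := hp.two_le
        nlinarith [Nat.pos_of_ne_zero hm0]
      have hsub : m.divisors ⊆ n.properDivisors := by
        intro d hd
        rw [Nat.mem_properDivisors]
        have hdm := Nat.dvd_of_mem_divisors hd
        exact ⟨hm ▸ hdm.mul_left p, by have := Nat.le_of_dvd (Nat.pos_of_ne_zero hm0) hdm; omega⟩
      -- With n = p m, apply ψ_p to the ghost expansion of ψ_m(a). Its terms are matched with the
      -- divisors d of m; the other proper divisors of n are treated separately.
      rw [← Finset.sum_sdiff hsub, hm, hmul p m a hp.ne_zero hm0, hc m hm0 hmN, map_sum, ← hm,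
        sub_add_eq_sub_sub_swap, ← Finset.sum_sub_distrib]
      refine dvd_sub (Finset.dvd_sum fun d hd => ?_) (Finset.dvd_sum fun d hd => ?_)
      · have hdm := Nat.dvd_of_mem_divisors hd
        obtain ⟨e, he⟩ := hdm
        have hd0 : d ≠ 0 := by rintro rfl; simp at he; exact hm0 he
        have he0 : e ≠ 0 := by rintro rfl; simp at he; exact hm0 he
        have e1 : m / d = e := by rw [he]; exact Nat.mul_div_cancel_left _ (Nat.pos_of_ne_zero hd0)
        have e2 : n / d = p * e := by
          rw [hm, he, mul_left_comm]; exact Nat.mul_div_cancel_left _ (Nat.pos_of_ne_zero hd0)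
        rw [map_mul, map_natCast, map_pow, ← mul_sub, e1, e2, pow_mul]
        set t := e.factorization p
        obtain ⟨u, hu⟩ := Nat.ordProj_dvd e p
        have hfac : n.factorization p = d.factorization p + (t + 1) := by
          rw [hm, he, Nat.factorization_mul hp.ne_zero (mul_ne_zero hd0 he0),
            Nat.factorization_mul hd0 he0]
          simp [hp.factorization_self]; ring
        -- Elements congruent modulo p have p^t-th powers congruent modulo p^(t+1). The missing
        -- power of p is supplied by the factor d.
        have h3 := dvd_sub_pow_of_dvd_sub (hfrob p hp (c d)) t
        have h4 : ((p ^ (t + 1) : ℕ) : A) ∣ ψ p (c d) ^ e - (c d ^ p) ^ e := by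
          rw [hu, pow_mul, pow_mul]
          push_cast
          exact h3.trans (sub_dvd_pow_sub_pow _ _ u)
        rw [hfac, pow_add, Nat.cast_mul]
        exact mul_dvd_mul (Nat.cast_dvd_cast (Nat.ordProj_dvd d p)) h4
      · rw [Finset.mem_sdiff, Nat.mem_properDivisors] at hd
        refine Dvd.dvd.mul_right (Nat.cast_dvd_cast ?_) _
        obtain ⟨⟨⟨e, he⟩, -⟩, h5⟩ := hd
        have hd0 : d ≠ 0 := by rintro rfl; simp at he
        have he0 : e ≠ 0 := by rintro rfl; simp at he
        -- A divisor d of n that does not divide n/p contains the full power of p in n.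
        have hpe : ¬ p ∣ e := by
          rintro ⟨e', rfl⟩
          apply h5
          rw [Nat.mem_divisors]
          refine ⟨⟨e', ?_⟩, hm0⟩
          apply Nat.eq_of_mul_eq_mul_left hp.pos
          rw [← hm, he]; ring
        have : n.factorization p = d.factorization p := by
          rw [he, Nat.factorization_mul hd0 he0]
          simp [Nat.factorization_eq_zero_of_not_dvd hpe]
        rw [this]
        exact Nat.ordProj_dvd d p
    obtain ⟨x, hx⟩ := key
    refine ⟨Function.update c n x, fun k hk hkn => ?_⟩
    by_cases hkN : k ≤ N
    · rw [hc k hk hkN]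
      refine Finset.sum_congr rfl fun d hd => ?_
      have := Nat.divisor_le hd
      rw [Function.update_of_ne (by omega)]
    · obtain rfl : k = n := by omega
      rw [← Nat.insert_self_properDivisors hk, Finset.sum_insert Nat.self_notMem_properDivisors,
        Function.update_self, Nat.div_self (Nat.pos_of_ne_zero hk), pow_one, ← hx]
      rw [eq_comm, ← eq_sub_iff_add_eq]
      congr 1
      refine Finset.sum_congr rfl fun d hd => ?_
      have := (Nat.mem_properDivisors.1 hd).2
      rw [Function.update_of_ne (by omega)]

end Ghost

/-! ### Divisibility of exponents -/

section Content

variable {σ : Type*}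

/-- The greatest common divisor of the entries. -/
def content (β : σ →₀ ℕ) : ℕ := β.support.gcd β

/-- Division of all the entries by `n`. -/
noncomputable def divBy (β : σ →₀ ℕ) (n : ℕ) : σ →₀ ℕ := β.mapRange (· / n) (Nat.zero_div n)

theorem dvd_content_iff {β : σ →₀ ℕ} {n : ℕ} : n ∣ content β ↔ ∀ i, n ∣ β i := by
  rw [content, Finset.dvd_gcd_iff]
  refine ⟨fun h i => ?_, fun h i _ => h i⟩
  by_cases hi : i ∈ β.support
  · exact h i hi
  · simp [Finsupp.notMem_support_iff.1 hi]

theorem smul_divBy {β : σ →₀ ℕ} {n : ℕ} (h : n ∣ content β) : n • divBy β n = β := by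
  ext i
  exact Nat.mul_div_cancel' (dvd_content_iff.1 h i)

theorem divBy_smul {β : σ →₀ ℕ} {n : ℕ} (hn : n ≠ 0) : divBy (n • β) n = β := by
  ext i
  exact Nat.mul_div_cancel_left _ (Nat.pos_of_ne_zero hn)

theorem dvd_content_smul (β : σ →₀ ℕ) (n : ℕ) : n ∣ content (n • β) :=
  dvd_content_iff.2 fun i => ⟨β i, rfl⟩

@[simp] theorem content_zero : content (0 : σ →₀ ℕ) = 0 := by simp [content]

theorem content_smul (β : σ →₀ ℕ) (n : ℕ) : content (n • β) = n * content β := by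
  by_cases hn : n = 0
  · simp [hn]
  · apply Nat.dvd_antisymm
    · obtain ⟨k, hk⟩ := dvd_content_smul β n
      rw [hk]
      refine mul_dvd_mul_left n (dvd_content_iff.2 fun i => ?_)
      have := dvd_content_iff.1 hk.symm.dvd i
      exact Nat.dvd_of_mul_dvd_mul_left (Nat.pos_of_ne_zero hn) this
    · exact dvd_content_iff.2 fun i => mul_dvd_mul_left n (dvd_content_iff.1 dvd_rfl i)

theorem content_divBy {β : σ →₀ ℕ} {n : ℕ} (hn : n ≠ 0) (h : n ∣ content β) :
    content (divBy β n) = content β / n := by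
  conv_rhs => rw [← smul_divBy h, content_smul, Nat.mul_div_cancel_left _ (Nat.pos_of_ne_zero hn)]

theorem divBy_divBy (β : σ →₀ ℕ) (m n : ℕ) : divBy (divBy β m) n = divBy β (m * n) := by
  ext i
  exact Nat.div_div_eq_div_mul _ _ _

theorem divBy_one (β : σ →₀ ℕ) : divBy β 1 = β := by
  ext i
  exact Nat.div_one _

theorem content_ne_zero {β : σ →₀ ℕ} (h : β ≠ 0) : content β ≠ 0 := by
  intro h0
  apply h
  ext i
  have := dvd_content_iff.1 (h0 ▸ dvd_refl _ : 0 ∣ content β) i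
  simpa using this

theorem content_le_degree {β : σ →₀ ℕ} (h : β ≠ 0) : content β ≤ β.degree := by
  have h1 : β.degree ≠ 0 := (Finsupp.degree_eq_zero_iff β).not.2 h
  refine Nat.le_of_dvd (Nat.pos_of_ne_zero h1) ?_
  rw [Finsupp.degree_apply]
  exact Finset.dvd_sum fun i _ => dvd_content_iff.1 dvd_rfl i

/-- The substitution N = n m, used to compose two Adams sums. -/
theorem sum_divisors_divisors {M : Type*} [AddCommMonoid M] (c : ℕ) (f : ℕ → ℕ → M) :
    ∑ n ∈ c.divisors, ∑ m ∈ (c / n).divisors, f n m =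
      ∑ N ∈ c.divisors, ∑ n ∈ N.divisors, f n (N / n) := by
  by_cases hc : c = 0
  · simp [hc]
  rw [Finset.sum_sigma', Finset.sum_sigma']
  refine Finset.sum_nbij' (fun x => ⟨x.1 * x.2, x.1⟩) (fun x => ⟨x.2, x.1 / x.2⟩) ?_ ?_ ?_ ?_ ?_
  · rintro ⟨n, m⟩ h
    simp only [Finset.mem_sigma, Nat.mem_divisors] at h ⊢
    obtain ⟨⟨⟨k, rfl⟩, -⟩, h2, -⟩ := h
    have hn : 0 < n := Nat.pos_of_ne_zero (by rintro rfl; simp at hc)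
    rw [Nat.mul_div_cancel_left _ hn] at h2
    refine ⟨⟨mul_dvd_mul_left n h2, hc⟩, dvd_mul_right _ _, mul_ne_zero hn.ne' ?_⟩
    rintro rfl
    simp at h2; simp [h2] at hc
  · rintro ⟨N, n⟩ h
    simp only [Finset.mem_sigma, Nat.mem_divisors] at h ⊢
    obtain ⟨⟨⟨k, rfl⟩, -⟩, ⟨l, rfl⟩, h2⟩ := h
    have hn : 0 < n := Nat.pos_of_ne_zero (by rintro rfl; simp at h2)
    rw [Nat.mul_div_cancel_left _ hn, mul_assoc, Nat.mul_div_cancel_left _ hn]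
    refine ⟨⟨dvd_mul_right _ _, by rwa [← mul_assoc]⟩, dvd_mul_right _ _, ?_⟩
    rw [mul_assoc] at hc
    exact (mul_ne_zero_iff.1 hc).2
  · rintro ⟨n, m⟩ h
    simp only [Finset.mem_sigma, Nat.mem_divisors] at h
    have hn : 0 < n := Nat.pos_of_ne_zero (by rintro rfl; simp at h)
    simp [Nat.mul_div_cancel_left _ hn]
  · rintro ⟨N, n⟩ h
    simp only [Finset.mem_sigma, Nat.mem_divisors] at h
    simp [Nat.mul_div_cancel' h.2.1]
  · rintro ⟨n, m⟩ h
    simp only [Finset.mem_sigma, Nat.mem_divisors] at h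
    have hn : 0 < n := Nat.pos_of_ne_zero (by rintro rfl; simp at h)
    simp [Nat.mul_div_cancel_left _ hn]

/-- Möbius inversion in the form used for plethystic logarithms. -/
theorem sum_moebius_divisors {K : Type*} [Field K] [CharZero K] {c : ℕ} (hc : c ≠ 0) (t : ℕ → K) :
    ∑ n ∈ c.divisors, ∑ m ∈ (c / n).divisors,
      ((ArithmeticFunction.moebius n : ℤ) : K) / n * ((m : K)⁻¹ * t (n * m)) = t 1 := by
  rw [sum_divisors_divisors c fun n m => ((ArithmeticFunction.moebius n : ℤ) : K) / n *
    ((m : K)⁻¹ * t (n * m))]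
  have h : ∀ N ∈ c.divisors, ∑ n ∈ N.divisors, ((ArithmeticFunction.moebius n : ℤ) : K) / n *
      (((N / n : ℕ) : K)⁻¹ * t (n * (N / n))) = if N = 1 then t 1 else 0 := by
    intro N hN
    have h2 : ∑ n ∈ N.divisors, ((ArithmeticFunction.moebius n : ℤ) : K) = if N = 1 then 1 else 0 := by
      have := congrArg (fun f => f N) (ArithmeticFunction.moebius_mul_coe_zeta)
      simp only [ArithmeticFunction.coe_mul_zeta_apply, ArithmeticFunction.one_apply] at this
      exact_mod_cast congrArg (Int.cast : ℤ → K) this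
    calc _ = ∑ n ∈ N.divisors, ((ArithmeticFunction.moebius n : ℤ) : K) * ((N : K)⁻¹ * t N) := by
          refine Finset.sum_congr rfl fun n hn => ?_
          have hnN := Nat.dvd_of_mem_divisors hn
          have hn0 : (n : K) ≠ 0 := by
            have := Nat.pos_of_mem_divisors hn
            exact_mod_cast this.ne'
          rw [Nat.mul_div_cancel' hnN, Nat.cast_div hnN hn0]
          field_simp
      _ = _ := by
          rw [← Finset.sum_mul, h2]
          split_ifs with h1
          · subst h1; simp
          · simp
  rw [Finset.sum_congr rfl h, Finset.sum_ite_eq', if_pos (by simp [hc])]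

end Content

end Hua

namespace Hua

open Finset MvPowerSeries

/-! ### Plethystic exponentials and logarithms -/

section Plethystic

variable {σ : Type u}

theorem coeff_adams (n : ℕ) (hn : n ≠ 0) (f : MvPowerSeries σ (RatFunc ℚ)) (β : σ →₀ ℕ) :
    coeff β (adams n hn f) = if n ∣ content β then psi n (coeff (divBy β n) f) else 0 := by
  split_ifs with h
  · conv_lhs => rw [← smul_divBy h]
    rw [adams, coeff_expand_smul, coeff_map, psi_of_ne_zero hn]
  · rw [dvd_content_iff, not_forall] at h
    obtain ⟨i, hi⟩ := h
    exact coeff_expand_of_not_dvd n hn _ hi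

/-- For β ≠ 0 the content is at most the degree, so no divisor is missed. For β = 0 both sums are
empty, since 0 has no divisors in `Nat.divisors`; this makes the constant terms of `Psi` and
`PsiInv` vanish. -/
theorem sum_range_degree_eq {K : Type*} [AddCommMonoid K] (β : σ →₀ ℕ) (F : ℕ → K) :
    ∑ n ∈ range β.degree, (if (n + 1) ∣ content β then F (n + 1) else 0) =
      ∑ n ∈ (content β).divisors, F n := by
  by_cases hβ : β = 0
  · simp [hβ]
  rw [← Finset.sum_filter]
  refine Finset.sum_nbij' (· + 1) (· - 1) ?_ ?_ ?_ ?_ ?_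
  · intro n hn
    simp only [Finset.mem_filter] at hn
    exact Nat.mem_divisors.2 ⟨hn.2, content_ne_zero hβ⟩
  · intro n hn
    have h1 := Nat.pos_of_mem_divisors hn
    have h2 := Nat.divisor_le hn
    have h3 := content_le_degree hβ
    have h4 := Nat.dvd_of_mem_divisors hn
    simp only [Finset.mem_filter, Finset.mem_range]
    exact ⟨by omega, by rwa [Nat.sub_add_cancel h1]⟩
  · intro n _; simp
  · intro n hn
    exact Nat.sub_add_cancel (Nat.pos_of_mem_divisors hn)
  · intro n _; rfl

theorem coeff_Psi (f : MvPowerSeries σ (RatFunc ℚ)) (β : σ →₀ ℕ) :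
    coeff β (Psi f) =
      ∑ n ∈ (content β).divisors, (n : RatFunc ℚ)⁻¹ * psi n (coeff (divBy β n) f) := by
  rw [← sum_range_degree_eq β fun n => (n : RatFunc ℚ)⁻¹ * psi n (coeff (divBy β n) f)]
  change ∑ n ∈ range β.degree, (1 / ((n + 1 : ℕ) : RatFunc ℚ)) *
    coeff β (adams (n + 1) n.succ_ne_zero f) = _
  refine Finset.sum_congr rfl fun n _ => ?_
  rw [coeff_adams, mul_ite, mul_zero, one_div]

theorem coeff_PsiInv (f : MvPowerSeries σ (RatFunc ℚ)) (β : σ →₀ ℕ) :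
    coeff β (PsiInv f) = ∑ n ∈ (content β).divisors,
      ((ArithmeticFunction.moebius n : ℤ) : RatFunc ℚ) / n * psi n (coeff (divBy β n) f) := by
  rw [← sum_range_degree_eq β fun n =>
    ((ArithmeticFunction.moebius n : ℤ) : RatFunc ℚ) / n * psi n (coeff (divBy β n) f)]
  change ∑ n ∈ range β.degree,
    ((ArithmeticFunction.moebius (n + 1) : RatFunc ℚ) / ((n + 1 : ℕ) : RatFunc ℚ)) *
      coeff β (adams (n + 1) n.succ_ne_zero f) = _
  refine Finset.sum_congr rfl fun n _ => ?_
  rw [coeff_adams, mul_ite, mul_zero]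

theorem constantCoeff_Psi (f : MvPowerSeries σ (RatFunc ℚ)) : constantCoeff (Psi f) = 0 := by
  rw [← coeff_zero_eq_constantCoeff_apply, coeff_Psi]; simp

theorem constantCoeff_PsiInv (f : MvPowerSeries σ (RatFunc ℚ)) : constantCoeff (PsiInv f) = 0 := by
  rw [← coeff_zero_eq_constantCoeff_apply, coeff_PsiInv]; simp

theorem divisor_facts {β : σ →₀ ℕ} {n : ℕ} (hn : n ∈ (content β).divisors) :
    n ≠ 0 ∧ n ∣ content β ∧ content (divBy β n) = content β / n := by
  have h0 := (Nat.pos_of_mem_divisors hn).ne'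
  have h1 := Nat.dvd_of_mem_divisors hn
  exact ⟨h0, h1, content_divBy h0 h1⟩

theorem Psi_PsiInv {f : MvPowerSeries σ (RatFunc ℚ)} (hf : constantCoeff f = 0) :
    Psi (PsiInv f) = f := by
  ext β
  by_cases hβ : β = 0
  · subst hβ
    rw [coeff_zero_eq_constantCoeff_apply, coeff_zero_eq_constantCoeff_apply, constantCoeff_Psi, hf]
  rw [coeff_Psi]
  have h := sum_moebius_divisors (K := RatFunc ℚ) (content_ne_zero hβ)
    (fun N => psi N (coeff (divBy β N) f))
  simp only [psi_one, divBy_one] at h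
  rw [← h]
  rw [sum_divisors_divisors (content β) fun n m =>
    ((ArithmeticFunction.moebius n : ℤ) : RatFunc ℚ) / n *
      ((m : RatFunc ℚ)⁻¹ * psi (n * m) (coeff (divBy β (n * m)) f))]
  have h2 : ∀ n ∈ (content β).divisors,
      (n : RatFunc ℚ)⁻¹ * psi n (coeff (divBy β n) (PsiInv f)) =
      ∑ m ∈ (content β / n).divisors, (n : RatFunc ℚ)⁻¹ *
        (((ArithmeticFunction.moebius m : ℤ) : RatFunc ℚ) / m *
          psi (n * m) (coeff (divBy β (n * m)) f)) := by
    intro n hn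
    obtain ⟨h0, h1, h2⟩ := divisor_facts hn
    rw [coeff_PsiInv, h2, map_sum, Finset.mul_sum]
    refine Finset.sum_congr rfl fun m hm => ?_
    rw [map_mul, map_div₀, map_intCast, map_natCast, divBy_divBy, ← psi_mul h0
      (Nat.pos_of_mem_divisors hm).ne']
  rw [Finset.sum_congr rfl h2, sum_divisors_divisors (content β) fun n m =>
    (n : RatFunc ℚ)⁻¹ * (((ArithmeticFunction.moebius m : ℤ) : RatFunc ℚ) / m *
      psi (n * m) (coeff (divBy β (n * m)) f))]
  refine Finset.sum_congr rfl fun N hN => ?_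
  -- The Möbius factor sits on the inner index here and on the outer one in `sum_moebius_divisors`;
  -- the involution n ↦ N/n exchanges them.
  rw [← Nat.sum_div_divisors]
  refine Finset.sum_congr rfl fun n hn => ?_
  have hnN := Nat.dvd_of_mem_divisors hn
  have hN0 := Nat.pos_of_mem_divisors hN
  rw [Nat.div_div_self hnN hN0.ne', Nat.mul_div_cancel' hnN, Nat.div_mul_cancel hnN]
  ring

theorem isLog_Exp (f : MvPowerSeries σ (RatFunc ℚ)) : IsLog (Exp f) (Psi f) :=
  isLog_exp (constantCoeff_Psi f)

theorem isLog_Psi_Log {f : MvPowerSeries σ (RatFunc ℚ)} (hf : constantCoeff f = 1) :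
    IsLog f (Psi (Log f)) := by
  have h := isLog_log hf
  rw [Log, Psi_PsiInv h.right]
  exact h

/-! ### Series in a monomial -/

section Monomial

variable {K : Type*} [Field K]

theorem coeff_subst_monomial [DecidableEq σ] {γ : σ →₀ ℕ} (hγ : γ ≠ 0) (P : PowerSeries K) (α : σ →₀ ℕ)
    {N : ℕ} (hN : α.degree ≤ N) :
    coeff α (P.subst (monomial γ (1 : K))) =
      ∑ n ∈ range (N + 1), if n • γ = α then PowerSeries.coeff n P else 0 := by
  have h0 : constantCoeff (monomial γ (1 : K)) = 0 := by
    rw [← coeff_zero_eq_constantCoeff_apply, coeff_monomial, if_neg hγ.symm]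
  rw [coeff_subst_eq_sum h0 P hN, map_sum]
  refine Finset.sum_congr rfl fun n _ => ?_
  rw [coeff_smul, monomial_pow, one_pow, coeff_monomial]
  simp [eq_comm (a := α)]

theorem smul_left_injective_of_ne_zero {γ : σ →₀ ℕ} (hγ : γ ≠ 0) {m n : ℕ}
    (h : m • γ = n • γ) : m = n := by
  obtain ⟨i, hi⟩ := Finsupp.ne_iff.1 hγ
  exact Nat.eq_of_mul_eq_mul_right (Nat.pos_of_ne_zero hi) (DFunLike.congr_fun h i)

theorem coeff_subst_monomial_smul {γ : σ →₀ ℕ} (hγ : γ ≠ 0) (P : PowerSeries K) (n : ℕ) :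
    coeff (n • γ) (P.subst (monomial γ (1 : K))) = PowerSeries.coeff n P := by
  classical
  have hn : n ≤ (n • γ).degree := by
    rw [map_nsmul, smul_eq_mul]
    exact Nat.le_mul_of_pos_right n (Nat.pos_of_ne_zero ((Finsupp.degree_eq_zero_iff γ).not.2 hγ))
  rw [coeff_subst_monomial hγ P _ le_rfl, Finset.sum_eq_single n]
  · simp
  · intro m _ hm
    rw [if_neg fun h => hm (smul_left_injective_of_ne_zero hγ h)]
  · intro h
    rw [Finset.mem_range] at h
    omega

theorem coeff_subst_monomial_eq_zero {γ : σ →₀ ℕ} (hγ : γ ≠ 0) (P : PowerSeries K)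
    {α : σ →₀ ℕ} (h : ∀ n : ℕ, α ≠ n • γ) : coeff α (P.subst (monomial γ (1 : K))) = 0 := by
  classical
  rw [coeff_subst_monomial hγ P _ le_rfl]
  exact Finset.sum_eq_zero fun n _ => if_neg (h n).symm

theorem constantCoeff_monomial_eq_zero {γ : σ →₀ ℕ} (hγ : γ ≠ 0) :
    constantCoeff (monomial γ (1 : K)) = 0 := by
  classical
  rw [← coeff_zero_eq_constantCoeff_apply, coeff_monomial, if_neg hγ.symm]

/-- The logarithm of 1/(1 - c x). The constant coefficient of the second series is 1/0, which is 0
as it should be. -/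
theorem isLog_geometric [CharZero K] (c : K) {γ : σ →₀ ℕ} (hγ : γ ≠ 0) :
    IsLog ((PowerSeries.mk fun n => c ^ n).subst (monomial γ (1 : K)))
      ((PowerSeries.mk fun n => c ^ n / (n : K)).subst (monomial γ (1 : K))) := by
  refine isLog_subst ?_ ?_ ?_ (constantCoeff_monomial_eq_zero hγ)
  · simp [← PowerSeries.coeff_zero_eq_constantCoeff_apply]
  · simp [← PowerSeries.coeff_zero_eq_constantCoeff_apply]
  · ext n
    simp only [PowerSeries.coeff_derivative, PowerSeries.coeff_mul, PowerSeries.coeff_mk]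
    rw [Finset.sum_congr rfl (g := fun _ => c ^ (n + 1))]
    · simp [Finset.Nat.card_antidiagonal]; ring
    · rintro ⟨i, j⟩ h
      have h1 := HasAntidiagonal.mem_antidiagonal.1 h
      have h2 : ((j : K) + 1) ≠ 0 := by exact_mod_cast Nat.succ_ne_zero j
      simp only at h1 ⊢
      rw [← h1]
      push_cast
      rw [div_mul_cancel₀ _ h2]; ring

end Monomial

/-! ### Integrality of plethystic exponentials -/

/-- The Adams operations on the ring of quotients by monic integer polynomials. -/
noncomputable def psiMonic (n : ℕ) : monicSubring →+* monicSubring :=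
  if hn : n ≠ 0 then (psi n).restrict monicSubring monicSubring fun _ => psi_mem_monicSubring hn
  else RingHom.id _

theorem coe_psiMonic {n : ℕ} (hn : n ≠ 0) (x : monicSubring) : (psiMonic n x : RatFunc ℚ) = psi n x := by
  rw [psiMonic, dif_pos hn]; rfl

theorem exists_ghost_monic {c : RatFunc ℚ} (hc : c ∈ monicSubring) (N : ℕ) :
    ∃ e : ℕ → RatFunc ℚ, (∀ n, e n ∈ monicSubring) ∧ ∀ n, n ≠ 0 → n ≤ N →
      psi n c = ∑ d ∈ n.divisors, (d : RatFunc ℚ) * e d ^ (n / d) := by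
  have hmul : ∀ m n a, m ≠ 0 → n ≠ 0 → psiMonic (m * n) a = psiMonic m (psiMonic n a) := by
    intro m n a hm hn
    apply Subtype.ext
    rw [coe_psiMonic (mul_ne_zero hm hn), coe_psiMonic hm, coe_psiMonic hn, psi_mul hm hn]
  have hfrob : ∀ p : ℕ, p.Prime → ∀ a, (p : monicSubring) ∣ psiMonic p a - a ^ p := by
    intro p hp a
    obtain ⟨g, hg, h⟩ := exists_psi_sub_pow hp a.2
    refine ⟨⟨g, hg⟩, Subtype.ext ?_⟩
    simpa [coe_psiMonic hp.ne_zero] using h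
  obtain ⟨e, he⟩ := exists_ghost psiMonic hmul hfrob (⟨c, hc⟩ : monicSubring) N
  refine ⟨fun n => e n, fun n => (e n).2, fun n hn hnN => ?_⟩
  have := congrArg (Subtype.val) (he n hn hnN)
  rw [coe_psiMonic hn] at this
  simpa using this

/-- The power series with coefficients in a subring. -/
def coeffsIn {K : Type*} [CommRing K] (O : Subring K) : Subring (MvPowerSeries σ K) where
  carrier := {f | ∀ α, coeff α f ∈ O}
  one_mem' α := by
    classical
    rw [coeff_one]; split_ifs
    exacts [O.one_mem, O.zero_mem]
  zero_mem' α := O.zero_mem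
  add_mem' hf hg α := O.add_mem (hf α) (hg α)
  neg_mem' hf α := O.neg_mem (hf α)
  mul_mem' hf hg α := by
    classical
    rw [coeff_mul]
    exact O.sum_mem fun p _ => O.mul_mem (hf _) (hg _)

theorem coeff_Psi_monomial_smul {β : σ →₀ ℕ} (hβ : β ≠ 0) (c : RatFunc ℚ) {M : ℕ} (hM : M ≠ 0) :
    coeff (M • β) (Psi (monomial β c)) = (M : RatFunc ℚ)⁻¹ * psi M c := by
  classical
  rw [coeff_Psi, Finset.sum_eq_single M]
  · rw [divBy_smul hM, coeff_monomial_same]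
  · intro n hn hne
    obtain ⟨h0, h1, -⟩ := divisor_facts hn
    rw [coeff_monomial, if_neg, map_zero, mul_zero]
    intro h
    apply hne
    have := smul_divBy h1
    rw [h] at this
    exact smul_left_injective_of_ne_zero hβ this
  · intro h
    exfalso; apply h
    rw [content_smul, Nat.mem_divisors]
    exact ⟨dvd_mul_right _ _, mul_ne_zero hM (content_ne_zero hβ)⟩

theorem coeff_Psi_monomial_eq_zero {β : σ →₀ ℕ} (c : RatFunc ℚ) {α : σ →₀ ℕ}
    (h : ∀ n : ℕ, α ≠ n • β) : coeff α (Psi (monomial β c)) = 0 := by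
  classical
  rw [coeff_Psi]
  refine Finset.sum_eq_zero fun n hn => ?_
  obtain ⟨h0, h1, -⟩ := divisor_facts hn
  rw [coeff_monomial, if_neg, map_zero, mul_zero]
  intro h2
  exact h n (by rw [← h2, smul_divBy h1])

/-- With ghost components ψ_n(c) = Σ_(d∣n) d e_d^(n/d), the series Σ ψ_n(c) x^(nβ)/n is the
logarithm of Π_d 1/(1 - e_d x^(dβ)). This product involves no denominators. -/
theorem monomial_exp_mem {β : σ →₀ ℕ} (hβ : β ≠ 0) {c : RatFunc ℚ} (hc : c ∈ monicSubring)
    {f : MvPowerSeries σ (RatFunc ℚ)} (hf : IsLog f (Psi (monomial β c))) :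
    f ∈ coeffsIn monicSubring := by
  classical
  intro α
  set N := α.degree
  obtain ⟨e, he, hce⟩ := exists_ghost_monic hc N
  -- The factors with d > N do not influence degrees up to N, so the finite product suffices.
  have hlog := IsLog.prod (s := Finset.Icc 1 N) fun d hd =>
    isLog_geometric (e d) (γ := d • β) (by
      have : d ≠ 0 := by simp at hd; omega
      simp [this, hβ])
  rw [hf.agree_left hlog (n := N) ?_ α le_rfl]
  · refine (coeffsIn monicSubring).prod_mem (fun d hd α => ?_) α
    have hd' : d • β ≠ 0 := by
      have : d ≠ 0 := by simp at hd; omega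
      simp [this, hβ]
    rw [coeff_subst_monomial hd' _ _ le_rfl]
    refine monicSubring.sum_mem fun n _ => ?_
    split_ifs
    · rw [PowerSeries.coeff_mk]; exact pow_mem (he d) n
    · exact monicSubring.zero_mem
  · intro γ hγ
    rw [map_sum]
    by_cases h : ∃ M : ℕ, γ = M • β
    · obtain ⟨M, rfl⟩ := h
      by_cases hM : M = 0
      · subst hM
        rw [zero_smul, coeff_zero_eq_constantCoeff_apply, constantCoeff_Psi, Finset.sum_eq_zero]
        intro d hd
        have : d ≠ 0 := by simp at hd; omega
        have h2 := coeff_subst_monomial_smul (γ := d • β) (by simp [this, hβ])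
          (PowerSeries.mk fun n => e d ^ n / (n : RatFunc ℚ)) 0
        rw [zero_smul] at h2
        rw [h2]; simp
      · have hMN : M ≤ N := by
          refine le_trans ?_ hγ
          rw [map_nsmul, smul_eq_mul]
          exact Nat.le_mul_of_pos_right M
            (Nat.pos_of_ne_zero ((Finsupp.degree_eq_zero_iff β).not.2 hβ))
        rw [coeff_Psi_monomial_smul hβ c hM, hce M hM hMN, Finset.mul_sum]
        have hsub : M.divisors ⊆ Finset.Icc 1 N := fun d hd =>
          Finset.mem_Icc.2 ⟨Nat.pos_of_mem_divisors hd, (Nat.divisor_le hd).trans hMN⟩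
        rw [← Finset.sum_subset hsub]
        · refine Finset.sum_congr rfl fun d hd => ?_
          have hd0 := (Nat.pos_of_mem_divisors hd).ne'
          obtain ⟨k, rfl⟩ := Nat.dvd_of_mem_divisors hd
          have h2 := coeff_subst_monomial_smul (γ := d • β) (by simp [hd0, hβ])
            (PowerSeries.mk fun n => e d ^ n / (n : RatFunc ℚ)) k
          rw [smul_smul, mul_comm k d] at h2
          rw [h2, PowerSeries.coeff_mk, Nat.mul_div_cancel_left _ (Nat.pos_of_ne_zero hd0)]
          have hd1 : (d : RatFunc ℚ) ≠ 0 := by exact_mod_cast hd0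
          push_cast
          rw [mul_inv, div_eq_mul_inv]
          field_simp
        · intro d hd hdM
          have : d ≠ 0 := by simp at hd; omega
          refine coeff_subst_monomial_eq_zero (by simp [this, hβ]) _ fun n hn => hdM ?_
          rw [smul_smul] at hn
          have := smul_left_injective_of_ne_zero hβ hn
          exact Nat.mem_divisors.2 ⟨⟨n, by rw [this, mul_comm]⟩, hM⟩
    · push Not at h
      rw [coeff_Psi_monomial_eq_zero c h, Finset.sum_eq_zero]
      intro d hd
      have : d ≠ 0 := by simp at hd; omega
      refine coeff_subst_monomial_eq_zero (by simp [this, hβ]) _ fun n hn => h (n * d) ?_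
      rw [hn, smul_smul]

/-- Up to degree N, g may be replaced by the sum of its finitely many monomials of degree at most N,
and Exp turns the sum into a product of the series in `monomial_exp_mem`. -/
theorem exp_mem_coeffsIn [Finite σ] {f g : MvPowerSeries σ (RatFunc ℚ)} {N : ℕ}
    (hg : ∀ α, α ≠ 0 → α.degree ≤ N → coeff α g ∈ monicSubring) (hf : IsLog f (Psi g))
    (α : σ →₀ ℕ) (hα : α.degree ≤ N) : coeff α f ∈ monicSubring := by
  classical
  set s := (Finsupp.finite_of_degree_le (σ := σ) N).toFinset.erase 0 with hs
  have hmem : ∀ β, β ∈ s ↔ β ≠ 0 ∧ β.degree ≤ N := fun β => by simp [hs]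
  have hlog := IsLog.prod (s := s) fun β _ => isLog_Exp (monomial β (coeff β g))
  rw [hf.agree_left hlog (n := N) ?_ α hα]
  · exact (coeffsIn monicSubring).prod_mem (fun β hβ =>
      monomial_exp_mem ((hmem β).1 hβ).1 (hg _ ((hmem β).1 hβ).1 ((hmem β).1 hβ).2) (isLog_Exp _)) α
  · intro γ hγ
    rw [map_sum, coeff_Psi]
    simp only [coeff_Psi]
    rw [Finset.sum_comm]
    refine Finset.sum_congr rfl fun n hn => ?_
    obtain ⟨h0, h1, -⟩ := divisor_facts hn
    have hγ0 : γ ≠ 0 := by rintro rfl; simp at hn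
    rw [← Finset.mul_sum, ← map_sum]
    congr 2
    simp only [coeff_monomial]
    rw [Finset.sum_ite_eq, if_pos]
    rw [hmem]
    have h2 := smul_divBy h1
    refine ⟨fun h => hγ0 (by rw [← h2, h, smul_zero]), le_trans ?_ hγ⟩
    conv_rhs => rw [← h2, map_nsmul, smul_eq_mul]
    exact Nat.le_mul_of_pos_left _ (Nat.pos_of_ne_zero h0)

/-- Induction on the degree d: let g be the part of Log f of degree below d. Then Exp g has
coefficients in the subring and agrees with f below degree d, and in degree d the difference f - Exp
g is the coefficient of Log f. -/
theorem Log_mem_coeffsIn [Finite σ] {f : MvPowerSeries σ (RatFunc ℚ)} (h1 : constantCoeff f = 1)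
    (hf : f ∈ coeffsIn monicSubring) : Log f ∈ coeffsIn monicSubring := by
  classical
  intro α
  induction hd : α.degree using Nat.strong_induction_on generalizing α with
  | _ d ih =>
    by_cases h0 : α = 0
    · subst h0
      rw [coeff_zero_eq_constantCoeff_apply, Log, constantCoeff_PsiInv]
      exact monicSubring.zero_mem
    set g : MvPowerSeries σ (RatFunc ℚ) := fun β => if β.degree < d then coeff β (Log f) else 0
    have hgc : ∀ β, coeff β g = if β.degree < d then coeff β (Log f) else 0 := fun β => rfl
    have hT := isLog_Exp g
    have hF := isLog_Psi_Log h1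
    -- Division of β by n ≥ 2 lowers the degree, so in degree d only the term with n = 1 of Ψ sees
    -- the truncation.
    have hlow : ∀ β n, n ∣ content β → β ≠ 0 → β.degree ≤ d → (n ≠ 1 ∨ β.degree < d) →
        coeff (divBy β n) g = coeff (divBy β n) (Log f) := by
      intro β n hn hβ hβd hor
      rw [hgc, if_pos]
      have h2 := smul_divBy hn
      have h3 : β.degree = n * (divBy β n).degree := by
        conv_lhs => rw [← h2, map_nsmul, smul_eq_mul]
      have h4 : β.degree ≠ 0 := (Finsupp.degree_eq_zero_iff β).not.2 hβ
      have h5 : n ≠ 0 := by rintro rfl; rw [zero_mul] at h3; exact h4 h3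
      have h6 : (divBy β n).degree ≠ 0 := by intro h; rw [h, mul_zero] at h3; exact h4 h3
      rcases hor with h | h
      · have : 2 ≤ n := by omega
        nlinarith [Nat.pos_of_ne_zero h6]
      · have : 1 ≤ n := by omega
        nlinarith
    have hPsi : ∀ β : σ →₀ ℕ, β.degree ≤ d - 1 → coeff β (Psi (Log f)) = coeff β (Psi g) := by
      intro β hβ
      rw [coeff_Psi, coeff_Psi]
      refine Finset.sum_congr rfl fun n hn => ?_
      obtain ⟨h2, h3, -⟩ := divisor_facts hn
      have hβ0 : β ≠ 0 := by rintro rfl; simp at hn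
      have h4 : β.degree ≠ 0 := (Finsupp.degree_eq_zero_iff β).not.2 hβ0
      rw [hlow β n h3 hβ0 (by omega) (Or.inr (by omega))]
    have hag := hF.agree_left hT hPsi
    have hdiff : coeff α (Log f) = coeff α f - coeff α (Exp g) := by
      have e1 := hF.coeff_right h0
      have e2 := hT.coeff_right h0
      have e3 : ∑ p ∈ antidiagonal α with p.2 ≠ 0 ∧ p.2 ≠ α,
          coeff p.1 f * ((p.2.degree : RatFunc ℚ) * coeff p.2 (Psi (Log f))) =
          ∑ p ∈ antidiagonal α with p.2 ≠ 0 ∧ p.2 ≠ α,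
          coeff p.1 (Exp g) * ((p.2.degree : RatFunc ℚ) * coeff p.2 (Psi g)) := by
        refine Finset.sum_congr rfl fun p hp => ?_
        rw [Finset.mem_filter] at hp
        have h2 := degree_snd_lt hp.1 hp.2.2
        have h3 := degree_fst_lt hp.1 hp.2.1
        rw [hag _ (by omega), hPsi _ (by omega)]
      rw [e3] at e1
      have e4 : coeff α (Psi (Log f)) - coeff α (Psi g) = coeff α (Log f) := by
        rw [coeff_Psi, coeff_Psi, ← Finset.sum_sub_distrib, Finset.sum_eq_single 1]
        · have : ¬ α.degree < d := by omega
          rw [divBy_one, hgc, if_neg this]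
          simp [psi_one]
        · intro n hn hn1
          obtain ⟨h2, h3, -⟩ := divisor_facts hn
          rw [hlow α n h3 h0 hd.le (Or.inl hn1), sub_self]
        · intro h; simp [content_ne_zero h0] at h
      linear_combination (-1 : RatFunc ℚ) * e4 + e1 - e2
    rw [hdiff]
    refine sub_mem (hf α) (exp_mem_coeffsIn (N := d) (fun β _ _ => ?_) hT α hd.le)
    rw [hgc]
    split_ifs with h
    · exact ih _ h β rfl
    · exact monicSubring.zero_mem

end Plethystic

end Hua

namespace Hua

open Finset MvPowerSeries

/-! ### From numerical identities at prime powers to polynomials -/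

section Counts

variable {σ : Type u}

/-- The series with coefficients `∑_{k ∣ β} w k (β / k) / k`. -/
noncomputable def adamsSum (w : ℕ → (σ →₀ ℕ) → ℚ) : MvPowerSeries σ ℚ :=
  fun β => ∑ k ∈ (content β).divisors, (k : ℚ)⁻¹ * w k (divBy β k)

theorem coeff_adamsSum (w : ℕ → (σ →₀ ℕ) → ℚ) (β : σ →₀ ℕ) :
    coeff β (adamsSum w) = ∑ k ∈ (content β).divisors, (k : ℚ)⁻¹ * w k (divBy β k) := rfl

/-- Integral values give a polynomial over ℚ, and the monic denominator makes its coefficients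
integers. Values alone would not suffice, as x(x - 1)/2 shows. -/
theorem exists_intPoly_of_values {f : RatFunc ℚ} (hf : f ∈ monicSubring) {S : Set ℕ}
    (hS : S.Infinite) {v : ℕ → ℕ} (h : ∀ q ∈ S, (f, (v q : ℚ)) ∈ valSubring q) :
    ∃ P : Polynomial ℤ, algebraMap (Polynomial ℚ) (RatFunc ℚ) (P.map (Int.castRingHom ℚ)) = f ∧
      ∀ q ∈ S, P.eval (q : ℤ) = v q := by
  obtain ⟨p, rfl⟩ := exists_polynomial_of_integral_values hS fun q hq =>
    ⟨v q, by simpa using h q hq⟩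
  obtain ⟨P, rfl⟩ := exists_intPoly_of_mem hf
  refine ⟨P, rfl, fun q hq => ?_⟩
  have := eval_of_mem_valSubring (h q hq)
  rw [← Int.cast_natCast q, Polynomial.eval_intCast_map] at this
  rw [eq_intCast] at this
  exact_mod_cast this

/-- If the numbers `av q α` and `mv q α` satisfy the plethystic identities numerically for all
`q` in a sufficiently large set, then they are the values of polynomials that satisfy
them formally. -/
theorem exists_polynomials_of_counts [Finite σ] {r : MvPowerSeries σ (RatFunc ℚ)}
    (hr1 : constantCoeff r = 1) (hr : r ∈ coeffsIn monicSubring) {S : Set ℕ} (hS : S.Infinite)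
    (hS2 : ∀ q ∈ S, 2 ≤ q) (hpow : ∀ q ∈ S, ∀ k, k ≠ 0 → q ^ k ∈ S)
    (av mv : ℕ → (σ →₀ ℕ) → ℕ) (hav : ∀ q ∈ S, av q 0 = 0)
    (rv : ℕ → MvPowerSeries σ ℚ) (hrv : ∀ q ∈ S, ∀ α, (coeff α r, coeff α (rv q)) ∈ valSubring q)
    (hrlog : ∀ q ∈ S, IsLog (rv q) (adamsSum fun k γ => av (q ^ k) γ / ((q : ℚ) ^ k - 1)))
    (hmlog : ∀ q ∈ S, IsLog (fun α => (mv q α : ℚ) : MvPowerSeries σ ℚ)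
      (adamsSum fun k γ => av (q ^ k) γ)) :
    ∃ m a : (σ →₀ ℕ) → Polynomial ℤ,
      (∀ q ∈ S, ∀ α, (m α).eval (q : ℤ) = mv q α ∧ (a α).eval (q : ℤ) = av q α) ∧
      genSeries a = qSubOne σ * Log r ∧ genSeries m = Pow r (qSubOne σ) := by
  set A := qSubOne σ * Log r with hA
  have hAc : ∀ α, coeff α A = (RatFunc.X - 1) * coeff α (Log r) := fun α => by
    rw [hA, qSubOne, coeff_C_mul]
  have hX : ∀ q : ℕ, (RatFunc.X - 1, (q : ℚ) - 1) ∈ valSubring q := fun q =>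
    (valSubring q).sub_mem (X_mem_valSubring q) (valSubring q).one_mem
  have hAin : A ∈ coeffsIn monicSubring := by
    intro α
    rw [hAc]
    refine mul_mem (sub_mem ?_ monicSubring.one_mem) (Log_mem_coeffsIn hr1 hr α)
    have := intPoly_mem Polynomial.X
    simpa [intPoly] using this
  have hlog := isLog_log hr1
  have hval : ∀ q ∈ S, ∀ β, (coeff β ((PowerSeries.log (RatFunc ℚ)).subst (r - 1)),
      coeff β (adamsSum fun k γ => (av (q ^ k) γ : ℚ) / ((q : ℚ) ^ k - 1))) ∈ valSubring q := by
    intro q hq β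
    exact hlog.rel_right (natCast_inv_mem_valSubring q) (hrlog q hq) (n := β.degree)
      (fun α _ => hrv q hq α) β le_rfl
  have hAval : ∀ q ∈ S, ∀ α, (coeff α A, (av q α : ℚ)) ∈ valSubring q := by
    intro q hq α
    have hq2 := hS2 q hq
    by_cases hα : α = 0
    · subst hα
      rw [hAc, coeff_zero_eq_constantCoeff_apply, Log, constantCoeff_PsiInv, mul_zero, hav q hq,
        Nat.cast_zero]
      exact (valSubring q).zero_mem
    -- The coefficient of Log r and its numerical counterpart are computed simultaneously in the
    -- product ring. The n-th term uses the numerical logarithm at q^n, which is available because S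
    -- is closed under powers.
    have h1 : (∑ n ∈ (content α).divisors, ((ArithmeticFunction.moebius n : ℤ) : RatFunc ℚ × ℚ) *
        ((n : RatFunc ℚ)⁻¹, (n : ℚ)⁻¹) *
        (psi n (coeff (divBy α n) ((PowerSeries.log (RatFunc ℚ)).subst (r - 1))),
          coeff (divBy α n) (adamsSum fun k γ =>
            (av ((q ^ n) ^ k) γ : ℚ) / (((q ^ n : ℕ) : ℚ) ^ k - 1)))) ∈ valSubring q := by
      refine (valSubring q).sum_mem fun n hn => ?_
      have hn0 := (Nat.pos_of_mem_divisors hn).ne'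
      exact mul_mem (mul_mem (intCast_mem _ _) (natCast_inv_mem_valSubring q n))
        (psi_mem_valSubring hn0 (hval (q ^ n) (hpow q hq n hn0) _))
    have h2 := (valSubring q).mul_mem (hX q) h1
    convert h2 using 1
    ext
    · simp only [Prod.fst_mul, Prod.fst_sum, Prod.fst_intCast, hAc, Log, coeff_PsiInv,
        div_eq_mul_inv]
    · simp only [Prod.snd_mul, Prod.snd_sum, Prod.snd_intCast]
      -- Möbius inversion leaves only the term av q α / (q - 1), and the factor q - 1 cancels its
      -- denominator.
      have h3 := sum_moebius_divisors (content_ne_zero hα)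
        (fun N => (av (q ^ N) (divBy α N) : ℚ) / ((q : ℚ) ^ N - 1))
      have hq1 : (q : ℚ) - 1 ≠ 0 := by
        have : (2 : ℚ) ≤ q := by exact_mod_cast hq2
        intro h; linarith
      simp only [pow_one, divBy_one] at h3
      rw [← mul_div_cancel₀ (av q α : ℚ) hq1, ← h3]
      congr 1
      refine Finset.sum_congr rfl fun n hn => ?_
      obtain ⟨hn0, hn1, hn2⟩ := divisor_facts hn
      rw [coeff_adamsSum, hn2, Finset.mul_sum]
      refine Finset.sum_congr rfl fun m _ => ?_
      rw [divBy_divBy, ← pow_mul]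
      push_cast
      rw [← pow_mul, div_eq_mul_inv]
  have ha := fun α => exists_intPoly_of_values (hAin α) hS fun q hq => hAval q hq α
  choose a ha1 ha2 using ha
  have hM := isLog_Exp A
  have hPsi : ∀ q ∈ S, ∀ β, (coeff β (Psi A), coeff β (adamsSum fun k γ => (av (q ^ k) γ : ℚ))) ∈
      valSubring q := by
    intro q hq β
    have h1 : (∑ n ∈ (content β).divisors, ((n : RatFunc ℚ)⁻¹, (n : ℚ)⁻¹) *
        (psi n (coeff (divBy β n) A), (av (q ^ n) (divBy β n) : ℚ))) ∈ valSubring q := by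
      refine (valSubring q).sum_mem fun n hn => ?_
      have hn0 := (Nat.pos_of_mem_divisors hn).ne'
      exact mul_mem (natCast_inv_mem_valSubring q n)
        (psi_mem_valSubring hn0 (hAval (q ^ n) (hpow q hq n hn0) _))
    convert h1 using 1
    ext
    · rw [coeff_Psi, Prod.fst_sum]; rfl
    · rw [coeff_adamsSum, Prod.snd_sum]; rfl
  have hMval : ∀ q ∈ S, ∀ α, (coeff α (Exp A), (mv q α : ℚ)) ∈ valSubring q := fun q hq α =>
    hM.rel_left (natCast_inv_mem_valSubring q) (hmlog q hq) (n := α.degree)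
      (fun β _ => hPsi q hq β) α le_rfl
  have hMin : ∀ α, coeff α (Exp A) ∈ monicSubring := fun α =>
    exp_mem_coeffsIn (fun β _ _ => hAin β) hM α le_rfl
  have hm := fun α => exists_intPoly_of_values (hMin α) hS fun q hq => hMval q hq α
  choose m hm1 hm2 using hm
  exact ⟨m, a, fun q hq α => ⟨hm2 α q hq, ha2 α q hq⟩, funext ha1, funext hm1⟩

end Counts

end Hua

namespace Hua

open Finset Module

/-! ### Counting linear maps over finite fields -/

section Cards

theorem card_eq_sum_card_fiber {A B : Type*} [Finite A] [Fintype B] (f : A → B) :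
    Nat.card A = ∑ b, Nat.card {a // f a = b} := by
  rw [← Nat.card_sigma]
  exact Nat.card_congr (Equiv.sigmaFiberEquiv f).symm

theorem card_eq_mul_of_card_fiber {A B : Type*} [Finite A] [Finite B] (f : A → B) {c : ℕ}
    (h : ∀ b, Nat.card {a // f a = b} = c) : Nat.card A = Nat.card B * c := by
  have := Fintype.ofFinite B
  rw [card_eq_sum_card_fiber f, Finset.sum_congr rfl fun b _ => h b, Finset.sum_const,
    Finset.card_univ, smul_eq_mul, Nat.card_eq_fintype_card]

theorem card_fiber_eq_card_ker {A B : Type*} [AddGroup A] [AddGroup B] (φ : A →+ B)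
    (hφ : Function.Surjective φ) (b : B) : Nat.card {a // φ a = b} = Nat.card φ.ker := by
  obtain ⟨a₀, rfl⟩ := hφ b
  refine Nat.card_congr
    { toFun := fun a => ⟨-a₀ + a.1, by simp [AddMonoidHom.mem_ker, a.2]⟩
      invFun := fun k => ⟨a₀ + k.1, by simp [AddMonoidHom.mem_ker.1 k.2]⟩
      left_inv := fun a => by simp
      right_inv := fun k => by simp }

theorem card_subtype_comp_of_surjective {A B : Type*} [AddGroup A] [AddGroup B] [Finite A]
    (φ : A →+ B) (hφ : Function.Surjective φ) (P : B → Prop) :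
    Nat.card {a // P (φ a)} = Nat.card {b // P b} * Nat.card φ.ker := by
  have := Finite.of_surjective φ hφ
  refine card_eq_mul_of_card_fiber (fun a : {a // P (φ a)} => (⟨φ a.1, a.2⟩ : {b // P b}))
    fun b => ?_
  rw [← card_fiber_eq_card_ker φ hφ b.1]
  exact Nat.card_congr
    { toFun := fun a => ⟨a.1.1, congrArg Subtype.val a.2⟩
      invFun := fun a => ⟨⟨a.1, by rw [a.2]; exact b.2⟩, Subtype.ext a.2⟩
      left_inv := fun a => rfl
      right_inv := fun a => rfl }

theorem card_eq_card_mul_card_ker {A B : Type*} [AddGroup A] [AddGroup B] [Finite A]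
    (φ : A →+ B) (hφ : Function.Surjective φ) :
    Nat.card A = Nat.card B * Nat.card φ.ker := by
  have := Finite.of_surjective φ hφ
  exact card_eq_mul_of_card_fiber φ fun b => card_fiber_eq_card_ker φ hφ b

/-- The number of injective linear maps from a space of dimension `k` to one of dimension `n`. -/
noncomputable def injCount (q : ℚ) (k n : ℕ) : ℚ := ∏ i ∈ range k, (q ^ n - q ^ i)

/-- `φ_m(q⁻¹)`. -/
noncomputable def phiInv (q : ℚ) (m : ℕ) : ℚ := ∏ i ∈ range m, (1 - q⁻¹ ^ (i + 1))

variable {q : ℚ}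

/-- An automorphism of a space of dimension k + l restricts to an injection of a subspace of
dimension k; the second factor counts the ways to extend such an injection. -/
theorem injCount_add (q : ℚ) (k l : ℕ) :
    injCount q (k + l) (k + l) = injCount q k (k + l) * (q ^ (k * l) * injCount q l l) := by
  rw [injCount, prod_range_add, injCount, injCount]
  congr 1
  rw [pow_mul]
  conv_rhs => rw [← card_range l, ← Finset.prod_const, card_range, ← Finset.prod_mul_distrib]
  refine Finset.prod_congr rfl fun i _ => ?_
  ring

theorem injCount_self_ne_zero (hq : 1 < q) (n : ℕ) : injCount q n n ≠ 0 := by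
  refine Finset.prod_ne_zero_iff.2 fun i hi => sub_ne_zero.2 ?_
  exact (pow_lt_pow_right₀ hq (Finset.mem_range.1 hi)).ne'

theorem phiInv_ne_zero (hq : 1 < q) (n : ℕ) : phiInv q n ≠ 0 := by
  refine Finset.prod_ne_zero_iff.2 fun i _ => sub_ne_zero.2 ?_
  exact (pow_lt_one₀ (by positivity) (inv_lt_one_of_one_lt₀ hq) i.succ_ne_zero).ne'

theorem injCount_self (hq : q ≠ 0) (n : ℕ) : injCount q n n = q ^ (n ^ 2) * phiInv q n := by
  rw [injCount, ← Finset.prod_range_reflect, phiInv, sq, pow_mul]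
  conv_rhs => rw [← card_range n, ← Finset.prod_const, card_range, ← Finset.prod_mul_distrib]
  refine Finset.prod_congr rfl fun i hi => ?_
  rw [Finset.mem_range] at hi
  obtain ⟨m, rfl⟩ : ∃ m, n = i + 1 + m := ⟨n - (i + 1), by omega⟩
  have : i + 1 + m - 1 - i = m := by omega
  rw [this, mul_sub, mul_one, inv_pow, pow_add q (i + 1) m]
  field_simp

end Cards

/-! ### Injective maps, surjective maps and subspaces over a finite field -/

section LinearMaps

variable {F : Type*} [Field F] [Finite F]
variable {V : Type*} [AddCommGroup V] [Module F V] [Finite V]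
variable {W : Type*} [AddCommGroup W] [Module F W] [Finite W]

instance finite_linearMap : Finite (V →ₗ[F] W) := Finite.of_injective _ DFunLike.coe_injective

theorem one_lt_natCard_rat (F : Type*) [Field F] [Finite F] : (1 : ℚ) < Nat.card F := by
  exact_mod_cast Finite.one_lt_card

theorem card_linearIndependent_rat (k : ℕ) :
    (Nat.card {s : Fin k → V // LinearIndependent F s} : ℚ) =
      injCount (Nat.card F) k (finrank F V) := by
  have := Fintype.ofFinite F
  by_cases hk : k ≤ finrank F V
  · rw [card_linearIndependent hk, injCount, ← Fin.prod_univ_eq_prod_range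
      (fun i => ((Nat.card F : ℕ) : ℚ) ^ finrank F V - ((Nat.card F : ℕ) : ℚ) ^ i),
      Nat.card_eq_fintype_card]
    push_cast
    refine Finset.prod_congr rfl fun i _ => ?_
    rw [Nat.cast_sub (Nat.pow_le_pow_right Fintype.card_pos (by omega))]
    push_cast; rfl
  · have : IsEmpty {s : Fin k → V // LinearIndependent F s} :=
      ⟨fun s => hk (by simpa using s.2.fintype_card_le_finrank)⟩
    rw [Nat.card_of_isEmpty, injCount, Finset.prod_eq_zero (i := finrank F V)]
    · simp
    · simpa using hk
    · simp

theorem card_injective (W' V' : Type*) [AddCommGroup W'] [Module F W'] [Finite W']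
    [AddCommGroup V'] [Module F V'] [Finite V'] :
    (Nat.card {f : W' →ₗ[F] V' // Function.Injective f} : ℚ) =
      injCount (Nat.card F) (finrank F W') (finrank F V') := by
  rw [← card_linearIndependent_rat]
  congr 1
  let b := finBasis F W'
  refine Nat.card_congr ((b.constr F (M' := V')).symm.toEquiv.subtypeEquiv fun f => ?_)
  rw [LinearEquiv.coe_toEquiv]
  have : (b.constr F).symm f = f ∘ b := by
    ext i; simp [Basis.constr]
  rw [this]
  refine ⟨fun h => b.linearIndependent.map' f (LinearMap.ker_eq_bot.2 h), fun h => ?_⟩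
  rw [injective_iff_map_eq_zero]
  intro x hx
  have h1 := Fintype.linearIndependent_iff.1 h (b.repr x) (by
    have h2 : f (∑ i, b.repr x i • b i) = 0 := by rw [b.sum_repr, hx]
    simpa only [map_sum, map_smul, Function.comp_apply] using h2)
  rw [← b.repr.map_eq_zero_iff]
  exact Finsupp.ext h1

/-- Transposition exchanges surjections with injections of the dual spaces. -/
theorem card_surjective (V' W' : Type*) [AddCommGroup W'] [Module F W'] [Finite W']
    [AddCommGroup V'] [Module F V'] [Finite V'] :
    (Nat.card {f : V' →ₗ[F] W' // Function.Surjective f} : ℚ) =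
      injCount (Nat.card F) (finrank F W') (finrank F V') := by
  have : Finite (Dual F W') := finite_linearMap
  have : Finite (Dual F V') := finite_linearMap
  rw [← Subspace.dual_finrank_eq (K := F) (V := W'), ← Subspace.dual_finrank_eq (K := F) (V := V'),
    ← card_injective]
  congr 1
  have hbij : Function.Bijective (Dual.transpose (R := F) (M := V') (M' := W')) := by
    have hinj : Function.Injective (Dual.transpose (R := F) (M := V') (M' := W')) := by
      rw [injective_iff_map_eq_zero]
      intro f hf
      ext x
      rw [LinearMap.zero_apply, ← forall_dual_apply_eq_zero_iff F]
      intro φ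
      exact LinearMap.congr_fun (LinearMap.congr_fun hf φ) x
    refine hinj.bijective_of_nat_card_le (le_of_eq ?_)
    rw [natCard_eq_pow_finrank (K := F), natCard_eq_pow_finrank (K := F) (V := V' →ₗ[F] W'),
      finrank_linearMap, finrank_linearMap, finrank_linearMap, finrank_linearMap, finrank_self,
      mul_one, mul_one, mul_comm]
  refine Nat.card_congr ((Equiv.ofBijective _ hbij).subtypeEquiv fun f => ?_)
  exact (LinearMap.dualMap_injective_iff (f := f)).symm

/-- Each subspace of dimension k is spanned by as many independent k-tuples as there are bases of
F^k. -/
theorem card_submodule (k : ℕ) :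
    (Nat.card {U : Submodule F V // finrank F U = k} : ℚ) * injCount (Nat.card F) k k =
      injCount (Nat.card F) k (finrank F V) := by
  have h := card_eq_mul_of_card_fiber (A := {s : Fin k → V // LinearIndependent F s})
    (B := {U : Submodule F V // finrank F U = k})
    (fun s => ⟨Submodule.span F (Set.range s.1), by rw [finrank_span_eq_card s.2]; simp⟩)
    (c := Nat.card {s : Fin k → (Fin k → F) // LinearIndependent F s}) ?_
  · rw [← card_linearIndependent_rat, h, Nat.cast_mul, card_linearIndependent_rat, finrank_fin_fun]
  · rintro ⟨U, hU⟩
    have e : U ≃ₗ[F] (Fin k → F) := LinearEquiv.ofFinrankEq _ _ (by rw [hU, finrank_fin_fun])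
    have h1 : Nat.card {s : Fin k → (Fin k → F) // LinearIndependent F s} =
        Nat.card {s : Fin k → U // LinearIndependent F s} := by
      refine Nat.card_congr ((Equiv.arrowCongr (Equiv.refl _) e.symm.toEquiv).subtypeEquiv
        fun s => ?_)
      exact (LinearMap.linearIndependent_iff e.symm.toLinearMap e.symm.ker).symm
    rw [h1]
    refine Nat.card_congr
      { toFun := fun s => ⟨fun i => ⟨s.1.1 i, ?_⟩, ?_⟩
        invFun := fun s => ⟨⟨fun i => s.1 i, ?_⟩, ?_⟩
        left_inv := fun s => rfl
        right_inv := fun s => rfl }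
    · have := congrArg Subtype.val s.2
      simp only at this
      exact this.le (Submodule.subset_span ⟨i, rfl⟩)
    · exact LinearIndependent.of_comp U.subtype s.1.2
    · exact s.2.map' U.subtype U.ker_subtype
    · apply Subtype.ext
      simp only
      apply Submodule.eq_of_le_of_finrank_eq
      · rw [Submodule.span_le]; rintro _ ⟨i, rfl⟩; exact (s.1 i).2
      · have h2 := finrank_span_eq_card (s.2.map' U.subtype U.ker_subtype)
        rw [Fintype.card_fin] at h2
        exact h2.trans hU.symm

end LinearMaps

end Hua

namespace Hua

set_option linter.unusedSectionVars false

open Finset Module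

/-! ### Counting nilpotent endomorphisms by the ranks of their powers -/

section Nilpotent

theorem injCount_ne_zero {q : ℚ} (hq : 1 < q) {k n : ℕ} (h : k ≤ n) : injCount q k n ≠ 0 := by
  refine Finset.prod_ne_zero_iff.2 fun i hi => sub_ne_zero.2 ?_
  exact (pow_lt_pow_right₀ hq ((Finset.mem_range.1 hi).trans_le h)).ne'

variable {F : Type*} [Field F] [Finite F]
variable {V : Type w} [AddCommGroup V] [Module F V] [Finite V]
variable {W : Type w} [AddCommGroup W] [Module F W] [Finite W]

/-- The powers of `N` have the ranks `ρ`. -/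
def HasRanks (N : End F V) (ρ : ℕ → ℕ) : Prop :=
  ∀ k, finrank F (LinearMap.range (N ^ k)) = ρ k

/-- An endomorphism with image in U is U ↪ V after g : V → U, and the opposite composition is its
restriction to U. The powers of the two differ only by a shift. -/
theorem subtype_comp_pow (U : Submodule F V) (g : V →ₗ[F] U) (k : ℕ) :
    ((U.subtype ∘ₗ g : End F V) ^ (k + 1)) =
      U.subtype ∘ₗ ((g ∘ₗ U.subtype : End F U) ^ k) ∘ₗ g := by
  induction k with
  | zero => simp; rfl
  | succ k ih =>
    rw [pow_succ', ih, pow_succ' (g ∘ₗ U.subtype : End F U) k]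
    rfl

theorem hasRanks_subtype_comp {U : Submodule F V} {g : V →ₗ[F] U} (hg : Function.Surjective g)
    {ρ : ℕ → ℕ} (h0 : finrank F V = ρ 0) :
    HasRanks (U.subtype ∘ₗ g : End F V) ρ ↔
      HasRanks (g ∘ₗ U.subtype : End F U) fun k => ρ (k + 1) := by
  have h : ∀ k, finrank F (LinearMap.range ((U.subtype ∘ₗ g : End F V) ^ (k + 1))) =
      finrank F (LinearMap.range ((g ∘ₗ U.subtype : End F U) ^ k)) := by
    intro k
    rw [subtype_comp_pow, LinearMap.range_comp, LinearMap.range_comp_of_range_eq_top _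
      (LinearMap.range_eq_top.2 hg)]
    exact (Submodule.equivMapOfInjective U.subtype U.injective_subtype _).finrank_eq.symm
  refine ⟨fun H k => by rw [← h, H], fun H k => ?_⟩
  cases k with
  | zero => rw [pow_zero, End.one_eq_id, LinearMap.range_id, finrank_top, h0]
  | succ k => rw [h, H]

/-- An extension of N to V is an arbitrary map h from a complement C of U, of dimension a. It is
surjective if and only if C → U / im N is, and this last map has q^(a c) lifts to U. -/
theorem card_surjective_extension (U : Submodule F V) (N : End F U) {a b c : ℕ}
    (ha : finrank F V = a + finrank F U) (hc : finrank F (LinearMap.range N) = c)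
    (hb : finrank F U = b + c) :
    (Nat.card {g : V →ₗ[F] U // Function.Surjective g ∧ g ∘ₗ U.subtype = N} : ℚ) =
      injCount (Nat.card F) b a * (Nat.card F : ℚ) ^ (a * c) := by
  obtain ⟨C, hC⟩ := U.exists_isCompl
  have hCa : finrank F C = a := by
    have := Submodule.finrank_add_eq_of_isCompl hC
    omega
  set R := LinearMap.range N
  have hQ : finrank F (U ⧸ R) = b := by
    have := R.finrank_quotient_add_finrank
    omega
  have hsplit : ∀ v : V, ∃ x : U, ∃ y : C, (x : V) + y = v := fun v => by
    have : v ∈ U ⊔ C := hC.sup_eq_top ▸ Submodule.mem_top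
    obtain ⟨x, hx, y, hy, h⟩ := Submodule.mem_sup.1 this
    exact ⟨⟨x, hx⟩, ⟨y, hy⟩, h⟩
  let φ : (C →ₗ[F] U) →+ (C →ₗ[F] U ⧸ R) :=
    { toFun := fun h => R.mkQ ∘ₗ h
      map_zero' := by simp
      map_add' := fun x y => by simp [LinearMap.comp_add] }
  have hφ : Function.Surjective φ := by
    intro s
    obtain ⟨t, ht⟩ := LinearMap.exists_rightInverse_of_surjective R.mkQ R.range_mkQ
    refine ⟨t ∘ₗ s, ?_⟩
    change R.mkQ ∘ₗ t ∘ₗ s = s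
    rw [← LinearMap.comp_assoc, ht, LinearMap.id_comp]
  have hsurj : ∀ g : V →ₗ[F] U, g ∘ₗ U.subtype = N →
      (Function.Surjective g ↔ Function.Surjective (φ (g ∘ₗ C.subtype))) := by
    intro g hg
    have hgU : ∀ x : U, g x = N x := fun x => by rw [← hg]; rfl
    refine ⟨fun h y => ?_, fun h u => ?_⟩
    · obtain ⟨u, rfl⟩ := R.mkQ_surjective y
      obtain ⟨v, rfl⟩ := h u
      obtain ⟨x, y, rfl⟩ := hsplit v
      refine ⟨y, ?_⟩
      change R.mkQ (g y) = R.mkQ (g (x + y))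
      have h0 : R.mkQ (N x) = 0 := (Submodule.Quotient.mk_eq_zero R).2 (LinearMap.mem_range_self N x)
      rw [map_add, map_add, hgU, h0, zero_add]
    · obtain ⟨y, hy⟩ := h (R.mkQ u)
      have h1 : u - g y ∈ R := by
        rw [← Submodule.Quotient.mk_eq_zero, Submodule.Quotient.mk_sub, sub_eq_zero]
        exact hy.symm
      obtain ⟨x, hx⟩ := h1
      exact ⟨x + y, by rw [map_add, hgU, hx, sub_add_cancel]⟩
  have e : {g : V →ₗ[F] U // Function.Surjective g ∧ g ∘ₗ U.subtype = N} ≃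
      {h : C →ₗ[F] U // Function.Surjective (φ h)} :=
    { toFun := fun g => ⟨g.1 ∘ₗ C.subtype, (hsurj g.1 g.2.2).1 g.2.1⟩
      invFun := fun h => ⟨LinearMap.ofIsCompl hC N h.1, by
        have h1 : LinearMap.ofIsCompl hC N h.1 ∘ₗ U.subtype = N := by
          ext x : 1; exact LinearMap.ofIsCompl_apply_left hC x
        have h2 : LinearMap.ofIsCompl hC N h.1 ∘ₗ C.subtype = h.1 := by
          ext x : 1; exact LinearMap.ofIsCompl_apply_right hC x
        exact ⟨(hsurj _ h1).2 (by rw [h2]; exact h.2), h1⟩⟩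
      left_inv := fun g => Subtype.ext (LinearMap.ofIsCompl_eq hC
        (fun x => (LinearMap.congr_fun g.2.2 x).symm) (fun y => rfl))
      right_inv := fun h => Subtype.ext (by
        ext x : 1; exact LinearMap.ofIsCompl_apply_right hC x) }
  have : Finite (U ⧸ R) := Finite.of_surjective R.mkQ R.mkQ_surjective
  rw [Nat.card_congr e, card_subtype_comp_of_surjective φ hφ (fun s => Function.Surjective s),
    Nat.cast_mul, card_surjective, hQ, hCa]
  congr 1
  have hk := card_eq_card_mul_card_ker φ hφ
  rw [natCard_eq_pow_finrank (K := F), natCard_eq_pow_finrank (K := F) (V := C →ₗ[F] U ⧸ R),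
    finrank_linearMap, finrank_linearMap, hQ, hCa, hb, mul_add, pow_add] at hk
  have hpos : 0 < Nat.card F ^ (a * b) := pow_pos Nat.card_pos _
  exact_mod_cast (Nat.eq_of_mul_eq_mul_left hpos hk).symm

/-- An endomorphism with image U is determined by its restriction to U, whose ranks are shifted by
one, and a surjective extension of it to V; the number of extensions depends only on the ranks. -/
theorem card_fixed_range (U : Submodule F V) {ρ : ℕ → ℕ} (h0 : finrank F V = ρ 0) {lam : ℕ → ℕ}
    (hρ : ∀ k, ρ k = lam k + ρ (k + 1)) (hU : finrank F U = ρ 1) :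
    (Nat.card {N : End F V // HasRanks N ρ ∧ LinearMap.range N = U} : ℚ) =
      Nat.card {N : End F U // HasRanks N fun k => ρ (k + 1)} *
        (injCount (Nat.card F) (lam 1) (lam 0) * (Nat.card F : ℚ) ^ (lam 0 * ρ 2)) := by
  have e : {N : End F V // HasRanks N ρ ∧ LinearMap.range N = U} ≃
      {g : V →ₗ[F] U // Function.Surjective g ∧
        HasRanks (g ∘ₗ U.subtype : End F U) fun k => ρ (k + 1)} :=
    { toFun := fun N => ⟨N.1.codRestrict U fun x => N.2.2.le (LinearMap.mem_range_self N.1 x), by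
        have hs : Function.Surjective (N.1.codRestrict U
            fun x => N.2.2.le (LinearMap.mem_range_self N.1 x)) := by
          rintro ⟨y, hy⟩
          rw [← N.2.2] at hy
          obtain ⟨x, rfl⟩ := hy
          exact ⟨x, rfl⟩
        exact ⟨hs, (hasRanks_subtype_comp hs h0).1 N.2.1⟩⟩
      invFun := fun g => ⟨U.subtype ∘ₗ g.1, (hasRanks_subtype_comp g.2.1 h0).2 g.2.2, by
        rw [LinearMap.range_comp, LinearMap.range_eq_top.2 g.2.1, Submodule.map_top,
          Submodule.range_subtype]⟩
      left_inv := fun N => rfl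
      right_inv := fun g => rfl }
  rw [Nat.card_congr e]
  by_cases hemp : IsEmpty {N : End F U // HasRanks N fun k => ρ (k + 1)}
  · have : IsEmpty {g : V →ₗ[F] U // Function.Surjective g ∧
        HasRanks (g ∘ₗ U.subtype : End F U) fun k => ρ (k + 1)} :=
      ⟨fun g => hemp.false ⟨_, g.2.2⟩⟩
    simp
  rw [not_isEmpty_iff] at hemp
  have key : ∀ N : {N : End F U // HasRanks N fun k => ρ (k + 1)},
      (Nat.card {g : V →ₗ[F] U // Function.Surjective g ∧ g ∘ₗ U.subtype = N.1} : ℚ) =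
      injCount (Nat.card F) (lam 1) (lam 0) * (Nat.card F : ℚ) ^ (lam 0 * ρ 2) := by
    intro N
    refine card_surjective_extension U N.1 (by rw [h0, hU, hρ 0]) ?_ (by rw [hU, hρ 1])
    have := N.2 1
    rwa [pow_one] at this
  have h := card_eq_mul_of_card_fiber (A := {g : V →ₗ[F] U // Function.Surjective g ∧
      HasRanks (g ∘ₗ U.subtype : End F U) fun k => ρ (k + 1)})
    (B := {N : End F U // HasRanks N fun k => ρ (k + 1)}) (fun g => ⟨_, g.2.2⟩)
    (c := Nat.card {g : V →ₗ[F] U // Function.Surjective g ∧ g ∘ₗ U.subtype = hemp.some.1}) ?_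
  · rw [h, Nat.cast_mul, key]
  · intro N
    have h1 : Nat.card {g : V →ₗ[F] U // Function.Surjective g ∧ g ∘ₗ U.subtype = hemp.some.1} =
        Nat.card {g : V →ₗ[F] U // Function.Surjective g ∧ g ∘ₗ U.subtype = N.1} := by
      exact_mod_cast (key hemp.some).trans (key N).symm
    rw [h1]
    exact Nat.card_congr
      { toFun := fun g => ⟨g.1.1, g.1.2.1, congrArg Subtype.val g.2⟩
        invFun := fun g => ⟨⟨g.1, g.2.1, by rw [g.2.2]; exact N.2⟩, Subtype.ext g.2.2⟩
        left_inv := fun g => rfl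
        right_inv := fun g => rfl }

/-- The contribution of two consecutive parts to the number of nilpotent endomorphisms. -/
noncomputable def partWeight (q : ℚ) (a b : ℕ) : ℚ := (q ^ (a ^ 2))⁻¹ / phiInv q (a - b)

/-- The arithmetic of the induction in `card_hasRanks`, with a = λ_0, b = λ_1 and c = ρ_2. The first
factor is the number of subspaces of dimension b + c times the order of the general linear group of
such a subspace. -/
theorem partWeight_identity {q : ℚ} (hq : 1 < q) (a b c : ℕ) (hab : b ≤ a) :
    injCount q (b + c) (a + (b + c)) * (injCount q b a * q ^ (a * c)) =
      injCount q (a + (b + c)) (a + (b + c)) * partWeight q a b := by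
  have hq0 : q ≠ 0 := by positivity
  obtain ⟨m, rfl⟩ := Nat.exists_eq_add_of_le hab
  have h1 := injCount_add q (b + c) (b + m)
  have h2 := injCount_add q b m
  rw [add_comm (b + c)] at h1
  rw [h1, h2, partWeight, Nat.add_sub_cancel_left, injCount_self hq0 m]
  have := phiInv_ne_zero hq m
  field_simp
  ring

/-- Induction on the nilpotency bound through the image of N: choose a subspace of dimension ρ_1 and
an endomorphism of it with the shifted ranks, then extend. The drops λ_k of the ranks count the
Jordan blocks of size greater than k. -/
theorem card_hasRanks (n : ℕ) : ∀ {V : Type w} [AddCommGroup V] [Module F V] [Finite V]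
    {ρ lam : ℕ → ℕ}, finrank F V = ρ 0 → (∀ k, ρ k = lam k + ρ (k + 1)) → Antitone lam → ρ n = 0 →
    (Nat.card {N : End F V // HasRanks N ρ} : ℚ) =
      injCount (Nat.card F) (ρ 0) (ρ 0) *
        ∏ k ∈ range n, partWeight (Nat.card F) (lam k) (lam (k + 1)) := by
  induction n with
  | zero =>
    intro V _ _ _ ρ lam h0 hρ hlam hn
    have hρ0 : ∀ k, ρ k = 0 := by
      intro k
      induction k with
      | zero => exact hn
      | succ k ih => have := hρ k; omega
    have : Subsingleton V := finrank_zero_iff.1 (h0.trans hn)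
    have : Unique {N : End F V // HasRanks N ρ} :=
      { default := ⟨0, fun k => by rw [hρ0]; exact finrank_zero_of_subsingleton⟩
        uniq := fun N => Subtype.ext (Subsingleton.elim _ _) }
    simp [hn, injCount]
  | succ n ih =>
    intro V _ _ _ ρ lam h0 hρ hlam hn
    have hq := one_lt_natCard_rat F
    by_cases hemp : IsEmpty {U : Submodule F V // finrank F U = ρ 1}
    · exfalso
      have h := card_submodule (F := F) (V := V) (ρ 1)
      rw [Nat.card_of_isEmpty, Nat.cast_zero, zero_mul, h0] at h
      -- A subspace of dimension ρ_1 ≤ ρ_0 exists because the number of injections is nonzero.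
      exact injCount_ne_zero hq (by have := hρ 0; rw [zero_add] at this; omega) h.symm
    rw [not_isEmpty_iff] at hemp
    have key : ∀ U : {U : Submodule F V // finrank F U = ρ 1},
        (Nat.card {N : End F V // HasRanks N ρ ∧ LinearMap.range N = U.1} : ℚ) =
        (injCount (Nat.card F) (ρ 1) (ρ 1) *
          ∏ k ∈ range n, partWeight (Nat.card F) (lam (k + 1)) (lam (k + 1 + 1))) *
        (injCount (Nat.card F) (lam 1) (lam 0) * (Nat.card F : ℚ) ^ (lam 0 * ρ 2)) := by
      intro U
      rw [card_fixed_range U.1 h0 hρ U.2, ih (V := U.1) (lam := fun k => lam (k + 1)) U.2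
        (fun k => hρ (k + 1)) (fun a b h => hlam (Nat.succ_le_succ h)) hn]
    have h := card_eq_mul_of_card_fiber (A := {N : End F V // HasRanks N ρ})
      (B := {U : Submodule F V // finrank F U = ρ 1})
      (fun N => ⟨LinearMap.range N.1, by have := N.2 1; rwa [pow_one] at this⟩)
      (c := Nat.card {N : End F V // HasRanks N ρ ∧ LinearMap.range N = hemp.some.1}) ?_
    · have hU := card_submodule (F := F) (V := V) (ρ 1)
      rw [h, Nat.cast_mul, key, prod_range_succ', mul_assoc (injCount _ (ρ 1) (ρ 1)), ← mul_assoc,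
        hU, h0]
      have h2 : ρ 2 + lam 1 = ρ 1 := by rw [hρ 1, add_comm]
      have h3 := partWeight_identity hq (lam 0) (lam 1) (ρ 2) (hlam (Nat.zero_le 1))
      have e1 : lam 1 + ρ 2 = ρ 1 := (hρ 1).symm
      have e0 : lam 0 + ρ 1 = ρ 0 := (hρ 0).symm
      rw [e1, e0] at h3
      linear_combination (∏ k ∈ range n, partWeight (Nat.card F) (lam (k + 1)) (lam (k + 1 + 1))) * h3
    · intro U
      have h1 : Nat.card {N : End F V // HasRanks N ρ ∧ LinearMap.range N = hemp.some.1} =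
          Nat.card {N : End F V // HasRanks N ρ ∧ LinearMap.range N = U.1} := by
        exact_mod_cast (key hemp.some).trans (key U).symm
      rw [h1]
      exact Nat.card_congr
        { toFun := fun g => ⟨g.1.1, g.1.2, congrArg Subtype.val g.2⟩
          invFun := fun g => ⟨⟨g.1, g.2.1⟩, Subtype.ext g.2.2⟩
          left_inv := fun g => rfl
          right_inv := fun g => rfl }

end Nilpotent

end Hua

namespace Hua

set_option linter.unusedSectionVars false

open Finset Module

/-! ### Counting maps that commute with nilpotent endomorphisms -/

section Commuting

variable {F : Type*} [Field F] [Finite F]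

/-- The linear maps that intertwine two endomorphisms. -/
def intertwiners {V W : Type*} [AddCommGroup V] [Module F V] [AddCommGroup W] [Module F W]
    (N : End F V) (N' : End F W) : AddSubgroup (V →ₗ[F] W) where
  carrier := {f | f ∘ₗ N = N' ∘ₗ f}
  zero_mem' := by simp
  add_mem' {f g} hf hg := by
    change (f + g) ∘ₗ N = N' ∘ₗ (f + g)
    rw [LinearMap.add_comp, LinearMap.comp_add, hf, hg]
  neg_mem' {f} hf := by
    change (-f) ∘ₗ N = N' ∘ₗ (-f)
    rw [LinearMap.neg_comp, LinearMap.comp_neg, hf]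

theorem mem_intertwiners {V W : Type*} [AddCommGroup V] [Module F V] [AddCommGroup W] [Module F W]
    {N : End F V} {N' : End F W} {f : V →ₗ[F] W} :
    f ∈ intertwiners N N' ↔ ∀ x, f (N x) = N' (f x) :=
  ⟨fun h x => LinearMap.congr_fun h x, fun h => LinearMap.ext h⟩

/-- The restriction of an endomorphism to its range. -/
def rangeRestr {V : Type*} [AddCommGroup V] [Module F V] (N : End F V) :
    End F (LinearMap.range N) := N.rangeRestrict ∘ₗ (LinearMap.range N).subtype

theorem hasRanks_rangeRestr {V : Type w} [AddCommGroup V] [Module F V] [Finite V] {N : End F V}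
    {ρ : ℕ → ℕ} (h : HasRanks N ρ) : HasRanks (rangeRestr N) fun k => ρ (k + 1) := by
  refine (hasRanks_subtype_comp (g := N.rangeRestrict) N.surjective_rangeRestrict ?_).1 h
  have := h 0
  rwa [pow_zero, End.one_eq_id, LinearMap.range_id, finrank_top] at this

/-- An intertwiner maps im N to im N', so it can be restricted to the images. The restriction is
onto, and its kernel is Hom(C, ker N') for a complement C of im N; here dim C = a and dim ker N' =
b. -/
theorem card_intertwiners_step {V W : Type w} [AddCommGroup V] [Module F V] [Finite V]
    [AddCommGroup W] [Module F W] [Finite W] (N : End F V) (N' : End F W) {a b : ℕ}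
    (ha : finrank F V = a + finrank F (LinearMap.range N))
    (hb : finrank F W = b + finrank F (LinearMap.range N')) :
    Nat.card (intertwiners N N') =
      Nat.card (intertwiners (rangeRestr N) (rangeRestr N')) * Nat.card F ^ (a * b) := by
  have hmaps : ∀ f ∈ intertwiners N N', ∀ x ∈ LinearMap.range N, f x ∈ LinearMap.range N' := by
    rintro f hf _ ⟨x, rfl⟩
    exact ⟨f x, (mem_intertwiners.1 hf x).symm⟩
  let φ : intertwiners N N' →+ intertwiners (rangeRestr N) (rangeRestr N') :=
    { toFun := fun f => ⟨f.1.restrict (hmaps f.1 f.2), mem_intertwiners.2 fun x =>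
        Subtype.ext (mem_intertwiners.1 f.2 x)⟩
      map_zero' := rfl
      map_add' := fun f g => rfl }
  obtain ⟨C, hC⟩ := (LinearMap.range N).exists_isCompl
  have hCa : finrank F C = a := by
    have := Submodule.finrank_add_eq_of_isCompl hC
    omega
  have hK : finrank F (LinearMap.ker N') = b := by
    have := N'.finrank_range_add_finrank_ker
    omega
  have hsplit : ∀ v : V, ∃ x : LinearMap.range N, ∃ y : C, (x : V) + y = v := fun v => by
    have : v ∈ LinearMap.range N ⊔ C := hC.sup_eq_top ▸ Submodule.mem_top
    obtain ⟨x, hx, y, hy, h⟩ := Submodule.mem_sup.1 this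
    exact ⟨⟨x, hx⟩, ⟨y, hy⟩, h⟩
  have hφ : Function.Surjective φ := by
    rintro ⟨ψ, hψ⟩
    obtain ⟨s, hs⟩ := LinearMap.exists_rightInverse_of_surjective N'.rangeRestrict
      N'.range_rangeRestrict
    have hs' : ∀ y, N' (s y) = y := fun y => congrArg Subtype.val (LinearMap.congr_fun hs y)
    -- For y in C the condition N' f(y) = ψ(N y) only prescribes f(y) up to ker N'; the section s of
    -- N' picks a solution.
    set f := LinearMap.ofIsCompl hC ((LinearMap.range N').subtype ∘ₗ ψ)
      (s ∘ₗ ψ ∘ₗ N.rangeRestrict ∘ₗ C.subtype)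
    have hf1 : ∀ x : LinearMap.range N, f x = ψ x := fun x => LinearMap.ofIsCompl_apply_left hC x
    have hf2 : ∀ y : C, f y = s (ψ (N.rangeRestrict y)) :=
      fun y => LinearMap.ofIsCompl_apply_right hC y
    have hf : f ∈ intertwiners N N' := by
      refine mem_intertwiners.2 fun v => ?_
      have h1 : ∀ v, f (N v) = ψ (N.rangeRestrict v) := fun v => hf1 (N.rangeRestrict v)
      obtain ⟨x, y, rfl⟩ := hsplit v
      rw [map_add, map_add, map_add, map_add, hf2, hs', h1, h1, hf1]
      congr 1
      exact congrArg Subtype.val (mem_intertwiners.1 hψ x)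
    exact ⟨⟨f, hf⟩, Subtype.ext (LinearMap.ext fun x => Subtype.ext (hf1 x))⟩
  rw [card_eq_card_mul_card_ker φ hφ]
  congr 1
  have e : φ.ker ≃ (C →ₗ[F] LinearMap.ker N') :=
    { toFun := fun f => LinearMap.codRestrict _ (f.1.1 ∘ₗ C.subtype) fun y => by
        have h1 := congrArg Subtype.val (LinearMap.congr_fun
          (congrArg Subtype.val (AddMonoidHom.mem_ker.1 f.2)) (N.rangeRestrict y))
        exact (mem_intertwiners.1 f.1.2 y).symm.trans h1
      invFun := fun g => ⟨⟨LinearMap.ofIsCompl hC 0 ((LinearMap.ker N').subtype ∘ₗ g),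
        mem_intertwiners.2 fun v => by
          obtain ⟨x, y, rfl⟩ := hsplit v
          have h1 : ∀ v, LinearMap.ofIsCompl hC 0 ((LinearMap.ker N').subtype ∘ₗ g) (N v) = 0 :=
            fun v => LinearMap.ofIsCompl_apply_left hC (N.rangeRestrict v)
          rw [h1, map_add, LinearMap.ofIsCompl_apply_left, LinearMap.ofIsCompl_apply_right,
            LinearMap.zero_apply, zero_add]
          exact (g y).2.symm⟩, AddMonoidHom.mem_ker.2 (Subtype.ext (LinearMap.ext fun x =>
            Subtype.ext (LinearMap.ofIsCompl_apply_left hC x)))⟩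
      left_inv := fun f => Subtype.ext (Subtype.ext (LinearMap.ofIsCompl_eq hC
        (fun x => (congrArg Subtype.val (LinearMap.congr_fun
          (congrArg Subtype.val (AddMonoidHom.mem_ker.1 f.2)) x)).symm) (fun y => rfl)))
      right_inv := fun g => LinearMap.ext fun y => Subtype.ext
        (LinearMap.ofIsCompl_apply_right hC y) }
  rw [Nat.card_congr e, natCard_eq_pow_finrank (K := F), finrank_linearMap, hCa, hK]

theorem card_intertwiners (n : ℕ) : ∀ {V W : Type w} [AddCommGroup V] [Module F V] [Finite V]
    [AddCommGroup W] [Module F W] [Finite W] {N : End F V} {N' : End F W} {ρ ρ' lam mu : ℕ → ℕ},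
    HasRanks N ρ → HasRanks N' ρ' → (∀ k, ρ k = lam k + ρ (k + 1)) →
    (∀ k, ρ' k = mu k + ρ' (k + 1)) → ρ n = 0 →
    Nat.card (intertwiners N N') = Nat.card F ^ ∑ k ∈ range n, lam k * mu k := by
  induction n with
  | zero =>
    intro V W _ _ _ _ _ _ N N' ρ ρ' lam mu h h' hρ hρ' hn
    have h0 := h 0
    rw [pow_zero, End.one_eq_id, LinearMap.range_id, finrank_top, hn] at h0
    have : Subsingleton V := finrank_zero_iff.1 h0
    have : Subsingleton (intertwiners N N') := ⟨fun f g => Subtype.ext (Subsingleton.elim _ _)⟩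
    simp
  | succ n ih =>
    intro V W _ _ _ _ _ _ N N' ρ ρ' lam mu h h' hρ hρ' hn
    have h0 := h 0
    have h0' := h' 0
    have h1 := h 1
    have h1' := h' 1
    rw [pow_zero, End.one_eq_id, LinearMap.range_id, finrank_top, hρ 0] at h0
    rw [pow_zero, End.one_eq_id, LinearMap.range_id, finrank_top, hρ' 0] at h0'
    rw [pow_one] at h1 h1'
    rw [card_intertwiners_step N N' (a := lam 0) (b := mu 0) (by rw [h0, h1]) (by rw [h0', h1']),
      ih (hasRanks_rangeRestr h) (hasRanks_rangeRestr h') (fun k => hρ (k + 1))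
        (fun k => hρ' (k + 1)) hn, ← pow_add, sum_range_succ']

end Commuting

end Hua

namespace Hua

set_option linter.unusedSectionVars false

open Finset Module

/-! ### Partitions and ranks -/

section Partitions

/-- In a decreasing list the zeros come last, and the default value 0 replaces them once removed. -/
theorem getD_filter_of_pairwise (l : List ℕ) (h : l.Pairwise (· ≥ ·)) (k : ℕ) :
    (l.filter (· ≠ 0)).getD k 0 = l.getD k 0 := by
  induction l generalizing k with
  | nil => rfl
  | cons a t ih =>
    rw [List.pairwise_cons] at h
    by_cases ha : a = 0
    · subst ha
      have h0 : ∀ b ∈ t, b = 0 := fun b hb => Nat.le_zero.1 (h.1 b hb)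
      have h1 : (0 :: t).filter (· ≠ 0) = [] := by
        rw [List.filter_eq_nil_iff]
        intro b hb
        rcases List.mem_cons.1 hb with rfl | hb
        · simp
        · simp [h0 b hb]
      rw [h1]
      cases k with
      | zero => rfl
      | succ k =>
        rw [List.getD_cons_succ, List.getD_nil]
        by_cases hk : k < t.length
        · rw [List.getD_eq_getElem _ _ hk, h0 _ (List.getElem_mem hk)]
        · rw [List.getD_eq_default _ _ (not_lt.1 hk)]
    · rw [List.filter_cons_of_pos (by simpa using ha)]
      cases k with
      | zero => rfl
      | succ k => rw [List.getD_cons_succ, List.getD_cons_succ, ih h.2]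

theorem sum_getD (l : List ℕ) {n : ℕ} (h : l.length ≤ n) : ∑ k ∈ range n, l.getD k 0 = l.sum := by
  induction l generalizing n with
  | nil => simp
  | cons a t ih =>
    obtain ⟨m, rfl⟩ := Nat.exists_eq_add_of_le' (Nat.lt_of_lt_of_le (Nat.succ_pos _) h)
    rw [sum_range_succ', List.sum_cons, add_comm]
    congr 1
    rw [← ih (n := m) (by simpa using h)]
    rfl

variable {n : ℕ}

theorem part_antitone (p : n.Partition) : Antitone (part p) := by
  refine antitone_nat_of_succ_le fun k => ?_
  unfold part
  set l := p.parts.sort (· ≥ ·)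
  have hs : l.Pairwise (· ≥ ·) := Multiset.pairwise_sort ..
  by_cases hk : k + 1 < l.length
  · rw [List.getD_eq_getElem _ _ hk, List.getD_eq_getElem _ _ (by omega)]
    exact List.pairwise_iff_getElem.1 hs _ _ _ _ (Nat.lt_succ_self k)
  · rw [List.getD_eq_default _ _ (not_lt.1 hk)]
    exact Nat.zero_le _

theorem length_sort_le (p : n.Partition) : (p.parts.sort (· ≥ ·)).length ≤ n := by
  rw [Multiset.length_sort]
  calc p.parts.card = p.parts.card • 1 := by simp
    _ ≤ p.parts.sum := Multiset.card_nsmul_le_sum fun x hx => p.parts_pos hx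
    _ = n := p.parts_sum

theorem part_eq_zero (p : n.Partition) {k : ℕ} (hk : n ≤ k) : part p k = 0 :=
  List.getD_eq_default _ _ ((length_sort_le p).trans hk)

theorem sum_part (p : n.Partition) : ∑ k ∈ range n, part p k = n := by
  unfold part
  rw [sum_getD _ (length_sort_le p), ← Multiset.sum_coe, Multiset.sort_eq, p.parts_sum]

theorem part_injective : Function.Injective (part : n.Partition → ℕ → ℕ) := by
  intro p p' h
  have hpos : ∀ (p : n.Partition) k, k < (p.parts.sort (· ≥ ·)).length ↔ 0 < part p k := by
    intro p k
    unfold part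
    by_cases hk : k < (p.parts.sort (· ≥ ·)).length
    · rw [List.getD_eq_getElem _ _ hk]
      simp only [hk, true_iff]
      exact p.parts_pos ((Multiset.mem_sort (· ≥ ·)).1 (List.getElem_mem hk))
    · rw [List.getD_eq_default _ _ (not_lt.1 hk)]
      exact iff_of_false hk (lt_irrefl 0)
  have hl : (p.parts.sort (· ≥ ·)) = (p'.parts.sort (· ≥ ·)) := by
    have hlen : ∀ k, k < (p.parts.sort (· ≥ ·)).length ↔ k < (p'.parts.sort (· ≥ ·)).length := by
      intro k; rw [hpos, hpos, h]
    apply List.ext_getElem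
    · apply le_antisymm
      · by_contra hlt; exact absurd ((hlen _).1 (not_le.1 hlt)) (lt_irrefl _)
      · by_contra hlt; exact absurd ((hlen _).2 (not_le.1 hlt)) (lt_irrefl _)
    · intro k h1 h2
      have := congrFun h k
      unfold part at this
      rwa [List.getD_eq_getElem _ _ h1, List.getD_eq_getElem _ _ h2] at this
  apply Nat.Partition.ext
  rw [← Multiset.sort_eq p.parts (· ≥ ·), hl, Multiset.sort_eq]

theorem exists_partition {lam : ℕ → ℕ} (hlam : Antitone lam) (hsum : ∑ k ∈ range n, lam k = n)
    (h0 : ∀ k, n ≤ k → lam k = 0) : ∃ p : n.Partition, part p = lam := by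
  set l := (List.range n).map lam with hl
  have hs : l.Pairwise (· ≥ ·) := by
    rw [hl, List.pairwise_map]
    exact (List.pairwise_lt_range).imp fun h => hlam h.le
  have hlsum : (l : Multiset ℕ).sum = n := by
    rw [Multiset.sum_coe, hl]
    refine Eq.trans ?_ hsum
    rw [Finset.sum_range, ← List.sum_ofFn, List.ofFn_eq_map, ← List.map_coe_finRange_eq_range,
      List.map_map]
    rfl
  refine ⟨Nat.Partition.ofSums n l hlsum, funext fun k => ?_⟩
  have h1 : ((Nat.Partition.ofSums n l hlsum).parts.sort (· ≥ ·)) = l.filter (· ≠ 0) := by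
    rw [Nat.Partition.ofSums_parts, Multiset.filter_coe, Multiset.coe_sort]
    exact List.mergeSort_of_pairwise (by simpa using hs.filter _)
  rw [part, h1, getD_filter_of_pairwise l hs]
  by_cases hk : k < n
  · rw [List.getD_eq_getElem _ _ (by simpa [hl] using hk)]
    simp [hl]
  · rw [List.getD_eq_default _ _ (by simpa [hl] using hk), h0 k (not_lt.1 hk)]

/-- The ranks of the powers of a nilpotent endomorphism with the type `p`. -/
def ranksOf (p : n.Partition) (k : ℕ) : ℕ := ∑ j ∈ range n, part p (k + j)

theorem ranksOf_succ (p : n.Partition) (k : ℕ) : ranksOf p k = part p k + ranksOf p (k + 1) := by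
  have h1 := sum_range_succ' (fun j => part p (k + j)) n
  have h2 := sum_range_succ (fun j => part p (k + j)) n
  rw [part_eq_zero p (Nat.le_add_left n k), add_zero] at h2
  rw [ranksOf, ← h2, h1, add_zero, add_comm, ranksOf]
  congr 1
  refine Finset.sum_congr rfl fun j _ => ?_
  rw [add_right_comm, add_assoc]

theorem ranksOf_zero (p : n.Partition) : ranksOf p 0 = n := by
  simp only [ranksOf, zero_add, sum_part]

theorem ranksOf_eq_zero (p : n.Partition) {k : ℕ} (hk : n ≤ k) : ranksOf p k = 0 :=
  Finset.sum_eq_zero fun j _ => part_eq_zero p (by omega)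

variable {F : Type*} [Field F] [Finite F]
variable {V : Type w} [AddCommGroup V] [Module F V] [Finite V]

theorem HasRanks.isNilpotent {N : End F V} {ρ : ℕ → ℕ} (h : HasRanks N ρ) {k : ℕ}
    (hk : ρ k = 0) : IsNilpotent N := by
  refine ⟨k, ?_⟩
  have h1 := h k
  rw [hk, Submodule.finrank_eq_zero, LinearMap.range_eq_bot] at h1
  exact h1

theorem finrank_range_pow_le (N : End F V) (k : ℕ) :
    finrank F (LinearMap.range (N ^ (k + 1))) ≤ finrank F (LinearMap.range (N ^ k)) := by
  apply Submodule.finrank_mono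
  rw [pow_succ]
  exact LinearMap.range_comp_le_range _ _

/-- The drop of the rank from N^k to N^(k+1) is the dimension of ker N ∩ im N^k, which decreases
with k. -/
theorem finrank_range_convex (N : End F V) (k : ℕ) :
    finrank F (LinearMap.range (N ^ (k + 1))) + finrank F (LinearMap.range (N ^ (k + 1))) ≤
      finrank F (LinearMap.range (N ^ k)) + finrank F (LinearMap.range (N ^ (k + 2))) := by
  have h : ∀ k, finrank F (LinearMap.range (N ^ k)) = finrank F (LinearMap.range (N ^ (k + 1))) +
      finrank F (LinearMap.ker (N.domRestrict (LinearMap.range (N ^ k)))) := by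
    intro k
    rw [← (N.domRestrict (LinearMap.range (N ^ k))).finrank_range_add_finrank_ker,
      LinearMap.range_domRestrict, pow_succ', End.mul_eq_comp, LinearMap.range_comp]
  have hle : finrank F (LinearMap.ker (N.domRestrict (LinearMap.range (N ^ (k + 1))))) ≤
      finrank F (LinearMap.ker (N.domRestrict (LinearMap.range (N ^ k)))) := by
    have hsub : LinearMap.range (N ^ (k + 1)) ≤ LinearMap.range (N ^ k) := by
      rw [pow_succ]; exact LinearMap.range_comp_le_range _ _
    refine LinearMap.finrank_le_finrank_of_injective (f := ((Submodule.inclusion hsub).comp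
      (Submodule.subtype _)).codRestrict _ fun x => ?_) ?_
    · exact x.2
    · intro x y hxy
      apply Subtype.ext; apply Subtype.ext
      exact congrArg (fun z => ((z.1 : LinearMap.range (N ^ k)) : V)) hxy
  have h1 := h k
  have h2 : finrank F (LinearMap.range (N ^ (k + 1))) =
      finrank F (LinearMap.range (N ^ (k + 2))) + _ := h (k + 1)
  omega

/-- By convexity the drops of the ranks form a partition. It is conjugate to the partition of Jordan
block sizes, which does not matter as all partitions are summed over. -/
theorem exists_partition_hasRanks {N : End F V} (hN : IsNilpotent N) (hn : finrank F V = n) :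
    ∃ p : n.Partition, HasRanks N (ranksOf p) := by
  set ρ : ℕ → ℕ := fun k => finrank F (LinearMap.range (N ^ k)) with hρ
  have hle : ∀ k, ρ (k + 1) ≤ ρ k := finrank_range_pow_le N
  have hconv : ∀ k, ρ (k + 1) + ρ (k + 1) ≤ ρ k + ρ (k + 2) := finrank_range_convex N
  have hρ0 : ρ 0 = n := by
    change finrank F (LinearMap.range (N ^ 0)) = n
    rw [pow_zero, End.one_eq_id, LinearMap.range_id, finrank_top, hn]
  have hρn : ∀ k, n ≤ k → ρ k = 0 := by
    intro k hk
    have h1 : N ^ k = 0 := by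
      have := (LinearMap.isNilpotent_iff_charpoly N).1 hN
      have h2 := N.aeval_self_charpoly
      rw [this, map_pow, Polynomial.aeval_X, hn] at h2
      exact pow_eq_zero_of_le hk h2
    change finrank F (LinearMap.range (N ^ k)) = 0
    rw [h1, LinearMap.range_zero, finrank_bot]
  have hlam : Antitone fun k => ρ k - ρ (k + 1) := by
    refine antitone_nat_of_succ_le fun k => ?_
    have h1 : ρ (k + 1) + ρ (k + 1) ≤ ρ k + ρ (k + 1 + 1) := hconv k
    have := hle k; have := hle (k + 1)
    show ρ (k + 1) - ρ (k + 1 + 1) ≤ ρ k - ρ (k + 1)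
    omega
  have htel : ∀ m, ∑ k ∈ range m, (ρ k - ρ (k + 1)) + ρ m = ρ 0 := by
    intro m
    induction m with
    | zero => simp
    | succ m ih => rw [sum_range_succ]; have := hle m; omega
  obtain ⟨p, hp⟩ := exists_partition (n := n) hlam
    (by have := htel n; rw [hρn n le_rfl, hρ0, add_zero] at this; exact this)
    (fun k hk => by
      have h1 := hρn k hk
      show ρ k - ρ (k + 1) = 0
      omega)
  refine ⟨p, fun k => ?_⟩
  change ρ k = _
  have h1 : ∀ m, ρ (k + m) + ∑ j ∈ range m, part p (k + j) = ρ k := by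
    intro m
    induction m with
    | zero => simp
    | succ m ih =>
      rw [sum_range_succ, hp]
      have := hle (k + m)
      rw [hp] at ih
      simp only at ih ⊢
      have e : k + (m + 1) = k + m + 1 := by ring
      rw [e]
      omega
  rw [← h1 n, hρn _ (Nat.le_add_left n k), zero_add, ranksOf]

theorem hasRanks_ranksOf_unique {N : End F V} {p p' : n.Partition}
    (h : HasRanks N (ranksOf p)) (h' : HasRanks N (ranksOf p')) : p = p' := by
  have h1 : ∀ k, ranksOf p k = ranksOf p' k := fun k => (h k).symm.trans (h' k)
  refine part_injective (funext fun k => ?_)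
  have e1 := ranksOf_succ p k
  have e2 := ranksOf_succ p' k
  rw [h1, h1] at e1
  omega

end Partitions

end Hua

namespace Hua

set_option linter.unusedSectionVars false

open Finset Module

/-! ### The coefficients of `r` as weighted counts -/

section Count

variable {V : Type u} [Quiver.{v + 1} V] [Fintype V] [DecidableEq V]

/-- The representations on the coordinate spaces of dimension vector `α`. -/
abbrev RepSpace (F : Type w) [Field F] (V : Type u) [Quiver.{v + 1} V] (α : V →₀ ℕ) :=
  ∀ i j : V, (i ⟶ j) → ((Fin (α i) → F) →ₗ[F] (Fin (α j) → F))

/-- The representations together with a nilpotent endomorphism. -/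
abbrev NilPairs (F : Type w) [Field F] (V : Type u) [Quiver.{v + 1} V] (α : V →₀ ℕ) :=
  {p : (∀ i, End F (Fin (α i) → F)) × RepSpace F V α //
    (∀ i, IsNilpotent (p.1 i)) ∧ ∀ i j (e : i ⟶ j), p.2 i j e ∈ intertwiners (p.1 i) (p.1 j)}

/-- The value of `r_α` at the natural number `q`. -/
noncomputable def rValue (V : Type u) [Quiver.{v + 1} V] [Fintype V] [DecidableEq V] (q : ℕ) (α : V →₀ ℕ) : ℚ :=
  ∑ lam : ∀ i, (α i).Partition, ∏ k ∈ range (∑ i, α i),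
    ((∏ i, partWeight q (part (lam i) k) (part (lam i) (k + 1))) *
      (q : ℚ) ^ ∑ i, ∑ j, Nat.card (i ⟶ j) * (part (lam i) k * part (lam j) k))

variable {F : Type w} [Field F] [Finite F] [∀ i j : V, Finite (i ⟶ j)]

/-- Pairs are sorted by the type of the nilpotent endomorphism at each vertex. Given the
endomorphisms, the maps at the arrows are chosen independently among the intertwiners, and their
number depends only on the types. -/
theorem card_nilPairs (α : V →₀ ℕ) : (Nat.card (NilPairs F V α) : ℚ) =
    (∏ i, injCount (Nat.card F) (α i) (α i)) * rValue V (Nat.card F) α := by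
  set n := ∑ i, α i with hn
  have hle : ∀ i, α i ≤ n := fun i => single_le_sum (f := fun i => α i) (fun _ _ => Nat.zero_le _)
    (mem_univ i)
  let type : NilPairs F V α → ∀ i, (α i).Partition := fun p i =>
    (exists_partition_hasRanks (p.2.1 i) (finrank_fin_fun F)).choose
  have htype : ∀ p i, HasRanks (p.1.1 i) (ranksOf (type p i)) := fun p i =>
    (exists_partition_hasRanks (p.2.1 i) (finrank_fin_fun F)).choose_spec
  rw [card_eq_sum_card_fiber type, Nat.cast_sum, rValue, mul_sum]
  refine Finset.sum_congr rfl fun lam _ => ?_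
  let e : {p // type p = lam} ≃ Σ N : ∀ i, {N : End F (Fin (α i) → F) // HasRanks N (ranksOf (lam i))},
      ∀ i j, (i ⟶ j) → intertwiners (N i).1 (N j).1 :=
    { toFun := fun p => ⟨fun i => ⟨p.1.1.1 i, (congrFun p.2 i) ▸ htype p.1 i⟩,
        fun i j e => ⟨p.1.1.2 i j e, p.1.2.2 i j e⟩⟩
      invFun := fun p => ⟨⟨(fun i => (p.1 i).1, fun i j e => (p.2 i j e).1),
        fun i => (p.1 i).2.isNilpotent (ranksOf_eq_zero _ le_rfl), fun i j e => (p.2 i j e).2⟩,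
        funext fun i => hasRanks_ranksOf_unique (htype _ i) (p.1 i).2⟩
      left_inv := fun p => rfl
      right_inv := fun p => rfl }
  have hc : ∀ N : ∀ i, {N : End F (Fin (α i) → F) // HasRanks N (ranksOf (lam i))},
      Nat.card (∀ i j, (i ⟶ j) → intertwiners (N i).1 (N j).1) =
      ∏ k ∈ range n, Nat.card F ^
        ∑ i, ∑ j, Nat.card (i ⟶ j) * (part (lam i) k * part (lam j) k) := by
    intro N
    rw [prod_pow_eq_pow_sum, Finset.sum_comm, ← prod_pow_eq_pow_sum, Nat.card_pi]
    refine prod_congr rfl fun i _ => ?_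
    rw [Finset.sum_comm, ← prod_pow_eq_pow_sum, Nat.card_pi]
    refine prod_congr rfl fun j _ => ?_
    rw [Nat.card_fun, card_intertwiners n (N i).2 (N j).2 (fun k => ranksOf_succ _ k)
      (fun k => ranksOf_succ _ k) (ranksOf_eq_zero _ (hle i)), ← pow_mul, ← mul_sum, mul_comm]
  have := Fintype.ofFinite (∀ i, {N : End F (Fin (α i) → F) // HasRanks N (ranksOf (lam i))})
  rw [Nat.card_congr e, Nat.card_sigma, Finset.sum_congr rfl fun N _ => hc N, sum_const, card_univ,
    smul_eq_mul, ← Nat.card_eq_fintype_card, Nat.card_pi, prod_mul_distrib, Finset.prod_comm,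
    ← mul_assoc, ← prod_mul_distrib]
  push_cast
  congr 1
  refine prod_congr rfl fun i _ => ?_
  have h0 := ranksOf_zero (lam i)
  rw [card_hasRanks n ((finrank_fin_fun F).trans h0.symm) (ranksOf_succ (lam i))
    (part_antitone _) (ranksOf_eq_zero _ (hle i)), h0]

end Count

/-! ### Values, denominators and constant term of r -/

section Values

variable {V : Type u} [Quiver.{v + 1} V] [Fintype V] [DecidableEq V]

/-- Separates the vertices, which count nilpotent endomorphisms, from the arrows, which count
intertwiners. The Cartan matrix omits the loops, so without them the sum may run over all pairs of
vertices. -/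
theorem X_zpow_neg_titsForm (hloops : ∀ i : V, IsEmpty (i ⟶ i)) (a : V → ℕ) :
    (RatFunc.X : RatFunc ℚ) ^ (-titsForm fun i => (a i : ℤ)) =
      (∏ i, (RatFunc.X ^ (a i ^ 2))⁻¹) *
        RatFunc.X ^ ∑ i, ∑ j, Nat.card (i ⟶ j) * (a i * a j) := by
  have h : -titsForm (fun i => (a i : ℤ)) =
      -((∑ i, a i ^ 2 : ℕ) : ℤ) + ((∑ i, ∑ j, Nat.card (i ⟶ j) * (a i * a j) : ℕ) : ℤ) := by
    have h1 := two_mul_titsForm fun i => (a i : ℤ)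
    rw [sum_cartanMatrix] at h1
    have h2 : ∀ i j, (if i = j then (0 : ℤ) else (Nat.card (i ⟶ j) : ℤ) * a i * a j) =
        Nat.card (i ⟶ j) * (a i * a j) := by
      intro i j
      split_ifs with hij
      · subst hij
        have := hloops i
        simp
      · ring
    simp only [h2] at h1
    push_cast
    linarith
  rw [h, zpow_add₀ RatFunc.X_ne_zero, zpow_neg, zpow_natCast, zpow_natCast, prod_inv_distrib,
    prod_pow_eq_pow_sum]

theorem phi_mem_valSubring {q : ℕ} (hq : q ≠ 0) (m : ℕ) :
    (phi m (RatFunc.X)⁻¹, phiInv q m) ∈ valSubring q := by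
  have h : (phi m (RatFunc.X)⁻¹, phiInv (q : ℚ) m) =
      ∏ i ∈ range m, (1 - ((RatFunc.X : RatFunc ℚ)⁻¹, (q : ℚ)⁻¹) ^ (i + 1)) := by
    refine Prod.ext ?_ ?_
    · simp [phi, Prod.fst_prod]
    · simp [phiInv, Prod.snd_prod]
  rw [h]
  exact (valSubring q).prod_mem fun i _ => sub_mem (one_mem _)
    (pow_mem (inv_mem_valSubring (X_mem_valSubring q) (by exact_mod_cast hq)) _)

theorem mk_sum {ι : Type*} (s : Finset ι) {A B : Type*} [AddCommMonoid A] [AddCommMonoid B]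
    (f : ι → A) (g : ι → B) : (∑ i ∈ s, f i, ∑ i ∈ s, g i) = ∑ i ∈ s, (f i, g i) :=
  Prod.ext (by simp [Prod.fst_sum]) (by simp [Prod.snd_sum])

theorem mk_prod {ι : Type*} (s : Finset ι) {A B : Type*} [CommMonoid A] [CommMonoid B]
    (f : ι → A) (g : ι → B) : (∏ i ∈ s, f i, ∏ i ∈ s, g i) = ∏ i ∈ s, (f i, g i) :=
  Prod.ext (by simp [Prod.fst_prod]) (by simp [Prod.snd_prod])

theorem rSeries_mem_valSubring (hloops : ∀ i : V, IsEmpty (i ⟶ i)) {q : ℕ} (hq : 2 ≤ q)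
    (α : V →₀ ℕ) : (MvPowerSeries.coeff α (rSeries V), rValue V q α) ∈ valSubring q := by
  have hq0 : (q : ℚ) ≠ 0 := by positivity
  have hq1 : (1 : ℚ) < q := by exact_mod_cast hq
  have hX := X_mem_valSubring q
  change (∑ lam : ∀ i, (α i).Partition, rMulti lam, rValue V q α) ∈ _
  rw [rValue, mk_sum]
  refine (valSubring q).sum_mem fun lam _ => ?_
  rw [rMulti, mk_prod]
  refine (valSubring q).prod_mem fun k _ => ?_
  rw [X_zpow_neg_titsForm hloops, div_eq_mul_inv, ← prod_inv_distrib, mul_right_comm,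
    ← prod_mul_distrib, ← Prod.mk_mul_mk, mk_prod]
  refine mul_mem ((valSubring q).prod_mem fun i _ => ?_) (pow_mem hX _)
  rw [partWeight, div_eq_mul_inv, ← Prod.mk_mul_mk]
  refine mul_mem (inv_mem_valSubring (pow_mem hX _) (pow_ne_zero _ hq0))
    (inv_mem_valSubring (phi_mem_valSubring (by omega) _) (phiInv_ne_zero hq1 _))

theorem X_inv_mem_monicSubring : (RatFunc.X : RatFunc ℚ)⁻¹ ∈ monicSubring := by
  have := intPoly_inv_mem Polynomial.monic_X
  simpa [intPoly] using this

theorem X_mem_monicSubring : (RatFunc.X : RatFunc ℚ) ∈ monicSubring := by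
  simpa [intPoly] using intPoly_mem Polynomial.X

/-- Equal to q^(m+1) / (q^(m+1) - 1), with a monic denominator. -/
theorem one_sub_X_inv_pow_inv_mem (m : ℕ) :
    (1 - (RatFunc.X : RatFunc ℚ)⁻¹ ^ (m + 1))⁻¹ ∈ monicSubring := by
  have h1 : (1 - (RatFunc.X : RatFunc ℚ)⁻¹ ^ (m + 1))⁻¹ =
      (intPoly (Polynomial.X ^ (m + 1) - 1))⁻¹ * RatFunc.X ^ (m + 1) := by
    have h2 : intPoly (Polynomial.X ^ (m + 1) - 1) = (RatFunc.X : RatFunc ℚ) ^ (m + 1) - 1 := by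
      simp [intPoly]
    have h3 : (RatFunc.X : RatFunc ℚ) ^ (m + 1) - 1 =
        (1 - (RatFunc.X : RatFunc ℚ)⁻¹ ^ (m + 1)) * RatFunc.X ^ (m + 1) := by
      rw [sub_mul, ← mul_pow, inv_mul_cancel₀ RatFunc.X_ne_zero, one_pow, one_mul]
    rw [h2, h3, mul_inv, inv_mul_cancel_right₀ (pow_ne_zero _ RatFunc.X_ne_zero)]
  rw [h1]
  refine mul_mem (intPoly_inv_mem ?_) (pow_mem X_mem_monicSubring _)
  refine Polynomial.monic_X_pow_sub ?_
  rw [Polynomial.degree_one]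
  exact_mod_cast Nat.succ_pos m

theorem rSeries_mem_coeffsIn (hloops : ∀ i : V, IsEmpty (i ⟶ i)) :
    rSeries V ∈ coeffsIn monicSubring := by
  intro α
  refine monicSubring.sum_mem fun lam _ => monicSubring.prod_mem fun k _ => ?_
  rw [X_zpow_neg_titsForm hloops, div_eq_mul_inv, ← prod_inv_distrib]
  refine mul_mem (mul_mem (monicSubring.prod_mem fun i _ => ?_) (pow_mem X_mem_monicSubring _))
    (monicSubring.prod_mem fun i _ => ?_)
  · rw [← inv_pow]
    exact pow_mem X_inv_mem_monicSubring _
  · rw [phi, ← prod_inv_distrib]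
    exact monicSubring.prod_mem fun j _ => one_sub_X_inv_pow_inv_mem j

theorem constantCoeff_rSeries : MvPowerSeries.constantCoeff (rSeries V) = 1 := by
  change ∑ lam : ∀ i, ((0 : V →₀ ℕ) i).Partition, rMulti lam = 1
  have : ∀ i, Unique ((0 : V →₀ ℕ) i).Partition := fun i =>
    inferInstanceAs (Unique (Nat.Partition 0))
  rw [Fintype.sum_unique, rMulti]
  simp

end Values

end Hua

namespace Hua

set_option linter.unusedSectionVars false

open Finset Module

/-! ### Nilpotent matrices over a finite field -/

section Nilpotent

/-- The proportion of nilpotent endomorphisms to automorphisms in dimension `n`, see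
`card_nilpotent`. -/
noncomputable def nilWeight (q : ℚ) (n : ℕ) : ℚ := (q ^ n)⁻¹ / phiInv q n

variable {F : Type*} [Field F]

theorem apply_pow_finrank_eq_zero {V : Type*} [AddCommGroup V] [Module F V] [Module.Finite F V]
    (A : End F V) {x : V} (hx : (A ^ finrank F V) (A x) = 0) : (A ^ finrank F V) x = 0 := by
  have h := End.ker_pow_eq_ker_pow_finrank_of_le (f := A) (Nat.le_succ (finrank F V))
  have h1 : x ∈ LinearMap.ker (A ^ (finrank F V).succ) := by
    rw [LinearMap.mem_ker, Nat.succ_eq_add_one, pow_succ]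
    exact hx
  rw [h] at h1
  exact h1

theorem pow_eq_zero_of_finrank_le {V : Type*} [AddCommGroup V] [Module F V] [Module.Finite F V]
    {N : End F V} (hN : IsNilpotent N) {k : ℕ} (hk : finrank F V ≤ k) : N ^ k = 0 := by
  have h1 := (LinearMap.isNilpotent_iff_charpoly N).1 hN
  have h2 := N.aeval_self_charpoly
  rw [h1, map_pow, Polynomial.aeval_X] at h2
  exact pow_eq_zero_of_le hk h2

/-- The block triangular endomorphism of a product. -/
def blockTriangular {U C : Type*} [AddCommGroup U] [Module F U] [AddCommGroup C] [Module F C]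
    (N : End F U) (h : C →ₗ[F] U) (g : End F C) : End F (U × C) :=
  (N.coprod h).prod (g ∘ₗ LinearMap.snd F U C)

theorem blockTriangular_apply {U C : Type*} [AddCommGroup U] [Module F U] [AddCommGroup C]
    [Module F C] (N : End F U) (h : C →ₗ[F] U) (g : End F C) (x : U × C) :
    blockTriangular N h g x = (N x.1 + h x.2, g x.2) := rfl

theorem blockTriangular_pow_snd {U C : Type*} [AddCommGroup U] [Module F U] [AddCommGroup C]
    [Module F C] (N : End F U) (h : C →ₗ[F] U) (g : End F C) (k : ℕ) (x : U × C) :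
    ((blockTriangular N h g ^ k) x).2 = (g ^ k) x.2 := by
  induction k with
  | zero => rfl
  | succ k ih =>
    rw [pow_succ', pow_succ', End.mul_apply, End.mul_apply, blockTriangular_apply, ih]

theorem blockTriangular_pow_inl {U C : Type*} [AddCommGroup U] [Module F U] [AddCommGroup C]
    [Module F C] (N : End F U) (h : C →ₗ[F] U) (g : End F C) (k : ℕ) (u : U) :
    (blockTriangular N h g ^ k) (u, 0) = ((N ^ k) u, 0) := by
  induction k with
  | zero => rfl
  | succ k ih =>
    rw [pow_succ', pow_succ', End.mul_apply, End.mul_apply, blockTriangular_apply, ih]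
    simp

variable [Finite F]

/-- The endomorphisms of a product whose generalized kernel is the first factor. -/
theorem card_generalizedKer_prod (U C : Type*) [AddCommGroup U] [Module F U] [Finite U]
    [AddCommGroup C] [Module F C] [Finite C] {n : ℕ} (hn : n = finrank F (U × C)) :
    (Nat.card {A : End F (U × C) // ∀ x, (A ^ n) x = 0 ↔ x.2 = 0} : ℚ) =
      Nat.card {N : End F U // IsNilpotent N} *
        ((Nat.card F : ℚ) ^ (finrank F C * finrank F U) *
          injCount (Nat.card F) (finrank F C) (finrank F C)) := by
  have hU : finrank F U ≤ n := by rw [hn, finrank_prod]; omega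
  let e : ({N : End F U // IsNilpotent N} × (C →ₗ[F] U) × {g : End F C // Function.Injective g}) ≃
      {A : End F (U × C) // ∀ x, (A ^ n) x = 0 ↔ x.2 = 0} := Equiv.ofBijective
    (fun t => ⟨blockTriangular t.1.1 t.2.1 t.2.2.1, by
      obtain ⟨⟨N, hN⟩, h, g, hg⟩ := t
      rintro ⟨y, c⟩
      have hgn : Function.Injective (g ^ n) := by
        rw [Module.End.coe_pow]; exact hg.iterate n
      constructor
      · intro hx
        apply hgn
        rw [map_zero, ← blockTriangular_pow_snd N h, hx]
        rfl
      · rintro rfl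
        rw [blockTriangular_pow_inl, pow_eq_zero_of_finrank_le hN hU]
        rfl⟩) (by
    constructor
    · rintro ⟨⟨N, hN⟩, h, g, hg⟩ ⟨⟨N', hN'⟩, h', g', hg'⟩ heq
      have h1 : ∀ x, blockTriangular N h g x = blockTriangular N' h' g' x :=
        fun x => LinearMap.congr_fun (congrArg Subtype.val heq) x
      simp only [blockTriangular_apply, Prod.mk.injEq] at h1
      have e1 : N = N' := LinearMap.ext fun y => by simpa using (h1 (y, 0)).1
      have e2 : h = h' := LinearMap.ext fun c => by simpa using (h1 (0, c)).1
      have e3 : g = g' := LinearMap.ext fun c => (h1 (0, c)).2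
      subst e1 e2 e3
      rfl
    · rintro ⟨A, hA⟩
      have hcomm : ∀ x, (A ^ n) (A x) = A ((A ^ n) x) := fun x => by
        rw [← End.mul_apply, ← End.mul_apply, pow_mul_comm']
      -- A commutes with A^n, so it preserves ker A^n = U × 0 and is block triangular.
      have h0 : ∀ y : U, (A (y, 0)).2 = 0 := fun y => by
        rw [← hA, hcomm, (hA (y, 0)).2 rfl, map_zero]
      set N : End F U := LinearMap.fst F U C ∘ₗ A ∘ₗ LinearMap.inl F U C with hN
      set h : C →ₗ[F] U := LinearMap.fst F U C ∘ₗ A ∘ₗ LinearMap.inr F U C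
      set g : End F C := LinearMap.snd F U C ∘ₗ A ∘ₗ LinearMap.inr F U C with hg
      have hblock : blockTriangular N h g = A := by
        ext y
        · simp [blockTriangular_apply, N]
        · simp [blockTriangular_apply, h0]
        · simp [blockTriangular_apply, h]
        · simp [blockTriangular_apply, g]
      refine ⟨⟨⟨N, n, LinearMap.ext fun y => ?_⟩, h, g, ?_⟩, Subtype.ext hblock⟩
      · have h1 := blockTriangular_pow_inl N h g n y
        rw [hblock, (hA (y, 0)).2 rfl] at h1
        exact (congrArg Prod.fst h1).symm
      · rw [injective_iff_map_eq_zero]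
        intro c hc
        -- If g(c) = 0, then A(0, c) lies in ker A^n. The kernels of the powers are stationary from
        -- n on, so (0, c) is already in ker A^n.
        refine (hA (0, c)).1 ?_
        have h1 : (A (0, c)).2 = 0 := hc
        rw [← hA] at h1
        subst hn
        exact apply_pow_finrank_eq_zero A h1)
  rw [← Nat.card_congr e, Nat.card_prod, Nat.card_prod, Nat.cast_mul, Nat.cast_mul, card_injective,
    natCard_eq_pow_finrank (K := F) (V := C →ₗ[F] U), finrank_linearMap, Nat.cast_pow]

theorem card_nilpotent_congr {U W : Type*} [AddCommGroup U] [Module F U] [AddCommGroup W]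
    [Module F W] (e : U ≃ₗ[F] W) :
    Nat.card {N : End F U // IsNilpotent N} = Nat.card {N : End F W // IsNilpotent N} :=
  Nat.card_congr (e.conjRingEquiv.toEquiv.subtypeEquiv fun _ =>
    (IsNilpotent.map_iff e.conjRingEquiv.injective).symm)

theorem card_generalizedKer {V : Type*} [AddCommGroup V] [Module F V] [Finite V]
    (U : Submodule F V) {k l : ℕ} (hk : finrank F U = k) (hl : finrank F V = k + l) :
    (Nat.card {A : End F V // LinearMap.ker (A ^ finrank F V) = U} : ℚ) =
      Nat.card {N : End F (Fin k → F) // IsNilpotent N} *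
        ((Nat.card F : ℚ) ^ (k * l) * injCount (Nat.card F) l l) := by
  obtain ⟨C, hC⟩ := U.exists_isCompl
  have hCl : finrank F C = l := by
    have := Submodule.finrank_add_eq_of_isCompl hC
    omega
  set e := U.prodEquivOfIsCompl C hC
  have h1 : ∀ x, e x ∈ U ↔ x.2 = 0 := fun x => by
    rw [← Submodule.prodEquivOfIsCompl_symm_apply_snd_eq_zero U C hC, LinearEquiv.symm_apply_apply]
  rw [card_nilpotent_congr (LinearEquiv.ofFinrankEq (Fin k → F) U (by rw [hk, finrank_fin_fun])),
    mul_comm k l, ← hk, ← hCl, ← card_generalizedKer_prod U C e.finrank_eq.symm]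
  congr 1
  refine Nat.card_congr (e.symm.conjRingEquiv.toEquiv.subtypeEquiv fun A => ?_)
  have h2 : ∀ x, ((e.symm.conjRingEquiv A) ^ finrank F V) x = e.symm ((A ^ finrank F V) (e x)) := by
    intro x
    rw [← map_pow]
    rfl
  change _ ↔ ∀ x, ((e.symm.conjRingEquiv A) ^ finrank F V) x = 0 ↔ x.2 = 0
  simp only [h2, ← h1, LinearEquiv.map_eq_zero_iff]
  constructor
  · rintro h x
    have := SetLike.ext_iff.1 h (e x)
    rwa [LinearMap.mem_ker] at this
  · intro h
    ext y
    have := h (e.symm y)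
    rwa [LinearEquiv.apply_symm_apply] at this

/-- Fitting's decomposition: all q^(n²) endomorphisms are sorted by the generalized kernel U. With
dim U = k and n = k + l, each U occurs for (nilpotents in dimension k) · q^(kl) |GL_l| of them;
division by |GL_n| leaves the claim. -/
theorem sum_card_nilpotent (n : ℕ) :
    ∑ k ∈ range (n + 1), (Nat.card {N : End F (Fin k → F) // IsNilpotent N} : ℚ) /
      injCount (Nat.card F) k k = (phiInv (Nat.card F) n)⁻¹ := by
  classical
  set q : ℚ := (Nat.card F : ℚ)
  have hq : 1 < q := one_lt_natCard_rat F
  have hcard : (Nat.card (End F (Fin n → F)) : ℚ) = q ^ (n ^ 2) := by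
    rw [natCard_eq_pow_finrank (K := F), finrank_linearMap, finrank_fin_fun, Nat.cast_pow, sq]
  have : Fintype (Submodule F (Fin n → F)) := Fintype.ofFinite _
  have h1 := card_eq_sum_card_fiber fun A : End F (Fin n → F) =>
    LinearMap.ker (A ^ finrank F (Fin n → F))
  have h2 : q ^ (n ^ 2) = ∑ k ∈ range (n + 1), injCount q n n *
      ((Nat.card {N : End F (Fin k → F) // IsNilpotent N} : ℚ) / injCount q k k) := by
    rw [← hcard, h1, Nat.cast_sum, ← Finset.sum_fiberwise_of_maps_to (t := range (n + 1))
      (g := fun U : Submodule F (Fin n → F) => finrank F U)]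
    · refine Finset.sum_congr rfl fun k hk => ?_
      obtain ⟨l, rfl⟩ := Nat.exists_eq_add_of_le (Nat.lt_succ_iff.1 (Finset.mem_range.1 hk))
      rw [Finset.sum_congr rfl fun U hU => card_generalizedKer U (Finset.mem_filter.1 hU).2
        (finrank_fin_fun F), sum_const, nsmul_eq_mul, injCount_add]
      have h3 := card_submodule (F := F) (V := Fin (k + l) → F) k
      rw [finrank_fin_fun, Nat.card_eq_fintype_card, Fintype.card_subtype] at h3
      have h4 := injCount_self_ne_zero hq k
      change _ = _
      rw [← h3]
      change _ * (_ * (q ^ (k * l) * injCount q l l)) = _ * injCount q k k * _ * _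
      field_simp
    · intro U _
      rw [Finset.mem_range, Nat.lt_succ_iff]
      exact (Submodule.finrank_le U).trans (finrank_fin_fun F).le
  rw [← Finset.mul_sum, injCount_self (by positivity)] at h2
  have h5 : q ^ (n ^ 2) ≠ 0 := by positivity
  have h6 := phiInv_ne_zero hq n
  refine eq_inv_of_mul_eq_one_left ?_
  apply mul_left_cancel₀ h5
  rw [mul_one]
  conv_rhs => rw [h2]
  ring

/-- The difference of the sums for consecutive n: 1/φ_n - 1/φ_(n-1) = q^(-n)/φ_n, all at q^(-1). -/
theorem card_nilpotent (n : ℕ) : (Nat.card {N : End F (Fin n → F) // IsNilpotent N} : ℚ) /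
    injCount (Nat.card F) n n = nilWeight (Nat.card F) n := by
  have hq : (1 : ℚ) < Nat.card F := one_lt_natCard_rat F
  have h1 := sum_card_nilpotent (F := F) n
  rw [sum_range_succ] at h1
  cases n with
  | zero => simpa [nilWeight] using h1
  | succ n =>
    rw [sum_card_nilpotent] at h1
    rw [eq_sub_of_add_eq' h1, nilWeight]
    have h2 := phiInv_ne_zero hq n
    have h3 : phiInv (Nat.card F : ℚ) (n + 1) =
        phiInv (Nat.card F) n * (1 - (Nat.card F : ℚ)⁻¹ ^ (n + 1)) := prod_range_succ _ _
    have h4 := phiInv_ne_zero hq (n + 1)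
    rw [h3] at h4 ⊢
    have h5 := right_ne_zero_of_mul h4
    have h6 : ((Nat.card F : ℚ) ^ (n + 1))⁻¹ = 1 - (1 - (Nat.card F : ℚ)⁻¹ ^ (n + 1)) := by
      rw [sub_sub_cancel, inv_pow]
    rw [h6]
    generalize 1 - (Nat.card F : ℚ)⁻¹ ^ (n + 1) = t at h5 ⊢
    field_simp

theorem nilWeight_zero (q : ℚ) : nilWeight q 0 = 1 := by simp [nilWeight, phiInv]

theorem nilWeight_succ {q : ℚ} (hq : 1 < q) (n : ℕ) :
    (q ^ (n + 1) - 1) * nilWeight q (n + 1) = q ^ n * nilWeight q n := by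
  have h2 := phiInv_ne_zero hq n
  have h3 : phiInv q (n + 1) = phiInv q n * (1 - q⁻¹ ^ (n + 1)) := prod_range_succ _ _
  have h4 := phiInv_ne_zero hq (n + 1)
  rw [nilWeight, nilWeight]
  rw [h3] at h4 ⊢
  have h5 := right_ne_zero_of_mul h4
  have hq0 : q ≠ 0 := by positivity
  have h6 : q ^ (n + 1) - 1 = q ^ (n + 1) * (1 - q⁻¹ ^ (n + 1)) := by
    rw [mul_sub, ← mul_pow, mul_inv_cancel₀ hq0]; simp
  rw [h6]
  generalize 1 - q⁻¹ ^ (n + 1) = t at h5 ⊢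
  field_simp

/-- The generating function of the weights `nilWeight q` and its logarithm. -/
theorem derivative_nilWeight {q : ℚ} (hq : 1 < q) :
    PowerSeries.derivative ℚ (PowerSeries.mk (nilWeight q)) = PowerSeries.mk (nilWeight q) *
      PowerSeries.derivative ℚ (PowerSeries.mk fun n => (1 : ℚ) / (n * (q ^ n - 1))) := by
  set P := PowerSeries.mk (nilWeight q)
  set Q := PowerSeries.mk fun n : ℕ => (1 : ℚ) / (n * (q ^ n - 1)) with hQ
  set d := PowerSeries.derivative ℚ
  set s := PowerSeries.rescale q
  have hq0 : q ≠ 0 := by positivity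
  have hpow : ∀ n : ℕ, q ^ (n + 1) - 1 ≠ 0 := fun n =>
    sub_ne_zero.2 (one_lt_pow₀ hq n.succ_ne_zero).ne'
  have hds : ∀ f : PowerSeries ℚ, d (s f) = PowerSeries.C q * s (d f) := by
    intro f; ext n
    simp only [d, s, PowerSeries.coeff_derivative, PowerSeries.coeff_rescale, PowerSeries.coeff_C_mul]
    ring
  -- The functional equation P(qx)(1 - x) = P(x), equivalent to `nilWeight_succ`.
  have hP : s P * (1 - PowerSeries.X) = P := by
    ext n
    cases n with
    | zero =>
      rw [mul_sub, mul_one, map_sub, PowerSeries.coeff_zero_mul_X, sub_zero]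
      simp only [s, PowerSeries.coeff_rescale, pow_zero, one_mul]
    | succ n =>
      rw [mul_sub, mul_one, map_sub, PowerSeries.coeff_succ_mul_X]
      simp only [s, P, PowerSeries.coeff_rescale, PowerSeries.coeff_mk]
      have := nilWeight_succ hq n
      linarith
  -- The derivative of Q(qx) - Q(x) = -log(1 - x).
  have hQ1 : (PowerSeries.C q * s (d Q) - d Q) * (1 - PowerSeries.X) = 1 := by
    have : PowerSeries.C q * s (d Q) - d Q = PowerSeries.mk 1 := by
      ext n
      simp only [d, s, Q, map_sub, PowerSeries.coeff_derivative, PowerSeries.coeff_rescale,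
        PowerSeries.coeff_C_mul, PowerSeries.coeff_mk, Pi.one_apply]
      have h1 := hpow n
      have h2 : ((n + 1 : ℕ) : ℚ) ≠ 0 := by exact_mod_cast n.succ_ne_zero
      push_cast at h2 ⊢
      field_simp
      ring
    rw [this]
    exact PowerSeries.mk_one_mul_one_sub_eq_one ℚ
  have hdP : PowerSeries.C q * s (d P) * (1 - PowerSeries.X) - s P = d P := by
    conv_rhs => rw [← hP, Derivation.leibniz, hds]
    simp [d, PowerSeries.derivative_X]
    ring
  -- The defect D = P Q' - P' satisfies q D(qx)(1 - x) = D(x), which forces its coefficients to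
  -- vanish one after the other since q^(n+1) ≠ 1.
  have hD : PowerSeries.C q * s (P * d Q - d P) * (1 - PowerSeries.X) = P * d Q - d P := by
    rw [map_sub, map_mul]
    have h1 : PowerSeries.C q * s (d Q) * (1 - PowerSeries.X) = 1 + d Q * (1 - PowerSeries.X) := by
      linear_combination hQ1
    linear_combination s P * h1 - hdP + d Q * hP
  have hz : ∀ n, PowerSeries.coeff n (P * d Q - d P) = 0 := by
    intro n
    induction n with
    | zero =>
      have := congrArg (PowerSeries.coeff 0) hD
      simp only [mul_sub, mul_one, map_sub (PowerSeries.coeff 0), mul_assoc,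
        PowerSeries.coeff_C_mul, PowerSeries.coeff_zero_mul_X, s, PowerSeries.coeff_rescale] at this
      have h2 : q - 1 ≠ 0 := by linarith
      have h3 : (q - 1) * PowerSeries.coeff 0 (P * d Q - d P) = 0 := by
        simp only [PowerSeries.coeff_zero_eq_constantCoeff_apply, map_sub, map_mul, pow_zero,
          one_mul] at this ⊢
        linear_combination this
      exact (mul_eq_zero.1 h3).resolve_left h2
    | succ n ih =>
      have := congrArg (PowerSeries.coeff (n + 1)) hD
      rw [mul_sub (PowerSeries.C q * _), mul_one, map_sub (PowerSeries.coeff (n + 1)),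
        PowerSeries.coeff_succ_mul_X, PowerSeries.coeff_C_mul, PowerSeries.coeff_C_mul] at this
      simp only [s, PowerSeries.coeff_rescale, ih, mul_zero, sub_zero] at this
      apply (mul_eq_zero.1 _).resolve_left (hpow (n + 1))
      rw [sub_mul, one_mul, pow_succ', mul_assoc, this, sub_self]
  exact (sub_eq_zero.1 (PowerSeries.ext fun n => (hz n).trans (by simp))).symm

theorem isLog_nilWeight {σ : Type*} {q : ℚ} (hq : 1 < q) {γ : σ →₀ ℕ} (hγ : γ ≠ 0) :
    IsLog ((PowerSeries.mk (nilWeight q)).subst (MvPowerSeries.monomial γ (1 : ℚ)))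
      ((PowerSeries.mk fun n => (1 : ℚ) / (n * (q ^ n - 1))).subst
        (MvPowerSeries.monomial γ (1 : ℚ))) := by
  refine isLog_subst ?_ ?_ (derivative_nilWeight hq) (constantCoeff_monomial_eq_zero hγ)
  · simp [← PowerSeries.coeff_zero_eq_constantCoeff_apply, nilWeight_zero]
  · simp [← PowerSeries.coeff_zero_eq_constantCoeff_apply]

end Nilpotent
end Hua

namespace Hua

set_option linter.unusedSectionVars false

open Finset Module

/-! ### Finite local rings -/

section FiniteRing

theorem exists_pow_isIdempotentElem {R : Type*} [Monoid R] [Finite R] (x : R) :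
    ∃ n, n ≠ 0 ∧ IsIdempotentElem (x ^ n) := by
  obtain ⟨a, b, hab, h⟩ := Finite.exists_ne_map_eq_of_infinite fun n : ℕ => x ^ n
  wlog hlt : a < b generalizing a b
  · exact this b a hab.symm h.symm (by omega)
  obtain ⟨d, rfl⟩ := Nat.exists_eq_add_of_lt hlt
  have h1 : ∀ k, x ^ (a + k * (d + 1)) = x ^ a := by
    intro k
    induction k with
    | zero => simp
    | succ k ih =>
      rw [show a + (k + 1) * (d + 1) = a + d + 1 + k * (d + 1) by ring, pow_add, ← h, ← pow_add, ih]
  have h2 : ∀ m k, a ≤ m → x ^ (m + k * (d + 1)) = x ^ m := by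
    intro m k hm
    obtain ⟨c, rfl⟩ := Nat.exists_eq_add_of_le' hm
    rw [add_assoc, pow_add, h1, ← pow_add]
  -- The powers have period d + 1 from exponent a on. This exponent is a multiple of the period
  -- beyond a, so doubling it does not change the power.
  refine ⟨(a + 1) * (d + 1), by simp, ?_⟩
  rw [IsIdempotentElem, ← pow_add]
  exact h2 _ _ (by nlinarith)

theorem isUnit_or_isNilpotent_of_finite {R : Type*} [Ring R] [Finite R]
    (h : ∀ e : R, IsIdempotentElem e → e = 0 ∨ e = 1) (x : R) : IsUnit x ∨ IsNilpotent x := by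
  obtain ⟨n, hn, he⟩ := exists_pow_isIdempotentElem x
  rcases h _ he with h0 | h1
  · exact Or.inr ⟨n, h0⟩
  · exact Or.inl (IsUnit.of_pow_eq_one h1 hn)

theorem isUnit_of_mul_isUnit_finite {R : Type*} [Monoid R] [Finite R] {x y : R}
    (h : IsUnit (x * y)) : IsUnit x ∧ IsUnit y := by
  obtain ⟨u, hu⟩ := h
  have hy : Function.Injective (y * · : R → R) := by
    intro a b hab
    have h1 : (↑u⁻¹ * x) * (y * a) = (↑u⁻¹ * x) * (y * b) := congrArg _ hab
    have h2 : (↑u⁻¹ * x) * y = 1 := by rw [mul_assoc, ← hu, Units.inv_mul]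
    rwa [← mul_assoc, ← mul_assoc, h2, one_mul, one_mul] at h1
  obtain ⟨z, hz⟩ := Finite.surjective_of_injective hy 1
  have hzy : z * y = 1 := hy (by simp only [← mul_assoc, hz, one_mul, mul_one])
  have hyu : IsUnit y := ⟨⟨y, z, hz, hzy⟩, rfl⟩
  refine ⟨?_, hyu⟩
  have : x = u * ↑(hyu.unit⁻¹) := by
    rw [hu, mul_assoc]
    simp
  rw [this]
  exact u.isUnit.mul (Units.isUnit _)

theorem IsNilpotent.isUnit_of_add {R : Type*} [Ring R] {x y : R}
    (h : ∀ a : R, IsUnit a ∨ IsNilpotent a) (hx : ∀ a : R, IsNilpotent (a * x))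
    (hxy : IsUnit (x + y)) : IsUnit y := by
  obtain ⟨u, hu⟩ := hxy
  have h1 : (↑u⁻¹ : R) * y = 1 - ↑u⁻¹ * x := by
    rw [eq_sub_iff_add_eq, ← mul_add, add_comm y, ← hu, Units.inv_mul]
  have h2 : IsUnit ((↑u⁻¹ : R) * y) := h1 ▸ (hx _).isUnit_one_sub
  have h3 : y = u * (↑u⁻¹ * y) := by rw [Units.mul_inv_cancel_left]
  rw [h3]
  exact u.isUnit.mul h2

/-- The residue field of a finite local ring. -/
theorem exists_residueField {R : Type u} [Ring R] [Finite R] [Nontrivial R]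
    (h : ∀ e : R, IsIdempotentElem e → e = 0 ∨ e = 1) :
    ∃ (D : Type u) (_ : Field D) (_ : Finite D) (ρ : R →+* D), Function.Surjective ρ ∧
      ∀ x, ρ x = 0 ↔ IsNilpotent x := by
  have hor := isUnit_or_isNilpotent_of_finite h
  have hnot : ∀ x : R, IsNilpotent x → ¬ IsUnit x := fun x hx hu => by
    obtain ⟨n, hn⟩ := hx
    have := hu.pow n
    rw [hn] at this
    exact not_isUnit_zero this
  have hnil : ∀ x : R, ¬ IsUnit x → IsNilpotent x := fun x hx => (hor x).resolve_left hx
  have hmul : ∀ a x : R, IsNilpotent x → IsNilpotent (a * x) := fun a x hx =>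
    hnil _ fun hu => hnot x hx (isUnit_of_mul_isUnit_finite hu).2
  have hmul' : ∀ a x : R, IsNilpotent x → IsNilpotent (x * a) := fun a x hx =>
    hnil _ fun hu => hnot x hx (isUnit_of_mul_isUnit_finite hu).1
  let I : Ideal R :=
    { carrier := {x | IsNilpotent x}
      zero_mem' := IsNilpotent.zero
      add_mem' := fun {x y} hx hy => hnil _ fun hu =>
        hnot y hy (IsNilpotent.isUnit_of_add hor (fun a => hmul a x hx) hu)
      smul_mem' := fun a x hx => hmul a x hx }
  have hI : I.IsTwoSided := ⟨fun {a} b ha => hmul' b a ha⟩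
  have hmem : ∀ x, x ∈ I ↔ IsNilpotent x := fun x => Iff.rfl
  have hne : Nontrivial (R ⧸ I) := by
    rw [Ideal.Quotient.nontrivial_iff]
    intro htop
    exact hnot 1 ((hmem 1).1 (htop ▸ Submodule.mem_top)) isUnit_one
  have hunit : ∀ a : R ⧸ I, IsUnit a ∨ a = 0 := by
    intro a
    obtain ⟨x, rfl⟩ := Ideal.Quotient.mk_surjective a
    rcases hor x with hx | hx
    · exact Or.inl (hx.map (Ideal.Quotient.mk I))
    · exact Or.inr (Ideal.Quotient.eq_zero_iff_mem.2 hx)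
  let _ : DivisionRing (R ⧸ I) := DivisionRing.ofIsUnitOrEqZero hunit
  have : Finite (R ⧸ I) := Finite.of_surjective _ Ideal.Quotient.mk_surjective
  -- The quotient is a finite division ring, hence commutative by Wedderburn's theorem.
  exact ⟨R ⧸ I, littleWedderburn (R ⧸ I), this, Ideal.Quotient.mk I, Ideal.Quotient.mk_surjective,
    fun x => Ideal.Quotient.eq_zero_iff_mem⟩

end FiniteRing

/-! ### Decompositions in preadditive categories -/

section Decomposition

open CategoryTheory

variable {C : Type u} [Category.{v} C] [Preadditive C] {J : Type*} [Fintype J] [DecidableEq J]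

/-- A decomposition of `M` into a direct sum of `n j` copies of `X j`. -/
structure Decomposition (X : J → C) (n : J → ℕ) (M : C) where
  i : ∀ j, Fin (n j) → (X j ⟶ M)
  p : ∀ j, Fin (n j) → (M ⟶ X j)
  i_p : ∀ j a b, i j a ≫ p j b = if a = b then 𝟙 (X j) else 0
  i_p_ne : ∀ j k a b, j ≠ k → i j a ≫ p k b = 0
  total : ∑ t : Σ j, Fin (n j), p t.1 t.2 ≫ i t.1 t.2 = 𝟙 M

/-- If v inverts 1 - b ≫ a, then 1 + a ≫ v ≫ b inverts 1 - a ≫ b. -/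
theorem isUnit_one_sub_comp {M X : C} (a : M ⟶ X) (b : X ⟶ M)
    (h : IsUnit (1 - End.of (b ≫ a))) : IsUnit (1 - End.of (a ≫ b)) := by
  obtain ⟨v, hv1, hv2⟩ := isUnit_iff_exists.1 h
  have h1 : v.asHom - v.asHom ≫ b ≫ a = 𝟙 X := by
    have : v.asHom ≫ (𝟙 X - b ≫ a) = 𝟙 X := hv1
    rwa [Preadditive.comp_sub, Category.comp_id] at this
  have h2 : v.asHom - (b ≫ a) ≫ v.asHom = 𝟙 X := by
    have : (𝟙 X - b ≫ a) ≫ v.asHom = 𝟙 X := hv2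
    rwa [Preadditive.sub_comp, Category.id_comp] at this
  refine isUnit_iff_exists.2 ⟨1 + End.of (a ≫ v.asHom ≫ b), ?_, ?_⟩
  · change (𝟙 M + a ≫ v.asHom ≫ b) ≫ (𝟙 M - a ≫ b) = 𝟙 M
    have : (𝟙 M + a ≫ v.asHom ≫ b) ≫ (𝟙 M - a ≫ b) =
        𝟙 M - a ≫ b + a ≫ (v.asHom - v.asHom ≫ b ≫ a) ≫ b := by
      simp only [Preadditive.add_comp, Preadditive.comp_sub, Preadditive.sub_comp,
        Category.id_comp, Category.comp_id, Category.assoc]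
      abel
    rw [this, h1, Category.id_comp, sub_add_cancel]
  · change (𝟙 M - a ≫ b) ≫ (𝟙 M + a ≫ v.asHom ≫ b) = 𝟙 M
    have : (𝟙 M - a ≫ b) ≫ (𝟙 M + a ≫ v.asHom ≫ b) =
        𝟙 M - a ≫ b + a ≫ (v.asHom - (b ≫ a) ≫ v.asHom) ≫ b := by
      simp only [Preadditive.comp_add, Preadditive.comp_sub, Preadditive.sub_comp,
        Category.id_comp, Category.comp_id, Category.assoc]
    rw [this, h2, Category.id_comp, sub_add_cancel]

theorem Decomposition.i_comp_sum {X : J → C} {n : J → ℕ} {M Y : C} (d : Decomposition X n M)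
    (x : ∀ j, Fin (n j) → (X j ⟶ Y)) (j : J) (a : Fin (n j)) :
    d.i j a ≫ ∑ t : Σ j, Fin (n j), d.p t.1 t.2 ≫ x t.1 t.2 = x j a := by
  rw [Preadditive.comp_sum, Finset.sum_eq_single ⟨j, a⟩]
  · rw [← Category.assoc, d.i_p, if_pos rfl, Category.id_comp]
  · rintro ⟨k, b⟩ _ hne
    by_cases hk : j = k
    · subst hk
      rw [← Category.assoc, d.i_p, if_neg (fun h => hne (by rw [h])), Limits.zero_comp]
    · rw [← Category.assoc, d.i_p_ne j k a b hk, Limits.zero_comp]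
  · simp

variable {X : J → C} {D : J → Type*} [∀ j, Field (D j)] (ρ : ∀ j, End (X j) →+* D j)

/-- The matrices of residues of a morphism between objects with a decomposition. -/
def residueMatrix {n n' : J → ℕ} {M M' : C} (d : Decomposition X n M) (d' : Decomposition X n' M')
    (f : M ⟶ M') (j : J) : Matrix (Fin (n' j)) (Fin (n j)) (D j) :=
  Matrix.of fun a b => ρ j (End.of (d.i j b ≫ f ≫ d'.p j a))

variable {ρ} (hX : ∀ j k, j ≠ k → ∀ (f : X j ⟶ X k) (g : X k ⟶ X j), ρ j (End.of (f ≫ g)) = 0)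

-- Insert the decomposition of the middle object. Paths from X j to X j through a different X k have
-- residue 0 by `hX`, so only the block of j remains.
include hX in
theorem residueMatrix_comp {n n' n'' : J → ℕ} {M M' M'' : C} (d : Decomposition X n M)
    (d' : Decomposition X n' M') (d'' : Decomposition X n'' M'') (f : M ⟶ M') (g : M' ⟶ M'') (j : J) :
    residueMatrix ρ d d'' (f ≫ g) j = residueMatrix ρ d' d'' g j * residueMatrix ρ d d' f j := by
  ext a b
  have h1 : End.of (d.i j b ≫ (f ≫ g) ≫ d''.p j a) = ∑ t : Σ j, Fin (n' j),
      End.of ((d.i j b ≫ f ≫ d'.p t.1 t.2) ≫ (d'.i t.1 t.2 ≫ g ≫ d''.p j a)) := by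
    have h2 : (f ≫ g) ≫ d''.p j a = f ≫ 𝟙 M' ≫ g ≫ d''.p j a := by simp
    rw [h2, ← d'.total]
    simp only [Preadditive.sum_comp, Preadditive.comp_sum, Category.assoc]
  rw [Matrix.mul_apply]
  change ρ j (End.of (d.i j b ≫ (f ≫ g) ≫ d''.p j a)) = _
  rw [h1, map_sum, Fintype.sum_sigma, Finset.sum_eq_single j]
  · exact Finset.sum_congr rfl fun c _ => map_mul (ρ j) _ _
  · intro k _ hk
    exact Finset.sum_eq_zero fun c _ => hX j k hk.symm _ _
  · simp

theorem residueMatrix_id {n : J → ℕ} {M : C} (d : Decomposition X n M) (j : J) :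
    residueMatrix ρ d d (𝟙 M) j = 1 := by
  ext a b
  change ρ j (End.of (d.i j b ≫ 𝟙 M ≫ d.p j a)) = _
  rw [Category.id_comp, d.i_p, Matrix.one_apply]
  by_cases h : a = b
  · rw [if_pos h, if_pos h.symm]; exact map_one (ρ j)
  · rw [if_neg h, if_neg (Ne.symm h)]; exact map_zero (ρ j)

theorem residueMatrix_add {n n' : J → ℕ} {M M' : C} (d : Decomposition X n M)
    (d' : Decomposition X n' M') (f g : M ⟶ M') (j : J) :
    residueMatrix ρ d d' (f + g) j = residueMatrix ρ d d' f j + residueMatrix ρ d d' g j := by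
  ext a b
  change ρ j (End.of (d.i j b ≫ (f + g) ≫ d'.p j a)) = _
  rw [Preadditive.add_comp, Preadditive.comp_add]
  exact map_add (ρ j) _ _

/-- The multiplicities in a decomposition are determined by the isomorphism class. -/
theorem Decomposition.eq_of_iso (hX : ∀ j k, j ≠ k → ∀ (f : X j ⟶ X k) (g : X k ⟶ X j),
    ρ j (End.of (f ≫ g)) = 0) {n n' : J → ℕ} {M M' : C} (d : Decomposition X n M)
    (d' : Decomposition X n' M') (e : M ≅ M') : n = n' := by
  funext j
  have h1 := residueMatrix_comp hX d d' d e.hom e.inv j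
  have h2 := residueMatrix_comp hX d' d d' e.inv e.hom j
  rw [e.hom_inv_id, residueMatrix_id] at h1
  rw [e.inv_hom_id, residueMatrix_id] at h2
  -- A two-sided invertible matrix over a field is square.
  simpa using Matrix.square_of_invertible _ _ h1.symm h2.symm

/-- Objects with the same multiplicities are isomorphic. -/
def Decomposition.iso {n : J → ℕ} {M M' : C} (d : Decomposition X n M)
    (d' : Decomposition X n M') : M ≅ M' where
  hom := ∑ t : Σ j, Fin (n j), d.p t.1 t.2 ≫ d'.i t.1 t.2
  inv := ∑ t : Σ j, Fin (n j), d'.p t.1 t.2 ≫ d.i t.1 t.2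
  hom_inv_id := by
    rw [Preadditive.sum_comp, ← d.total]
    refine Finset.sum_congr rfl fun t _ => ?_
    rw [Category.assoc, d'.i_comp_sum]
  inv_hom_id := by
    rw [Preadditive.sum_comp, ← d'.total]
    refine Finset.sum_congr rfl fun t _ => ?_
    rw [Category.assoc, d.i_comp_sum]

/-- The residue matrices of the endomorphisms. -/
def residueHom (hX : ∀ j k, j ≠ k → ∀ (f : X j ⟶ X k) (g : X k ⟶ X j),
    ρ j (End.of (f ≫ g)) = 0) {n : J → ℕ} {M : C} (d : Decomposition X n M) :
    End M →+* ∀ j, Matrix (Fin (n j)) (Fin (n j)) (D j) where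
  toFun f := residueMatrix ρ d d f
  map_one' := funext fun j => residueMatrix_id d j
  map_mul' f g := funext fun j => residueMatrix_comp hX d d d g f j
  map_add' f g := funext fun j => residueMatrix_add d d f g j
  map_zero' := by
    funext j; ext a b
    change ρ j (End.of (d.i j b ≫ 0 ≫ d.p j a)) = _
    rw [Limits.zero_comp, Limits.comp_zero]
    exact map_zero (ρ j)

theorem residueHom_surjective (hρ : ∀ j, Function.Surjective (ρ j)) {n : J → ℕ} {M : C}
    (d : Decomposition X n M) : Function.Surjective (residueHom hX d) := by
  intro A
  choose u hu using fun j a b => hρ j (A j a b)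
  refine ⟨∑ j, ∑ a, ∑ b, d.p j b ≫ (u j a b).asHom ≫ d.i j a, ?_⟩
  funext j; ext a b
  have h1 : d.i j b ≫ (∑ j, ∑ a, ∑ b, d.p j b ≫ (u j a b).asHom ≫ d.i j a) ≫ d.p j a =
      (u j a b).asHom := by
    simp only [Preadditive.sum_comp, Preadditive.comp_sum, Category.assoc]
    rw [Finset.sum_eq_single j, Finset.sum_eq_single a, Finset.sum_eq_single b]
    · rw [d.i_p, if_pos rfl, ← Category.assoc, d.i_p, if_pos rfl]
      simp
    · intro b' _ hb
      rw [← Category.assoc, d.i_p, if_neg hb.symm, Limits.zero_comp]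
    · simp
    · intro a' _ ha
      refine Finset.sum_eq_zero fun b' _ => ?_
      rw [d.i_p, if_neg ha]
      simp
    · simp
    · intro k _ hk
      refine Finset.sum_eq_zero fun a' _ => Finset.sum_eq_zero fun b' _ => ?_
      rw [← Category.assoc, d.i_p_ne j k _ _ hk.symm, Limits.zero_comp]
    · simp
  change ρ j (End.of (d.i j b ≫ (∑ j, ∑ a, ∑ b, d.p j b ≫ (u j a b).asHom ≫ d.i j a) ≫ d.p j a)) = _
  rw [h1]
  exact hu j a b

/-- The kernel of the residue homomorphism lies in the Jacobson radical. The identity of M is a sum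
of projections, and f times a partial sum is treated by adding one projection at a time. -/
theorem isUnit_one_sub_of_residueHom_eq_zero (hker : ∀ j x, ρ j x = 0 ↔ IsNilpotent x)
    {n : J → ℕ} {M : C} (d : Decomposition X n M) (f : End M) (hf : residueHom hX d f = 0) :
    IsUnit (1 - f) := by
  have key : ∀ (S : Finset (Σ j, Fin (n j))) (f : End M), residueHom hX d f = 0 →
      IsUnit (1 - f * End.of (∑ t ∈ S, d.p t.1 t.2 ≫ d.i t.1 t.2)) := by
    intro S
    induction S using Finset.induction_on with
    | empty =>
      intro f hf
      rw [Finset.sum_empty]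
      change IsUnit (1 - f * 0)
      rw [mul_zero, sub_zero]
      exact isUnit_one
    | insert t S ht ih =>
      intro f hf
      rw [Finset.sum_insert ht]
      set ε : End M := End.of (∑ t ∈ S, d.p t.1 t.2 ≫ d.i t.1 t.2)
      set e : End M := End.of (d.p t.1 t.2 ≫ d.i t.1 t.2)
      have hu : IsUnit (1 - f * e) := by
        have h1 : f * e = End.of (d.p t.1 t.2 ≫ (d.i t.1 t.2 ≫ f.asHom)) :=
          Category.assoc _ _ _
        rw [h1]
        -- For one summand X the claim moves to End X, where the corresponding diagonal entry of f
        -- has residue 0 and is nilpotent.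
        refine isUnit_one_sub_comp _ _ (IsNilpotent.isUnit_one_sub ?_)
        rw [← hker, Category.assoc]
        have := congrFun hf t.1
        exact congrFun (congrFun this t.2) t.2
      obtain ⟨w, hw⟩ := hu
      have h2 : (1 : End M) - f * End.of (d.p t.1 t.2 ≫ d.i t.1 t.2 +
          ∑ t ∈ S, d.p t.1 t.2 ≫ d.i t.1 t.2) = w * (1 - (↑w⁻¹ * f) * ε) := by
        have h3 : (w : End M) * (1 - (↑w⁻¹ * f) * ε) = w - f * ε := by
          rw [mul_sub, mul_one, mul_assoc, Units.mul_inv_cancel_left]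
        rw [h3, hw, sub_sub, ← mul_add]
      rw [h2]
      refine w.isUnit.mul (ih _ ?_)
      rw [map_mul, hf, mul_zero]
  have := key Finset.univ f hf
  rwa [d.total, show f * End.of (𝟙 M) = f from mul_one f] at this

theorem isUnit_iff_residueHom (hker : ∀ j x, ρ j x = 0 ↔ IsNilpotent x)
    (hρ : ∀ j, Function.Surjective (ρ j))
    {n : J → ℕ} {M : C} (d : Decomposition X n M) (f : End M) :
    IsUnit f ↔ IsUnit (residueHom hX d f) := by
  refine ⟨fun h => h.map _, fun h => ?_⟩
  obtain ⟨A, h1, h2⟩ := isUnit_iff_exists.1 h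
  obtain ⟨g, rfl⟩ := residueHom_surjective hX hρ d A
  have h3 := isUnit_one_sub_of_residueHom_eq_zero hX hker d (1 - f * g) (by
    rw [map_sub, map_one, map_mul, h1, sub_self])
  have h4 := isUnit_one_sub_of_residueHom_eq_zero hX hker d (1 - g * f) (by
    rw [map_sub, map_one, map_mul, h2, sub_self])
  rw [sub_sub_cancel] at h3 h4
  obtain ⟨x, hx⟩ := h3
  obtain ⟨y, hy⟩ := h4
  have e1 : f * (g * ↑x⁻¹) = 1 := by rw [← mul_assoc, ← hx, Units.mul_inv]
  have e2 : (↑y⁻¹ * g) * f = 1 := by rw [mul_assoc, ← hy, Units.inv_mul]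
  have e3 : ↑y⁻¹ * g = g * ↑x⁻¹ := left_inv_eq_right_inv e2 e1
  exact isUnit_iff_exists.2 ⟨g * ↑x⁻¹, e1, e3 ▸ e2⟩

/-- Some power of f is an idempotent ε with residue 0. Then 1 - ε is a unit annihilating ε, so ε =
0. -/
theorem isNilpotent_iff_residueHom (hker : ∀ j x, ρ j x = 0 ↔ IsNilpotent x)
    {n : J → ℕ} {M : C} [Finite (End M)] (d : Decomposition X n M) (f : End M) :
    IsNilpotent f ↔ IsNilpotent (residueHom hX d f) := by
  refine ⟨fun h => h.map _, fun ⟨k, hk⟩ => ?_⟩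
  obtain ⟨m, hm, he⟩ := exists_pow_isIdempotentElem (f ^ k)
  refine ⟨k * m, ?_⟩
  rw [pow_mul]
  have h1 := isUnit_one_sub_of_residueHom_eq_zero hX hker d ((f ^ k) ^ m) (by
    rw [map_pow, map_pow, hk, zero_pow hm])
  have h2 : (1 - (f ^ k) ^ m) * (f ^ k) ^ m = 0 := by rw [sub_mul, one_mul, he.eq, sub_self]
  exact (h1.mul_right_eq_zero).1 h2

theorem card_pi_subtype {ι : Type*} [Fintype ι] {A : ι → Type*} (P : ∀ i, A i → Prop) :
    Nat.card {x : ∀ i, A i // ∀ i, P i (x i)} = ∏ i, Nat.card {a : A i // P i a} := by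
  rw [← Nat.card_pi]
  exact Nat.card_congr Equiv.subtypePiEquivPi

theorem isNilpotent_pi_iff {ι : Type*} [Finite ι] {A : ι → Type*} [∀ i, Ring (A i)]
    (x : ∀ i, A i) : IsNilpotent x ↔ ∀ i, IsNilpotent (x i) := by
  have := Fintype.ofFinite ι
  constructor
  · rintro ⟨k, hk⟩ i
    exact ⟨k, congrFun hk i⟩
  · intro h
    choose k hk using h
    refine ⟨∑ i, k i, funext fun i => ?_⟩
    exact pow_eq_zero_of_le (Finset.single_le_sum (fun _ _ => Nat.zero_le _) (Finset.mem_univ i))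
      (hk i)

theorem card_isUnit_matrix (F : Type*) [Field F] [Finite F] (n : ℕ) :
    (Nat.card {A : Matrix (Fin n) (Fin n) F // IsUnit A} : ℚ) = injCount (Nat.card F) n n := by
  have h := card_injective (F := F) (Fin n → F) (Fin n → F)
  rw [finrank_fin_fun] at h
  rw [← h]
  congr 1
  refine Nat.card_congr (Matrix.toLinAlgEquiv'.toEquiv.subtypeEquiv fun A => ?_)
  change _ ↔ Function.Injective (Matrix.toLinAlgEquiv' A)
  rw [← MulEquiv.isUnit_map (Matrix.toLinAlgEquiv' (R := F) (n := Fin n)), LinearMap.isUnit_iff_ker_eq_bot,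
    LinearMap.ker_eq_bot]

theorem card_isNilpotent_matrix (F : Type*) [Field F] (n : ℕ) :
    Nat.card {A : Matrix (Fin n) (Fin n) F // IsNilpotent A} =
      Nat.card {A : End F (Fin n → F) // IsNilpotent A} :=
  Nat.card_congr (Matrix.toLinAlgEquiv'.toEquiv.subtypeEquiv fun A =>
    (IsNilpotent.map_iff (Matrix.toLinAlgEquiv' (R := F) (n := Fin n)).injective).symm)

include hX in
/-- The proportion of nilpotent endomorphisms to automorphisms. -/
theorem card_isNilpotent_div_card_isUnit [∀ j, Finite (D j)]
    (hker : ∀ j x, ρ j x = 0 ↔ IsNilpotent x)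
    (hρ : ∀ j, Function.Surjective (ρ j)) {n : J → ℕ} {M : C} [Finite (End M)]
    (d : Decomposition X n M) :
    (Nat.card {f : End M // IsNilpotent f} : ℚ) / Nat.card {f : End M // IsUnit f} =
      ∏ j, nilWeight (Nat.card (D j)) (n j) := by
  have hsurj := residueHom_surjective hX hρ d
  have h1 := card_subtype_comp_of_surjective (residueHom hX d).toAddMonoidHom hsurj IsUnit
  have h2 := card_subtype_comp_of_surjective (residueHom hX d).toAddMonoidHom hsurj
    fun x => IsNilpotent x
  simp only [RingHom.toAddMonoidHom_eq_coe, AddMonoidHom.coe_coe,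
    ← isUnit_iff_residueHom hX hker hρ, ← isNilpotent_iff_residueHom hX hker] at h1 h2
  simp only [Pi.isUnit_iff, isNilpotent_pi_iff] at h1 h2
  rw [card_pi_subtype] at h1 h2
  rw [h1, h2]
  have hk : (Nat.card (AddMonoidHom.ker ((residueHom hX d : End M →+* _) : End M →+ (∀ j, Matrix (Fin (n j)) (Fin (n j)) (D j)))) : ℚ) ≠ 0 :=
    Nat.cast_ne_zero.2 Nat.card_pos.ne'
  push_cast
  -- Units and nilpotents are both full preimages under the residue homomorphism, so the order of
  -- its kernel cancels.
  rw [mul_div_mul_right _ _ hk, ← Finset.prod_div_distrib]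
  refine Finset.prod_congr rfl fun j _ => ?_
  rw [card_isUnit_matrix, card_isNilpotent_matrix, card_nilpotent]

end Decomposition
end Hua

namespace Hua

set_option linter.unusedSectionVars false

open Finset Module CategoryTheory

/-! ### The category of representations -/

section Cat

variable {F : Type w} [Field F] {V : Type u} [Quiver.{v + 1} V]

/-- The morphisms of representations. -/
def repHom (M N : QuiverRep F V) : Submodule F (∀ i, M.obj i →ₗ[F] N.obj i) where
  carrier := {f | ∀ (i j : V) (e : i ⟶ j) (x : M.obj i), f j (M.map e x) = N.map e (f i x)}
  zero_mem' := fun i j e x => by simp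
  add_mem' := fun {f g} hf hg i j e x => by
    simp only [Pi.add_apply, LinearMap.add_apply, map_add, hf i j e x, hg i j e x]
  smul_mem' := fun c f hf i j e x => by
    simp only [Pi.smul_apply, LinearMap.smul_apply, map_smul, hf i j e x]

instance : Category.{max u w} (QuiverRep F V) where
  Hom M N := repHom M N
  id M := ⟨fun i => LinearMap.id, fun _ _ _ _ => rfl⟩
  comp {M N P} f g := ⟨fun i => g.1 i ∘ₗ f.1 i, fun i j e x => by
    simp only [LinearMap.comp_apply, f.2 i j e x, g.2 i j e]⟩

variable {M N P : QuiverRep F V}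

/-- The component of a morphism at a vertex. -/
def app (f : M ⟶ N) (i : V) : M.obj i →ₗ[F] N.obj i := (show repHom M N from f).1 i

/-- The morphism with given components. -/
def homMk (f : ∀ i, M.obj i →ₗ[F] N.obj i)
    (h : ∀ (i j : V) (e : i ⟶ j) (x : M.obj i), f j (M.map e x) = N.map e (f i x)) : M ⟶ N :=
  (⟨f, h⟩ : repHom M N)

theorem app_map (f : M ⟶ N) {i j : V} (e : i ⟶ j) (x : M.obj i) :
    app f j (M.map e x) = N.map e (app f i x) := (show repHom M N from f).2 i j e x

theorem rep_hom_ext {f g : M ⟶ N} (h : ∀ i x, app f i x = app g i x) : f = g :=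
  Subtype.ext (funext fun i => LinearMap.ext (h i))

@[simp] theorem app_comp (f : M ⟶ N) (g : N ⟶ P) (i : V) : app (f ≫ g) i = app g i ∘ₗ app f i := rfl

@[simp] theorem app_id (i : V) : app (𝟙 M) i = LinearMap.id := rfl

instance : Preadditive (QuiverRep F V) where
  homGroup M N := inferInstanceAs (AddCommGroup (repHom M N))
  add_comp M N P f f' g := rep_hom_ext fun i x => map_add (app g i) _ _
  comp_add M N P f g g' := rep_hom_ext fun i x => rfl

instance : Linear F (QuiverRep F V) where
  homModule M N := inferInstanceAs (Module F (repHom M N))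
  smul_comp M N P c f g := rep_hom_ext fun i x => map_smul (app g i) _ _
  comp_smul M N P f c g := rep_hom_ext fun i x => rfl

@[simp] theorem app_add (f g : M ⟶ N) (i : V) : app (f + g) i = app f i + app g i := rfl

@[simp] theorem app_zero (i : V) : app (0 : M ⟶ N) i = 0 := rfl

/-- The component at a vertex as an algebra homomorphism. -/
def appHom (M : QuiverRep F V) (i : V) : CategoryTheory.End M →ₐ[F] Module.End F (M.obj i) where
  toFun f := app f i
  map_one' := rfl
  map_mul' _ _ := rfl
  map_zero' := rfl
  map_add' _ _ := rfl
  commutes' _ := rfl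

theorem app_sum {ι : Type*} (s : Finset ι) (f : ι → (M ⟶ N)) (i : V) :
    app (∑ t ∈ s, f t) i = ∑ t ∈ s, app (f t) i := by
  classical
  induction s using Finset.induction_on with
  | empty => simp
  | insert t s ht ih => rw [Finset.sum_insert ht, Finset.sum_insert ht, app_add, ih]

/-- An isomorphism from its components. -/
def isoMk (φ : ∀ i, M.obj i ≃ₗ[F] N.obj i)
    (h : ∀ (i j : V) (e : i ⟶ j) (x : M.obj i), φ j (M.map e x) = N.map e (φ i x)) : M ≅ N where
  hom := homMk (fun i => φ i) h
  inv := homMk (fun i => (φ i).symm) fun i j e x => by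
    simp only [LinearEquiv.coe_coe]
    rw [LinearEquiv.symm_apply_eq, h, LinearEquiv.apply_symm_apply]
  hom_inv_id := rep_hom_ext fun i x => (φ i).symm_apply_apply x
  inv_hom_id := rep_hom_ext fun i x => (φ i).apply_symm_apply x

/-- The components of an isomorphism. -/
def isoApp (e : M ≅ N) (i : V) : M.obj i ≃ₗ[F] N.obj i :=
  LinearEquiv.ofLinear (app e.hom i) (app e.inv i)
    (by rw [← app_comp, e.inv_hom_id, app_id]) (by rw [← app_comp, e.hom_inv_id, app_id])

theorem isIso_iff : QuiverRep.IsIso M N ↔ Nonempty (M ≅ N) :=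
  ⟨fun ⟨φ, h⟩ => ⟨isoMk φ h⟩, fun ⟨e⟩ => ⟨isoApp e, fun _ _ a x => app_map e.hom a x⟩⟩

theorem hasDim_of_iso (e : M ≅ N) {α : V →₀ ℕ} (h : M.HasDim α) : N.HasDim α := fun i => by
  have := (h i).1
  exact ⟨Module.Finite.equiv (isoApp e i), (isoApp e i).finrank_eq.symm.trans (h i).2⟩

theorem finite_hom [Finite V] [Finite F] {α β : V →₀ ℕ} (hM : M.HasDim α) (hN : N.HasDim β) :
    Finite (M ⟶ N) := by
  have : ∀ i, Finite (M.obj i →ₗ[F] N.obj i) := fun i => by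
    have := (hM i).1
    have := (hN i).1
    exact Module.finite_of_finite F
  exact inferInstanceAs (Finite (repHom M N))

/-! ### Idempotents and direct summands -/

/-- The image of an endomorphism. -/
def imageRep (e : CategoryTheory.End M) : QuiverRep F V where
  obj i := LinearMap.range (app e i)
  map {i j} a := (M.map a).restrict (by
    rintro _ ⟨x, rfl⟩
    exact ⟨M.map a x, app_map e a x⟩)

/-- The inclusion of the image of an endomorphism. -/
def imageIncl (e : CategoryTheory.End M) : imageRep e ⟶ M :=
  homMk (fun i => (LinearMap.range (app e i)).subtype) fun _ _ _ _ => rfl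

/-- The corestriction of an endomorphism to its image. -/
def imageProj (e : CategoryTheory.End M) : M ⟶ imageRep e :=
  homMk (fun i => (app e i).rangeRestrict) fun _ _ a x => Subtype.ext (app_map e a x)

theorem imageProj_incl (e : CategoryTheory.End M) : imageProj e ≫ imageIncl e = e := rfl

theorem imageIncl_proj {e : CategoryTheory.End M} (he : IsIdempotentElem e) :
    imageIncl e ≫ imageProj e = 𝟙 _ := by
  refine rep_hom_ext fun i x => Subtype.ext ?_
  obtain ⟨_, y, rfl⟩ := x
  exact LinearMap.congr_fun (congrArg (app · i) he) y

theorem nontrivial_end_iff : Nontrivial (CategoryTheory.End M) ↔ ∃ i, Nontrivial (M.obj i) := by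
  constructor
  · intro h
    by_contra! hs
    obtain ⟨f, g, hfg⟩ := h
    exact hfg (rep_hom_ext fun i x => (hs i).elim _ _)
  · rintro ⟨i, hi⟩
    obtain ⟨x, hx⟩ := exists_ne (0 : M.obj i)
    exact ⟨1, 0, fun h => hx (LinearMap.congr_fun (congrArg (app · i) h) x)⟩

/-- Image and kernel of an idempotent are complementary subrepresentations, and conversely the
projection for such a pair is an idempotent endomorphism. -/
theorem isIndecomposable_iff : M.IsIndecomposable ↔ Nontrivial (CategoryTheory.End M) ∧
    ∀ e : CategoryTheory.End M, IsIdempotentElem e → e = 0 ∨ e = 1 := by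
  rw [QuiverRep.IsIndecomposable, nontrivial_end_iff]
  refine and_congr_right fun _ => ⟨fun h e he => ?_, fun h U W hU hW hc => ?_⟩
  · have hee : ∀ i x, app e i (app e i x) = app e i x := fun i x =>
      LinearMap.congr_fun (congrArg (app · i) he) x
    have hcompl : ∀ i, IsCompl (LinearMap.range (app e i)) (LinearMap.ker (app e i)) := fun i =>
      LinearMap.IsIdempotentElem.isCompl (he.map (appHom M i))
    rcases h (fun i => LinearMap.range (app e i)) (fun i => LinearMap.ker (app e i))
      (by rintro i j a _ ⟨x, rfl⟩; exact ⟨M.map a x, app_map e a x⟩)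
      (fun i j a x hx => by
        rw [LinearMap.mem_ker] at hx ⊢
        rw [app_map, hx, map_zero]) hcompl with h0 | h0
    · left
      refine rep_hom_ext fun i x => ?_
      have : app e i x ∈ LinearMap.range (app e i) := ⟨x, rfl⟩
      rw [h0 i] at this
      exact this
    · right
      refine rep_hom_ext fun i x => ?_
      have : app e i x - x ∈ LinearMap.ker (app e i) := by
        rw [LinearMap.mem_ker, map_sub, hee, sub_self]
      rw [h0 i, Submodule.mem_bot, sub_eq_zero] at this
      exact this
  · let e : CategoryTheory.End M := homMk (fun i => (U i).projection (W i) (hc i)) fun i j a x => by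
      have hx := Submodule.projection_add_projection_eq_self (hc i) x
      conv_lhs => rw [← hx, map_add, map_add]
      rw [Submodule.projection_apply_of_mem_left _ (hU i j a _ (Submodule.projection_apply_mem _ _)),
        (Submodule.projection_apply_eq_zero_iff _).2
          (hW i j a _ (Submodule.projection_apply_mem _ _)), add_zero]
    have he : IsIdempotentElem e := rep_hom_ext fun i x =>
      LinearMap.congr_fun (Submodule.isIdempotentElem_projection (hc i)).eq x
    rcases h e he with h0 | h0
    · left
      intro i
      rw [eq_bot_iff]
      intro x hx
      have := LinearMap.congr_fun (congrArg (app · i) h0) x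
      have h2 : (U i).projection (W i) (hc i) x = 0 := this
      rw [Submodule.projection_apply_of_mem_left _ hx] at h2
      exact h2
    · right
      intro i
      rw [eq_bot_iff]
      intro x hx
      have h2 : (U i).projection (W i) (hc i) x = x :=
        LinearMap.congr_fun (congrArg (app · i) h0) x
      rw [(Submodule.projection_apply_eq_zero_iff _).2 hx] at h2
      exact h2.symm

/-- An isomorphism induces an isomorphism of endomorphism algebras. -/
def endEquiv (e : M ≅ N) : CategoryTheory.End M ≃ₐ[F] CategoryTheory.End N where
  toFun f := e.inv ≫ f ≫ e.hom
  invFun f := e.hom ≫ f ≫ e.inv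
  left_inv f := by simp
  right_inv f := by simp
  map_mul' f g := by simp [CategoryTheory.End.mul_def]
  map_add' f g := by
    change e.inv ≫ (f.asHom + g.asHom) ≫ e.hom = _
    rw [Preadditive.add_comp, Preadditive.comp_add]
  commutes' c := by
    change e.inv ≫ (c • 𝟙 M) ≫ e.hom = c • 𝟙 N
    simp

theorem isIndecomposable_of_iso (e : M ≅ N) (h : M.IsIndecomposable) : N.IsIndecomposable := by
  rw [isIndecomposable_iff] at h ⊢
  have := h.1
  refine ⟨(endEquiv e).symm.toEquiv.nontrivial, fun f hf => ?_⟩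
  rcases h.2 _ (hf.map (endEquiv e).symm) with h0 | h0
  · exact Or.inl ((map_eq_zero_iff _ (endEquiv e).symm.injective).1 h0)
  · exact Or.inr ((map_eq_one_iff _ (endEquiv e).symm.injective).1 h0)

/-- A retract of an indecomposable representation that is not zero is isomorphic to it. -/
theorem isIso_of_retract (hN : N.IsIndecomposable) (hM : Nontrivial (CategoryTheory.End M))
    (s : M ⟶ N) (p : N ⟶ M) (h : s ≫ p = 𝟙 M) : Nonempty (M ≅ N) := by
  rcases (isIndecomposable_iff.1 hN).2 (CategoryTheory.End.of (p ≫ s)) (by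
    change (p ≫ s) ≫ (p ≫ s) = p ≫ s
    rw [Category.assoc, ← Category.assoc s, h, Category.id_comp]) with h0 | h0
  · exfalso
    have h1 : p ≫ s = 0 := h0
    have h2 : 𝟙 M = s ≫ (p ≫ s) ≫ p := by
      rw [Category.assoc, h, Category.comp_id, h]
    rw [h1, Limits.zero_comp, Limits.comp_zero] at h2
    exact one_ne_zero (α := CategoryTheory.End M) h2
  · exact ⟨⟨s, p, h, h0⟩⟩

theorem finrank_add_of_idem {α : V →₀ ℕ} (hM : M.HasDim α) {e : CategoryTheory.End M}
    (he : IsIdempotentElem e) (i : V) : finrank F ((imageRep e).obj i) +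
      finrank F ((imageRep (1 - e)).obj i) = α i := by
  have := (hM i).1
  have hc := LinearMap.IsIdempotentElem.isCompl (he.map (appHom M i))
  have h1 := Submodule.finrank_add_eq_of_isCompl hc
  have h2 : LinearMap.range (app (1 - e) i) = LinearMap.ker (app e i) := by
    ext x
    constructor
    · rintro ⟨y, rfl⟩
      change app e i (y - app e i y) = 0
      rw [map_sub, sub_eq_zero]
      exact (LinearMap.congr_fun (congrArg (app · i) he) y).symm
    · intro hx
      refine ⟨x, ?_⟩
      change x - app e i x = x
      rw [LinearMap.mem_ker.1 hx, sub_zero]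
  have h3 : finrank F (LinearMap.range (app (1 - e) i)) = finrank F (LinearMap.ker (app e i)) := by
    rw [h2]
  rw [← (hM i).2, ← h1]
  exact congrArg (finrank F (LinearMap.range (app e i)) + ·) h3

end Cat
end Hua

namespace Hua

set_option linter.unusedSectionVars false

open Finset Module CategoryTheory

/-! ### Decompositions of representations -/

section Decomp

variable {C : Type u} [Category.{v} C] [Preadditive C] {J : Type*} [Fintype J] [DecidableEq J]
  {X : J → C}

/-- The decomposition of a direct sum of two decomposed objects. -/
def Decomposition.add {n₁ n₂ : J → ℕ} {M M₁ M₂ : C} (d₁ : Decomposition X n₁ M₁)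
    (d₂ : Decomposition X n₂ M₂) (u₁ : M₁ ⟶ M) (v₁ : M ⟶ M₁) (u₂ : M₂ ⟶ M) (v₂ : M ⟶ M₂)
    (h₁ : u₁ ≫ v₁ = 𝟙 M₁) (h₂ : u₂ ≫ v₂ = 𝟙 M₂) (h₁₂ : u₁ ≫ v₂ = 0) (h₂₁ : u₂ ≫ v₁ = 0)
    (h : v₁ ≫ u₁ + v₂ ≫ u₂ = 𝟙 M) : Decomposition X (fun j => n₁ j + n₂ j) M where
  i j := Fin.append (fun a => d₁.i j a ≫ u₁) (fun a => d₂.i j a ≫ u₂)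
  p j := Fin.append (fun a => v₁ ≫ d₁.p j a) (fun a => v₂ ≫ d₂.p j a)
  i_p j a b := by
    refine Fin.addCases (fun a => ?_) (fun a => ?_) a <;>
      refine Fin.addCases (fun b => ?_) (fun b => ?_) b
    · simp only [Fin.append_left, Category.assoc]
      rw [← Category.assoc u₁, h₁, Category.id_comp, d₁.i_p]
      simp
    · simp only [Fin.append_left, Fin.append_right, Category.assoc]
      rw [← Category.assoc u₁, h₁₂, Limits.zero_comp, Limits.comp_zero, if_neg]
      intro h
      have := congrArg Fin.val h
      simp at this
      omega
    · simp only [Fin.append_left, Fin.append_right, Category.assoc]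
      rw [← Category.assoc u₂, h₂₁, Limits.zero_comp, Limits.comp_zero, if_neg]
      intro h
      have := congrArg Fin.val h
      simp at this
      omega
    · simp only [Fin.append_right, Category.assoc]
      rw [← Category.assoc u₂, h₂, Category.id_comp, d₂.i_p]
      simp
  i_p_ne j k a b hjk := by
    refine Fin.addCases (fun a => ?_) (fun a => ?_) a <;>
      refine Fin.addCases (fun b => ?_) (fun b => ?_) b
    · simp only [Fin.append_left, Category.assoc]
      rw [← Category.assoc u₁, h₁, Category.id_comp, d₁.i_p_ne j k a b hjk]
    · simp only [Fin.append_left, Fin.append_right, Category.assoc]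
      rw [← Category.assoc u₁, h₁₂, Limits.zero_comp, Limits.comp_zero]
    · simp only [Fin.append_left, Fin.append_right, Category.assoc]
      rw [← Category.assoc u₂, h₂₁, Limits.zero_comp, Limits.comp_zero]
    · simp only [Fin.append_right, Category.assoc]
      rw [← Category.assoc u₂, h₂, Category.id_comp, d₂.i_p_ne j k a b hjk]
  total := by
    have e₁ : v₁ ≫ 𝟙 M₁ ≫ u₁ = v₁ ≫ u₁ := by simp
    have e₂ : v₂ ≫ 𝟙 M₂ ≫ u₂ = v₂ ≫ u₂ := by simp
    rw [← h, ← e₁, ← e₂, ← d₁.total, ← d₂.total, Fintype.sum_sigma, Fintype.sum_sigma,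
      Fintype.sum_sigma]
    simp only [Fin.sum_univ_add, Fin.append_left, Fin.append_right, Finset.sum_add_distrib,
      Preadditive.sum_comp, Preadditive.comp_sum, Category.assoc]

/-- The decomposition of a zero object. -/
def Decomposition.zero {M : C} (h : 𝟙 M = 0) : Decomposition X (fun _ => 0) M where
  i _ a := a.elim0
  p _ a := a.elim0
  i_p _ a := a.elim0
  i_p_ne _ _ a := a.elim0
  total := by
    rw [Fintype.sum_sigma, h]
    simp

/-- The decomposition of an object that is isomorphic to one of the constituents. -/
def Decomposition.single {M : C} (j : J) (e : X j ≅ M) :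
    Decomposition X (fun k => if k = j then 1 else 0) M where
  i k _ := if h : k = j then eqToHom (by rw [h]) ≫ e.hom else 0
  p k _ := if h : k = j then e.inv ≫ eqToHom (by rw [h]) else 0
  i_p k a b := by
    by_cases h : k = j
    · subst h
      have : a = b := by
        have h1 := a.2
        have h2 := b.2
        simp only [if_true] at h1 h2
        exact Fin.ext (by omega)
      simp [this]
    · have := a.2
      simp [h] at this
  i_p_ne k l a b hkl := by
    by_cases h : k = j
    · rw [dif_neg (c := l = j) fun hl => hkl (h.trans hl.symm), Limits.comp_zero]
    · rw [dif_neg h, Limits.zero_comp]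
  total := by
    rw [Fintype.sum_sigma, Finset.sum_eq_single j]
    · simp
    · intro k _ hk
      simp [hk]
    · simp

end Decomp

/-! ### Krull–Schmidt for representations -/

section Reps

variable {F : Type w} [Field F] {V : Type u} [Quiver.{v + 1} V]
variable {J : Type} [Fintype J] [DecidableEq J]

/-- The direct sum of `n j` copies of `X j`. -/
def dirSum (X : J → QuiverRep F V) (n : J → ℕ) : QuiverRep F V where
  obj i := ∀ t : Σ j, Fin (n j), (X t.1).obj i
  map e := LinearMap.pi fun t => (X t.1).map e ∘ₗ LinearMap.proj t

/-- The decomposition of a direct sum. -/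
def dirSumDecomposition (X : J → QuiverRep F V) (n : J → ℕ) : Decomposition X n (dirSum X n) where
  i j a := homMk (fun i => LinearMap.single F (fun t : Σ j, Fin (n j) => (X t.1).obj i) ⟨j, a⟩)
    fun i k e x => by
      funext t
      change Pi.single (M := fun t : Σ j, Fin (n j) => (X t.1).obj k) ⟨j, a⟩ ((X j).map e x) t =
        (X t.1).map e (Pi.single (M := fun t : Σ j, Fin (n j) => (X t.1).obj i) ⟨j, a⟩ x t)
      by_cases h : t = ⟨j, a⟩
      · subst h; simp
      · simp [Pi.single_eq_of_ne h]
  p j a := homMk (fun i => LinearMap.proj (φ := fun t : Σ j, Fin (n j) => (X t.1).obj i) ⟨j, a⟩)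
    fun i k e x => rfl
  i_p j a b := by
    refine rep_hom_ext fun i x => ?_
    change Pi.single (M := fun t : Σ j, Fin (n j) => (X t.1).obj i) ⟨j, a⟩ x ⟨j, b⟩ = _
    by_cases h : a = b
    · subst h; simp
    · rw [if_neg h, Pi.single_eq_of_ne]
      · rfl
      · intro h'
        apply h
        simpa using h'.symm
  i_p_ne j k a b hjk := by
    refine rep_hom_ext fun i x => ?_
    change Pi.single (M := fun t : Σ j, Fin (n j) => (X t.1).obj i) ⟨j, a⟩ x ⟨k, b⟩ = 0
    rw [Pi.single_eq_of_ne]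
    intro h
    exact hjk (congrArg Sigma.fst h).symm
  total := by
    refine rep_hom_ext fun i x => ?_
    rw [app_sum, LinearMap.sum_apply]
    exact Finset.univ_sum_single x

theorem dirSum_hasDim {X : J → QuiverRep F V} {γ : J → V →₀ ℕ} (hX : ∀ j, (X j).HasDim (γ j))
    (n : J → ℕ) : (dirSum X n).HasDim (∑ j, n j • γ j) := fun i => by
  have := fun t : Σ j, Fin (n j) => (hX t.1 i).1
  refine ⟨inferInstanceAs (Module.Finite F (∀ t : Σ j, Fin (n j), (X t.1).obj i)), ?_⟩
  change finrank F (∀ t : Σ j, Fin (n j), (X t.1).obj i) = _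
  rw [finrank_pi_fintype, Fintype.sum_sigma, Finsupp.finset_sum_apply]
  refine Finset.sum_congr rfl fun j _ => ?_
  simp [(hX j i).2]

theorem hasDim_unique {M : QuiverRep F V} {α β : V →₀ ℕ} (h : M.HasDim α) (h' : M.HasDim β) :
    α = β := Finsupp.ext fun i => (h i).2.symm.trans (h' i).2

/-- Every finite dimensional representation is a direct sum of indecomposable ones. -/
theorem exists_decomposition [Finite V] {X : J → QuiverRep F V} {D : ℕ}
    (hall : ∀ (M : QuiverRep F V) (α : V →₀ ℕ), α.degree ≤ D → M.HasDim α → M.IsIndecomposable →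
      ∃ j, Nonempty (X j ≅ M)) (d : ℕ) : ∀ (M : QuiverRep F V) (α : V →₀ ℕ), α.degree = d →
      d ≤ D → M.HasDim α → ∃ n, Nonempty (Decomposition X n M) := by
  induction d using Nat.strong_induction_on with
  | _ d ih =>
    intro M α hα hd hM
    by_cases hz : Nontrivial (CategoryTheory.End M)
    swap
    · rw [not_nontrivial_iff_subsingleton] at hz
      exact ⟨_, ⟨Decomposition.zero (hz.elim _ _)⟩⟩
    by_cases hi : M.IsIndecomposable
    · obtain ⟨j, ⟨e⟩⟩ := hall M α (hα.trans_le hd) hM hi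
      exact ⟨_, ⟨Decomposition.single j e⟩⟩
    rw [isIndecomposable_iff] at hi
    push Not at hi
    obtain ⟨e, he, he0, he1⟩ := hi hz
    have he' : IsIdempotentElem (1 - e) := he.one_sub
    -- The complementary summand is nonzero, so the image of e has smaller total dimension and the
    -- induction applies.
    have hdim : ∀ (e : CategoryTheory.End M), IsIdempotentElem e → 1 - e ≠ 0 →
        ∃ n, Nonempty (Decomposition X n (imageRep e)) := by
      intro e he hne
      have := fun i => (hM i).1
      let β : V →₀ ℕ := Finsupp.equivFunOnFinite.symm fun i => finrank F ((imageRep e).obj i)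
      have hβ : (imageRep e).HasDim β := fun i =>
        ⟨inferInstanceAs (Module.Finite F (LinearMap.range (app e i))), rfl⟩
      let β' : V →₀ ℕ := Finsupp.equivFunOnFinite.symm fun i => finrank F ((imageRep (1 - e)).obj i)
      have hsum : β + β' = α := Finsupp.ext fun i => finrank_add_of_idem hM he i
      have hpos : β'.degree ≠ 0 := by
        rw [Ne, Finsupp.degree_eq_zero_iff]
        intro h0
        apply hne
        refine rep_hom_ext fun i x => ?_
        have h1 : finrank F (LinearMap.range (app (1 - e) i)) = 0 := DFunLike.congr_fun h0 i
        rw [Submodule.finrank_eq_zero, LinearMap.range_eq_bot] at h1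
        rw [h1]
        rfl
      have hdeg : β.degree + β'.degree = d := by rw [← map_add, hsum, hα]
      exact ih β.degree (by omega) _ β rfl (by omega) hβ
    obtain ⟨n₁, ⟨d₁⟩⟩ := hdim e he (sub_ne_zero.2 (Ne.symm he1))
    obtain ⟨n₂, ⟨d₂⟩⟩ := hdim (1 - e) he' (by rwa [sub_sub_cancel])
    refine ⟨_, ⟨d₁.add d₂ (imageIncl e) (imageProj e) (imageIncl (1 - e)) (imageProj (1 - e))
      (imageIncl_proj he) (imageIncl_proj he') ?_ ?_ ?_⟩⟩
    · refine rep_hom_ext fun i x => Subtype.ext ?_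
      obtain ⟨_, y, rfl⟩ := x
      change app e i y - app e i (app e i y) = 0
      rw [sub_eq_zero]
      exact (LinearMap.congr_fun (congrArg (app · i) he) y).symm
    · refine rep_hom_ext fun i x => Subtype.ext ?_
      obtain ⟨_, y, rfl⟩ := x
      change app e i (y - app e i y) = 0
      rw [map_sub, sub_eq_zero]
      exact (LinearMap.congr_fun (congrArg (app · i) he) y).symm
    · rw [imageProj_incl, imageProj_incl]
      exact add_sub_cancel e 1

/-- A family of representatives for the indecomposable representations up to a bound. -/
structure IndecFamily (X : J → QuiverRep F V) (γ : J → V →₀ ℕ) (D : ℕ) : Prop where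
  indec : ∀ j, (X j).IsIndecomposable
  hasDim : ∀ j, (X j).HasDim (γ j)
  eq_of_iso : ∀ j k, Nonempty (X j ≅ X k) → j = k
  exists_iso : ∀ (M : QuiverRep F V) (α : V →₀ ℕ), α.degree ≤ D → M.HasDim α →
    M.IsIndecomposable → ∃ j, Nonempty (X j ≅ M)

variable {X : J → QuiverRep F V} {γ : J → V →₀ ℕ} {D : ℕ}

theorem IndecFamily.dim_ne_zero (hX : IndecFamily X γ D) (j : J) : γ j ≠ 0 := by
  intro h
  obtain ⟨i, hi⟩ := nontrivial_end_iff.1 (isIndecomposable_iff.1 (hX.indec j)).1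
  have h1 := hX.hasDim j i
  have := h1.1
  rw [h, Finsupp.coe_zero, Pi.zero_apply, finrank_zero_iff] at h1
  exact not_subsingleton _ h1.2

/-- A composition X j → X k → X j that is not nilpotent is invertible, which makes X j a retract of
X k and hence isomorphic to it. -/
theorem IndecFamily.exists_residueFields [Finite V] [Finite F] (hX : IndecFamily X γ D) :
    ∃ (K : J → Type max u w) (_ : ∀ j, Field (K j)) (_ : ∀ j, Finite (K j))
      (ρ : ∀ j, CategoryTheory.End (X j) →+* K j), (∀ j, Function.Surjective (ρ j)) ∧
      (∀ j x, ρ j x = 0 ↔ IsNilpotent x) ∧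
      ∀ j k, j ≠ k → ∀ (f : X j ⟶ X k) (g : X k ⟶ X j),
        ρ j (CategoryTheory.End.of (f ≫ g)) = 0 := by
  have hfin : ∀ j, Finite (CategoryTheory.End (X j)) := fun j =>
    finite_hom (hX.hasDim j) (hX.hasDim j)
  have hind := fun j => isIndecomposable_iff.1 (hX.indec j)
  have hnt := fun j => (hind j).1
  choose K hK hKf ρ hρ hker using fun j => exists_residueField (hind j).2
  refine ⟨K, hK, hKf, ρ, hρ, hker, fun j k hjk f g => ?_⟩
  rw [hker]
  refine (isUnit_or_isNilpotent_of_finite (hind j).2 _).resolve_left fun hu => hjk ?_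
  obtain ⟨w, hw, -⟩ := isUnit_iff_exists.1 hu
  exact hX.eq_of_iso j k (isIso_of_retract (hX.indec k) (hnt j) (w.asHom ≫ f) g
    ((Category.assoc _ _ _).trans hw))

end Reps
end Hua

namespace Hua

set_option linter.unusedSectionVars false

open Finset Module CategoryTheory

/-! ### Counting isomorphism classes -/

section Classes

variable {F : Type w} [Field F] {V : Type u} [Quiver.{v + 1} V]

/-- The representation on coordinate spaces with given maps. -/
def stdRep (α : V →₀ ℕ) (x : RepSpace F V α) : QuiverRep F V where
  obj i := Fin (α i) → F
  map {i j} e := x i j e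

theorem stdRep_hasDim (α : V →₀ ℕ) (x : RepSpace F V α) : (stdRep α x).HasDim α := fun i =>
  ⟨inferInstanceAs (Module.Finite F (Fin (α i) → F)), finrank_fin_fun F⟩

/-- Transport of a representation to coordinate spaces. -/
def transport {M : QuiverRep F V} {α : V →₀ ℕ} (g : ∀ i, M.obj i ≃ₗ[F] (Fin (α i) → F)) :
    RepSpace F V α := fun i j e => (g j).toLinearMap ∘ₗ M.map e ∘ₗ (g i).symm.toLinearMap

theorem transport_eq_iff {M : QuiverRep F V} {α : V →₀ ℕ}
    (g : ∀ i, M.obj i ≃ₗ[F] (Fin (α i) → F)) (x : RepSpace F V α) :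
    transport g = x ↔ ∀ (i j : V) (e : i ⟶ j) (y : M.obj i), g j (M.map e y) = x i j e (g i y) := by
  constructor
  · rintro rfl i j e y
    simp [transport]
  · intro h
    funext i j e
    refine LinearMap.ext fun y => ?_
    simp [transport, h]

theorem exists_stdRep_iso {M : QuiverRep F V} {α : V →₀ ℕ} (hM : M.HasDim α) :
    ∃ x : RepSpace F V α, Nonempty (M ≅ stdRep α x) := by
  have := fun i => (hM i).1
  let g : ∀ i, M.obj i ≃ₗ[F] (Fin (α i) → F) := fun i =>
    LinearEquiv.ofFinrankEq _ _ ((hM i).2.trans (finrank_fin_fun F).symm)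
  exact ⟨transport g, ⟨isoMk g ((transport_eq_iff g _).1 rfl)⟩⟩

/-- The isomorphisms to a representation on coordinate spaces. -/
def isoStdEquiv {M : QuiverRep F V} {α : V →₀ ℕ} (x : RepSpace F V α) :
    {g : ∀ i, M.obj i ≃ₗ[F] (Fin (α i) → F) // transport g = x} ≃ (M ≅ stdRep α x) where
  toFun g := isoMk g.1 ((transport_eq_iff g.1 x).1 g.2)
  invFun e := ⟨isoApp e, (transport_eq_iff _ x).2 fun _ _ a y => app_map e.hom a y⟩
  left_inv g := Subtype.ext (funext fun i => LinearEquiv.ext fun y => rfl)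
  right_inv e := Iso.ext rfl

/-- The automorphisms are the invertible endomorphisms. -/
noncomputable def isoSelfEquiv {C : Type*} [Category C] [Preadditive C] (M : C) :
    (M ≅ M) ≃ {f : CategoryTheory.End M // IsUnit f} where
  toFun e := ⟨e.hom, isUnit_iff_exists.2 ⟨e.inv, e.inv_hom_id, e.hom_inv_id⟩⟩
  invFun f := ⟨f.1, (↑(f.2.unit⁻¹) : CategoryTheory.End M), f.2.unit.inv_mul, f.2.unit.mul_inv⟩
  left_inv e := Iso.ext rfl
  right_inv f := rfl

variable [Finite F] [Fintype V] [∀ i j : V, Finite (i ⟶ j)]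

theorem card_linearEquiv {W W' : Type*} [AddCommGroup W] [Module F W] [AddCommGroup W'] [Module F W']
    [Finite W] [Finite W'] {n : ℕ} (h : finrank F W = n) (h' : finrank F W' = n) :
    (Nat.card (W ≃ₗ[F] W') : ℚ) = injCount (Nat.card F) n n := by
  have h1 := card_injective (F := F) W W'
  rw [h, h'] at h1
  rw [← h1]
  congr 1
  exact Nat.card_congr
    { toFun := fun e => ⟨e.toLinearMap, e.injective⟩
      invFun := fun f => LinearEquiv.ofInjectiveOfFinrankEq f.1 f.2 (h.trans h'.symm)
      left_inv := fun e => LinearEquiv.ext fun x => rfl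
      right_inv := fun f => Subtype.ext (LinearMap.ext fun x => rfl) }

/-- The size of an orbit. -/
theorem card_iso_stdRep {M : QuiverRep F V} {α : V →₀ ℕ} (hM : M.HasDim α) :
    (Nat.card {x : RepSpace F V α // Nonempty (M ≅ stdRep α x)} : ℚ) *
      Nat.card {f : CategoryTheory.End M // IsUnit f} =
      ∏ i, injCount (Nat.card F) (α i) (α i) := by
  have := fun i => (hM i).1
  have hfin : ∀ i, Finite (M.obj i) := fun i => Module.finite_of_finite F
  have : ∀ i, Finite (M.obj i ≃ₗ[F] (Fin (α i) → F)) := fun i =>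
    Finite.of_injective _ DFunLike.coe_injective
  -- Choices of coordinates for M are sent to the transported representations. The fibre over x
  -- consists of the isomorphisms from M to x, a torsor under Aut M.
  have hcard := card_eq_mul_of_card_fiber (A := ∀ i, M.obj i ≃ₗ[F] (Fin (α i) → F))
    (B := {x : RepSpace F V α // Nonempty (M ≅ stdRep α x)})
    (fun g => ⟨transport g, ⟨isoMk g ((transport_eq_iff g _).1 rfl)⟩⟩)
    (c := Nat.card {f : CategoryTheory.End M // IsUnit f}) ?_
  · rw [← Nat.cast_mul, ← hcard, Nat.card_pi, Nat.cast_prod]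
    exact Finset.prod_congr rfl fun i _ => card_linearEquiv (hM i).2 (finrank_fin_fun F)
  · rintro ⟨x, ⟨e⟩⟩
    rw [← Nat.card_congr (isoSelfEquiv M)]
    refine Nat.card_congr (((Equiv.subtypeEquivRight fun g => Subtype.ext_iff).trans
      (isoStdEquiv x)).trans ?_)
    exact { toFun := fun f => f.trans e.symm
            invFun := fun f => f.trans e
            left_inv := fun f => by simp
            right_inv := fun f => by simp }

theorem isNilpotent_end_iff {M : QuiverRep F V} (f : CategoryTheory.End M) :
    IsNilpotent f ↔ ∀ i, IsNilpotent (app f i : Module.End F (M.obj i)) := by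
  constructor
  · intro h i
    exact h.map (appHom M i)
  · intro h
    choose k hk using h
    refine ⟨∑ i, k i, rep_hom_ext fun i x => ?_⟩
    have h1 : appHom M i (f ^ ∑ i, k i) = 0 := by
      rw [map_pow]
      exact pow_eq_zero_of_le (Finset.single_le_sum (fun _ _ => Nat.zero_le _) (Finset.mem_univ i))
        (hk i)
    exact LinearMap.congr_fun h1 x

/-- Pairs of a representation and a nilpotent endomorphism. -/
def nilPairsEquiv (α : V →₀ ℕ) : NilPairs F V α ≃
    Σ x : RepSpace F V α, {f : CategoryTheory.End (stdRep α x) // IsNilpotent f} where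
  toFun p := ⟨p.1.2, homMk (M := stdRep α p.1.2) (N := stdRep α p.1.2) p.1.1
    fun i j e y => ((mem_intertwiners.1 (p.2.2 i j e)) y).symm, (isNilpotent_end_iff _).2 p.2.1⟩
  invFun p := ⟨(fun i => app p.2.1 i, p.1), (isNilpotent_end_iff _).1 p.2.2, fun i j e =>
    mem_intertwiners.2 fun y => (app_map p.2.1 e y).symm⟩
  left_inv p := rfl
  right_inv p := rfl

theorem card_nilpotent_end_of_iso {M N : QuiverRep F V} (e : M ≅ N) :
    Nat.card {f : CategoryTheory.End M // IsNilpotent f} =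
      Nat.card {f : CategoryTheory.End N // IsNilpotent f} :=
  Nat.card_congr ((endEquiv e).toEquiv.subtypeEquiv fun _ =>
    (IsNilpotent.map_iff (endEquiv e).injective).symm)

variable {J : Type} [Fintype J] [DecidableEq J] {X : J → QuiverRep F V} {γ : J → V →₀ ℕ} {D : ℕ}

/-- The multiplicities of the representations of dimension `α`. -/
abbrev Multiplicities (γ : J → V →₀ ℕ) (α : V →₀ ℕ) := {n : J → ℕ // ∑ j, n j • γ j = α}

theorem finite_multiplicities (hγ : ∀ j, γ j ≠ 0) (α : V →₀ ℕ) : Finite (Multiplicities γ α) := by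
  have : (Set.Iic fun _ : J => α.degree).Finite := Set.finite_Iic _
  refine this.subset ?_
  intro n hn j
  have h1 := congrArg Finsupp.degree (show ∑ j, n j • γ j = α from hn)
  rw [map_sum] at h1
  have h2 := Finset.single_le_sum (f := fun j => (n j • γ j).degree) (fun _ _ => Nat.zero_le _)
    (Finset.mem_univ j)
  rw [h1, map_nsmul, smul_eq_mul] at h2
  exact (Nat.le_mul_of_pos_right _
    (Nat.pos_of_ne_zero ((Finsupp.degree_eq_zero_iff (γ j)).not.2 (hγ j)))).trans h2

theorem IndecFamily.hasDim_dirSum (hX : IndecFamily X γ D) {α : V →₀ ℕ}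
    (n : Multiplicities γ α) : (dirSum X n.1).HasDim α := by
  have h := dirSum_hasDim hX.hasDim n.1
  rwa [n.2] at h

/-- Krull–Schmidt: multiplicities exist by splitting idempotents and are unique as sizes of residue
matrices. -/
theorem IndecFamily.existsUnique_iso (hX : IndecFamily X γ D) {M : QuiverRep F V} {α : V →₀ ℕ}
    (hα : α.degree ≤ D) (hM : M.HasDim α) :
    ∃! n : Multiplicities γ α, Nonempty (dirSum X n.1 ≅ M) := by
  obtain ⟨n, ⟨d⟩⟩ := exists_decomposition hX.exists_iso α.degree M α rfl hα hM
  let e := (dirSumDecomposition X n).iso d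
  have hn : ∑ j, n j • γ j = α := hasDim_unique (hasDim_of_iso e (dirSum_hasDim hX.hasDim n)) hM
  refine ⟨⟨n, hn⟩, ⟨e⟩, ?_⟩
  rintro ⟨n', hn'⟩ ⟨e'⟩
  obtain ⟨K, _, _, ρ, hρ, hker, h⟩ := hX.exists_residueFields
  exact Subtype.ext ((dirSumDecomposition X n').eq_of_iso h (dirSumDecomposition X n) (e'.trans e.symm))

/-- The number of isomorphism classes is the number of families of multiplicities. -/
theorem IndecFamily.numReps_eq (hX : IndecFamily X γ D) {α : V →₀ ℕ} (hα : α.degree ≤ D) :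
    QuiverRep.numReps F V α = Nat.card (Multiplicities γ α) := by
  symm
  refine Nat.card_congr (Equiv.ofBijective (fun n => Quotient.mk _
    (⟨dirSum X n.1, hX.hasDim_dirSum n⟩ : {M : QuiverRep F V // M.HasDim α})) ⟨?_, ?_⟩)
  · intro n n' h
    have h1 : QuiverRep.IsIso (dirSum X n.1) (dirSum X n'.1) := Quotient.exact h
    obtain ⟨e⟩ := isIso_iff.1 h1
    exact (hX.existsUnique_iso hα (hX.hasDim_dirSum n')).unique ⟨e⟩ ⟨Iso.refl _⟩
  · intro c
    induction c using Quotient.inductionOn with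
    | _ M =>
      obtain ⟨n, hn, -⟩ := hX.existsUnique_iso hα M.2
      exact ⟨n, Quotient.sound (isIso_iff.2 hn)⟩

/-- `r_α` at a finite field as a sum over isomorphism classes. -/
theorem IndecFamily.rValue_eq [DecidableEq V] (hX : IndecFamily X γ D) {α : V →₀ ℕ}
    (hα : α.degree ≤ D)
    [Fintype (Multiplicities γ α)] : rValue V (Nat.card F) α = ∑ n : Multiplicities γ α,
      (Nat.card {f : CategoryTheory.End (dirSum X n.1) // IsNilpotent f} : ℚ) /
        Nat.card {f : CategoryTheory.End (dirSum X n.1) // IsUnit f} := by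
  have hq : (1 : ℚ) < Nat.card F := one_lt_natCard_rat F
  have h0 : ∏ i, injCount (Nat.card F) (α i) (α i) ≠ 0 :=
    Finset.prod_ne_zero_iff.2 fun i _ => injCount_self_ne_zero hq _
  apply mul_left_cancel₀ h0
  have hdim : ∀ n : Multiplicities γ α, (dirSum X n.1).HasDim α := hX.hasDim_dirSum
  let cls : RepSpace F V α → Multiplicities γ α := fun x =>
    (hX.existsUnique_iso hα (stdRep_hasDim α x)).choose
  have hcls : ∀ x n, cls x = n ↔ Nonempty (dirSum X n.1 ≅ stdRep α x) := fun x n => by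
    have h := (hX.existsUnique_iso hα (stdRep_hasDim α x)).choose_spec
    exact ⟨fun hn => hn ▸ h.1, fun hn => (h.2 n hn).symm⟩
  have := Fintype.ofFinite (RepSpace F V α)
  have hfinE : ∀ x : RepSpace F V α, Finite (CategoryTheory.End (stdRep α x)) := fun x =>
    finite_hom (stdRep_hasDim α x) (stdRep_hasDim α x)
  -- The second count of the pairs, by the isomorphism class of the representation.
  rw [← card_nilPairs, Nat.card_congr (nilPairsEquiv α), Nat.card_sigma,
    ← Finset.sum_fiberwise_of_maps_to (t := Finset.univ) (g := cls) fun _ _ => Finset.mem_univ _,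
    Nat.cast_sum, Finset.mul_sum]
  refine Finset.sum_congr rfl fun n _ => ?_
  rw [Finset.sum_congr rfl (g := fun _ =>
    Nat.card {f : CategoryTheory.End (dirSum X n.1) // IsNilpotent f})]
  · rw [Finset.sum_const, smul_eq_mul, Nat.cast_mul, ← card_iso_stdRep (hdim n)]
    have : Finite (CategoryTheory.End (dirSum X n.1)) := finite_hom (hdim n) (hdim n)
    have hU : (Nat.card {f : CategoryTheory.End (dirSum X n.1) // IsUnit f} : ℚ) ≠ 0 := by
      have : Nonempty {f : CategoryTheory.End (dirSum X n.1) // IsUnit f} := ⟨⟨1, isUnit_one⟩⟩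
      exact_mod_cast Nat.card_pos.ne'
    have hc : Nat.card {x : RepSpace F V α // Nonempty (dirSum X n.1 ≅ stdRep α x)} =
        (Finset.univ.filter fun x => cls x = n).card := by
      rw [← Fintype.card_subtype, ← Nat.card_eq_fintype_card]
      exact Nat.card_congr (Equiv.subtypeEquivRight fun x => (hcls x n).symm)
    rw [hc]
    field_simp
  · intro x hx
    obtain ⟨e⟩ := (hcls x n).1 (Finset.mem_filter.1 hx).2
    exact (card_nilpotent_end_of_iso e).symm

end Classes
end Hua

namespace Hua

set_option linter.unusedSectionVars false

open Finset Module CategoryTheory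

/-! ### Logarithms of the counting series -/

section Series

variable {σ : Type*} {K : Type*} [Field K] [CharZero K]

/-- A finite family of indecomposables describes the counting series only up to a degree D; the
logarithm relation can be checked on such approximations. -/
theorem isLog_of_forall_degree {f g : MvPowerSeries σ K}
    (h : ∀ D : ℕ, ∃ f' g' : MvPowerSeries σ K, IsLog f' g' ∧ ∀ α : σ →₀ ℕ, α.degree ≤ D →
      MvPowerSeries.coeff α f = MvPowerSeries.coeff α f' ∧
      MvPowerSeries.coeff α g = MvPowerSeries.coeff α g') : IsLog f g := by
  classical
  obtain ⟨f', g', h', h0⟩ := h 0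
  refine ⟨?_, ?_, ?_⟩
  · rw [← MvPowerSeries.coeff_zero_eq_constantCoeff_apply, (h0 0 (by simp)).1,
      MvPowerSeries.coeff_zero_eq_constantCoeff_apply, h'.left]
  · rw [← MvPowerSeries.coeff_zero_eq_constantCoeff_apply, (h0 0 (by simp)).2,
      MvPowerSeries.coeff_zero_eq_constantCoeff_apply, h'.right]
  · ext α
    obtain ⟨f', g', h', h0⟩ := h α.degree
    have := congrArg (MvPowerSeries.coeff α) h'.euler_eq
    rw [coeff_euler, MvPowerSeries.coeff_mul] at this ⊢
    rw [(h0 α le_rfl).1, this]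
    refine Finset.sum_congr rfl fun p hp => ?_
    rw [coeff_euler, coeff_euler, (h0 p.1 (degree_fst_le hp)).1, (h0 p.2 ?_).2]
    rw [← HasAntidiagonal.mem_antidiagonal.1 hp, map_add]
    omega

theorem coeff_mul_congr {f f' g g' : MvPowerSeries σ K} {D : ℕ}
    (hf : ∀ α : σ →₀ ℕ, α.degree ≤ D → MvPowerSeries.coeff α f = MvPowerSeries.coeff α f')
    (hg : ∀ α : σ →₀ ℕ, α.degree ≤ D → MvPowerSeries.coeff α g = MvPowerSeries.coeff α g')
    (α : σ →₀ ℕ) (hα : α.degree ≤ D) :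
    MvPowerSeries.coeff α (f * g) = MvPowerSeries.coeff α (f' * g') := by
  classical
  rw [MvPowerSeries.coeff_mul, MvPowerSeries.coeff_mul]
  refine Finset.sum_congr rfl fun p hp => ?_
  have h := HasAntidiagonal.mem_antidiagonal.1 hp
  rw [← h, map_add] at hα
  rw [hf p.1 (by omega), hg p.2 (by omega)]

theorem coeff_prod_congr {ι : Type*} (s : Finset ι) {f f' : ι → MvPowerSeries σ K} {D : ℕ}
    (hf : ∀ i ∈ s, ∀ α : σ →₀ ℕ, α.degree ≤ D →
      MvPowerSeries.coeff α (f i) = MvPowerSeries.coeff α (f' i))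
    (α : σ →₀ ℕ) (hα : α.degree ≤ D) :
    MvPowerSeries.coeff α (∏ i ∈ s, f i) = MvPowerSeries.coeff α (∏ i ∈ s, f' i) := by
  classical
  induction s using Finset.induction_on generalizing α with
  | empty => rfl
  | insert i s hi ih =>
    rw [Finset.prod_insert hi, Finset.prod_insert hi]
    exact coeff_mul_congr (hf i (by simp)) (fun β hβ => ih (fun j hj => hf j (by simp [hj])) β hβ)
      α hα

theorem coeff_prod_subst_monomial [Finite σ] {J : Type*} [Fintype J] [DecidableEq J] {γ : J → σ →₀ ℕ}
    (hγ : ∀ j, γ j ≠ 0) (W : J → ℕ → K) (α : σ →₀ ℕ)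
    [Fintype {n : J → ℕ // ∑ j, n j • γ j = α}] :
    MvPowerSeries.coeff α
      (∏ j, (PowerSeries.mk (W j)).subst (MvPowerSeries.monomial (γ j) (1 : K))) =
      ∑ n : {n : J → ℕ // ∑ j, n j • γ j = α}, ∏ j, W j (n.1 j) := by
  classical
  have h1 : ∀ j ∈ (Finset.univ : Finset J), ∀ β : σ →₀ ℕ, β.degree ≤ α.degree →
      MvPowerSeries.coeff β ((PowerSeries.mk (W j)).subst (MvPowerSeries.monomial (γ j) (1 : K))) =
      MvPowerSeries.coeff β (∑ n ∈ range (α.degree + 1),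
        MvPowerSeries.monomial (n • γ j) (W j n)) := by
    intro j _ β hβ
    rw [coeff_subst_monomial (hγ j) _ β hβ, map_sum]
    refine Finset.sum_congr rfl fun n _ => ?_
    rw [MvPowerSeries.coeff_monomial, PowerSeries.coeff_mk]
    simp [eq_comm]
  have hmon : ∀ n : J → ℕ, ∏ j, MvPowerSeries.monomial (n j • γ j) (W j (n j)) =
      MvPowerSeries.monomial (∑ j, n j • γ j) (∏ j, W j (n j)) := fun n =>
    (MvPowerSeries.prod_monomial _ _ _)
  rw [coeff_prod_congr _ h1 α le_rfl, Finset.prod_univ_sum, map_sum]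
  simp only [hmon, MvPowerSeries.coeff_monomial]
  rw [← Finset.sum_filter]
  refine (Finset.sum_bij (fun n _ => n.1) ?_ ?_ ?_ ?_).symm
  · rintro ⟨n, hn⟩ _
    rw [Finset.mem_filter, Fintype.mem_piFinset]
    refine ⟨fun j => ?_, hn.symm⟩
    have h2 := congrArg Finsupp.degree hn
    rw [map_sum] at h2
    have h3 := Finset.single_le_sum (f := fun j => (n j • γ j).degree) (fun _ _ => Nat.zero_le _)
      (Finset.mem_univ j)
    rw [h2, map_nsmul, smul_eq_mul] at h3
    rw [Finset.mem_range, Nat.lt_succ_iff]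
    exact (Nat.le_mul_of_pos_right _
      (Nat.pos_of_ne_zero ((Finsupp.degree_eq_zero_iff (γ j)).not.2 (hγ j)))).trans h3
  · intro n _ n' _ h
    exact Subtype.ext h
  · intro n hn
    exact ⟨⟨n, (Finset.mem_filter.1 hn).2.symm⟩, Finset.mem_univ _, rfl⟩
  · intro n _
    rfl

/-- Reindexes the logarithm attached to one indecomposable of dimension γ by k = n d: then 1/n =
d/k, and β = n γ means γ = d (β/k). The weight d is the number of Galois conjugates. -/
theorem coeff_subst_monomial_eq_sum_divisors {γ : σ →₀ ℕ} (hγ : γ ≠ 0) {d : ℕ} (hd : d ∣ content γ)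
    (t : ℕ → K) {W : ℕ → K} (hW : ∀ n, W n = (n : K)⁻¹ * t (n * d)) [DecidableEq σ] (β : σ →₀ ℕ) :
    MvPowerSeries.coeff β ((PowerSeries.mk W).subst (MvPowerSeries.monomial γ (1 : K))) =
      ∑ k ∈ (content β).divisors,
        (k : K)⁻¹ * (((if d ∣ k ∧ γ = d • divBy β k then d else 0 : ℕ) : K) * t k) := by
  have hd0 : d ≠ 0 := fun h => content_ne_zero hγ (by simpa [h] using hd)
  have hkey : ∀ k ∈ (content β).divisors, d ∣ k → γ = d • divBy β k → ∃ n, k = n * d ∧ β = n • γ := by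
    rintro k hk ⟨n, rfl⟩ h
    refine ⟨n, mul_comm _ _, ?_⟩
    rw [mul_comm d n] at h hk
    conv_lhs => rw [← smul_divBy (Nat.dvd_of_mem_divisors hk), mul_smul, ← h]
  by_cases h : ∃ n : ℕ, β = n • γ
  · obtain ⟨n, rfl⟩ := h
    rw [coeff_subst_monomial_smul hγ, PowerSeries.coeff_mk]
    by_cases hn : n = 0
    · subst hn
      simp [hW]
    · have hdiv : n * d ∣ content (n • γ) := by
        rw [content_smul]
        exact Nat.mul_dvd_mul_left n hd
      have hc : content (n • γ) ≠ 0 := by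
        rw [content_smul]
        exact mul_ne_zero hn (content_ne_zero hγ)
      rw [Finset.sum_eq_single (n * d)]
      · rw [if_pos]
        · have h1 : (d : K) ≠ 0 := Nat.cast_ne_zero.2 hd0
          rw [hW, Nat.cast_mul, mul_inv]
          field_simp
        · refine ⟨dvd_mul_left d n, ?_⟩
          rw [← divBy_divBy, divBy_smul hn, smul_divBy hd]
      · intro k hk hne
        rw [if_neg, Nat.cast_zero, zero_mul, mul_zero]
        rintro ⟨h1, h2⟩
        obtain ⟨m, rfl, h3⟩ := hkey k hk h1 h2
        exact hne (by rw [smul_left_injective_of_ne_zero hγ h3])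
      · intro h1
        exact absurd (Nat.mem_divisors.2 ⟨hdiv, hc⟩) h1
  · rw [coeff_subst_monomial_eq_zero hγ _ fun n hn => h ⟨n, hn⟩]
    refine (Finset.sum_eq_zero fun k hk => ?_).symm
    rw [if_neg, Nat.cast_zero, zero_mul, mul_zero]
    rintro ⟨h1, h2⟩
    obtain ⟨n, -, hn⟩ := hkey k hk h1 h2
    exact h ⟨n, hn⟩

end Series

/-! ### The order of the residue field -/

section ResCard

variable {F : Type w} [Field F] {V : Type u} [Quiver.{v + 1} V]

/-- The number of elements of the residue field of a local endomorphism ring. -/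
noncomputable def resCard (M : QuiverRep F V) : ℕ :=
  Nat.card (CategoryTheory.End M) / Nat.card {f : CategoryTheory.End M // IsNilpotent f}

theorem resCard_eq {M : QuiverRep F V} [Finite (CategoryTheory.End M)] {K : Type*} [Ring K]
    (ρ : CategoryTheory.End M →+* K) (hρ : Function.Surjective ρ)
    (hker : ∀ x, ρ x = 0 ↔ IsNilpotent x) : resCard M = Nat.card K := by
  have h1 := card_eq_card_mul_card_ker ρ.toAddMonoidHom hρ
  have h2 : Nat.card ρ.toAddMonoidHom.ker =
      Nat.card {f : CategoryTheory.End M // IsNilpotent f} :=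
    Nat.card_congr (Equiv.subtypeEquivRight hker)
  rw [resCard, h1, h2]
  have : Nonempty {f : CategoryTheory.End M // IsNilpotent f} := ⟨⟨0, IsNilpotent.zero⟩⟩
  exact Nat.mul_div_cancel _ Nat.card_pos

end ResCard

/-! ### The two counting series as products over indecomposables -/

section Reps

variable {F : Type w} [Field F] [Finite F] {V : Type u} [Quiver.{v + 1} V] [Fintype V] [DecidableEq V]
  [∀ i j : V, Finite (i ⟶ j)]

variable {J : Type} [Fintype J] [DecidableEq J] {X : J → QuiverRep F V} {γ : J → V →₀ ℕ} {D : ℕ}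

/-- By Krull–Schmidt the series of isomorphism classes is Π_j 1/(1 - x^(γ_j)) up to degree D. -/
theorem IndecFamily.exists_isLog_numReps (hX : IndecFamily X γ D) {d : J → ℕ}
    (hd : ∀ j, d j ∣ content (γ j)) {A : ℕ → (V →₀ ℕ) → ℕ}
    (hA : ∀ k, k ≠ 0 → ∀ α, (k • α).degree ≤ D →
      A k α = ∑ j, if d j ∣ k ∧ γ j = d j • α then d j else 0) :
    ∃ f g : MvPowerSeries V ℚ, IsLog f g ∧ ∀ α : V →₀ ℕ, α.degree ≤ D →
      (QuiverRep.numReps F V α : ℚ) = MvPowerSeries.coeff α f ∧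
      MvPowerSeries.coeff α (adamsSum fun k γ => (A k γ : ℚ)) = MvPowerSeries.coeff α g := by
  have hγ := hX.dim_ne_zero
  refine ⟨_, _, IsLog.prod (s := Finset.univ) fun j _ => isLog_geometric (1 : ℚ) (hγ j),
    fun α hα => ⟨?_, ?_⟩⟩
  · have := finite_multiplicities hγ α
    have := Fintype.ofFinite (Multiplicities γ α)
    rw [hX.numReps_eq hα, coeff_prod_subst_monomial hγ (fun _ n => (1 : ℚ) ^ n)]
    simp [Nat.card_eq_fintype_card]
  · rw [map_sum, Finset.sum_congr rfl fun j _ => coeff_subst_monomial_eq_sum_divisors (hγ j) (hd j)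
      (fun _ => (1 : ℚ)) (fun n => by simp) α, Finset.sum_comm, coeff_adamsSum]
    refine Finset.sum_congr rfl fun k hk => ?_
    have hk' := Nat.dvd_of_mem_divisors hk
    rw [hA k (Nat.pos_of_mem_divisors hk).ne' _ (by rwa [smul_divBy hk']), Nat.cast_sum,
      Finset.mul_sum]
    simp

/-- Up to degree D, r is the product over j of the `nilWeight` series for q^(d_j) in x^(γ_j). The
denominators q^(n d_j) - 1 of its logarithm become q^k - 1 with k = n d_j. -/
theorem IndecFamily.exists_isLog_rValue (hX : IndecFamily X γ D) {d : J → ℕ}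
    (hd : ∀ j, d j ∣ content (γ j)) (hres : ∀ j, resCard (X j) = Nat.card F ^ d j)
    {A : ℕ → (V →₀ ℕ) → ℕ}
    (hA : ∀ k, k ≠ 0 → ∀ α, (k • α).degree ≤ D →
      A k α = ∑ j, if d j ∣ k ∧ γ j = d j • α then d j else 0) :
    ∃ f g : MvPowerSeries V ℚ, IsLog f g ∧ ∀ α : V →₀ ℕ, α.degree ≤ D →
      rValue V (Nat.card F) α = MvPowerSeries.coeff α f ∧
      MvPowerSeries.coeff α (adamsSum fun k γ => (A k γ : ℚ) / ((Nat.card F : ℚ) ^ k - 1)) =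
        MvPowerSeries.coeff α g := by
  have hγ := hX.dim_ne_zero
  obtain ⟨K, _, _, ρ, hρ, hker, h⟩ := hX.exists_residueFields
  have hfin : ∀ j, Finite (CategoryTheory.End (X j)) := fun j =>
    finite_hom (hX.hasDim j) (hX.hasDim j)
  have hK : ∀ j, (Nat.card (K j) : ℚ) = (Nat.card F : ℚ) ^ d j := fun j => by
    rw [← resCard_eq (ρ j) (hρ j) (hker j), hres j, Nat.cast_pow]
  refine ⟨_, _, IsLog.prod (s := Finset.univ) fun j _ =>
    isLog_nilWeight (one_lt_natCard_rat (K j)) (hγ j), fun α hα => ⟨?_, ?_⟩⟩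
  · have := finite_multiplicities hγ α
    have := Fintype.ofFinite (Multiplicities γ α)
    rw [hX.rValue_eq hα, coeff_prod_subst_monomial hγ]
    refine Finset.sum_congr rfl fun n _ => ?_
    have : Finite (CategoryTheory.End (dirSum X n.1)) :=
      finite_hom (hX.hasDim_dirSum n) (hX.hasDim_dirSum n)
    exact card_isNilpotent_div_card_isUnit h hker hρ (dirSumDecomposition X n.1)
  · rw [map_sum, Finset.sum_congr rfl fun j _ => coeff_subst_monomial_eq_sum_divisors (hγ j) (hd j)
      (fun k => (1 : ℚ) / ((Nat.card F : ℚ) ^ k - 1))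
      (fun n => by rw [hK, ← pow_mul, mul_comm (d j)]; simp [mul_comm]) α, Finset.sum_comm,
      coeff_adamsSum]
    refine Finset.sum_congr rfl fun k hk => ?_
    have hk' := Nat.dvd_of_mem_divisors hk
    rw [hA k (Nat.pos_of_mem_divisors hk).ne' _ (by rwa [smul_divBy hk']), Nat.cast_sum,
      div_eq_mul_one_div, Finset.sum_mul, Finset.mul_sum]

/-- There are finitely many indecomposable representations up to a bound for the dimension. -/
theorem exists_indecFamily (F : Type w) [Field F] [Finite F] (V : Type u) [Quiver.{v + 1} V]
    [Fintype V] [∀ i j : V, Finite (i ⟶ j)] (D : ℕ) :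
    ∃ (m : ℕ) (X : Fin m → QuiverRep F V) (γ : Fin m → V →₀ ℕ), IndecFamily X γ D := by
  classical
  let B := {α : V →₀ ℕ // α.degree ≤ D}
  have hB : Finite B := Finsupp.finite_of_degree_le D
  let T := Σ α : B, {x : RepSpace F V α.1 // (stdRep α.1 x).IsIndecomposable}
  have hT : Finite T := inferInstance
  let s : Setoid T :=
    { r := fun a b => Nonempty (stdRep a.1.1 a.2.1 ≅ stdRep b.1.1 b.2.1)
      iseqv := ⟨fun a => ⟨Iso.refl _⟩, fun ⟨e⟩ => ⟨e.symm⟩, fun ⟨e⟩ ⟨f⟩ => ⟨e.trans f⟩⟩ }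
  obtain ⟨m, ⟨e⟩⟩ := Finite.exists_equiv_fin (Quotient s)
  let t : Fin m → T := fun j => (e.symm j).out
  have ht : ∀ j, e (Quotient.mk s (t j)) = j := fun j => by
    rw [Quotient.out_eq, Equiv.apply_symm_apply]
  refine ⟨m, fun j => stdRep (t j).1.1 (t j).2.1, fun j => (t j).1.1,
    ⟨fun j => (t j).2.2, fun j => stdRep_hasDim _ _, fun j k h => ?_, fun M α hα hM hi => ?_⟩⟩
  · rw [← ht j, ← ht k]
    exact congrArg e (Quotient.sound h)
  · obtain ⟨x, ⟨f⟩⟩ := exists_stdRep_iso hM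
    let a : T := ⟨⟨α, hα⟩, x, isIndecomposable_of_iso f hi⟩
    refine ⟨e (Quotient.mk s a), ?_⟩
    have h1 : Quotient.mk s (t (e (Quotient.mk s a))) = Quotient.mk s a := by
      apply e.injective
      rw [ht]
    obtain ⟨g⟩ := Quotient.exact h1
    exact ⟨g.trans f.symm⟩

end Reps
end Hua

namespace Hua

set_option linter.unusedSectionVars false

open Finset Module CategoryTheory

/-! ### Extension of scalars of finite local algebras -/

section LocalAlgebra

open Polynomial
open scoped Pointwise

/-- Over the field with q elements f(x^q) = f(x)^q as polynomials, so commutativity of R plays no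
role. -/
theorem aeval_pow_card_pow {F : Type*} [Field F] [Fintype F] {R : Type*} [Ring R] [Algebra F R]
    (f : F[X]) (x : R) (m : ℕ) :
    aeval (x ^ Fintype.card F ^ m) f = aeval x f ^ Fintype.card F ^ m := by
  induction m with
  | zero => simp
  | succ m ih =>
    rw [pow_succ, pow_mul, pow_mul, ← ih, ← expand_aeval, FiniteField.expand_card, map_pow]

/-- A finite local algebra is generated, up to nilpotent elements, by a root of an irreducible
polynomial. -/
theorem exists_root_generating {F : Type w} [Field F] [Finite F] {R : Type u} [Ring R] [Finite R]
    [Nontrivial R] [Algebra F R] (h : ∀ e : R, IsIdempotentElem e → e = 0 ∨ e = 1) :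
    ∃ (f : F[X]) (θ : R), f.Monic ∧ Irreducible f ∧ aeval θ f = 0 ∧
      (∀ g, ∃ p : F[X], IsNilpotent (g - aeval θ p)) ∧
      ∃ (D : Type u) (_ : Field D) (ρ : R →+* D), Function.Surjective ρ ∧
        (∀ x, ρ x = 0 ↔ IsNilpotent x) ∧ Nat.card D = Nat.card F ^ f.natDegree := by
  obtain ⟨D, _, _, ρ, hρ, hker⟩ := exists_residueField h
  let _ : Algebra F D := (ρ.comp (algebraMap F R)).toAlgebra
  let ρ' : R →ₐ[F] D := { ρ with commutes' := fun _ => rfl }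
  have hρ' : ∀ x, ρ' x = ρ x := fun _ => rfl
  have := Fintype.ofFinite F
  obtain ⟨a, ha⟩ := Field.exists_primitive_element F D
  have hint : IsIntegral F a := IsIntegral.of_finite F a
  obtain ⟨θ₀, hθ₀⟩ := hρ a
  have hfa : aeval a (minpoly F a) = 0 := minpoly.aeval F a
  have hnil : IsNilpotent (aeval θ₀ (minpoly F a)) := by
    rw [← hker, ← hρ', ← Polynomial.aeval_algHom_apply, hρ', hθ₀, hfa]
  obtain ⟨n, hn⟩ := hnil
  have hcardD : Nat.card D = Nat.card F ^ (minpoly F a).natDegree := by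
    have h1 : finrank F D = (minpoly F a).natDegree := by
      rw [← IntermediateField.adjoin.finrank hint, ha, IntermediateField.finrank_top']
    rw [← h1, ← Module.natCard_eq_pow_finrank]
  have hpow : ∀ m, a ^ (Fintype.card F ^ ((minpoly F a).natDegree * m)) = a := by
    intro m
    induction m with
    | zero => simp
    | succ m ih =>
      have := Fintype.ofFinite D
      rw [mul_add, mul_one, pow_add, pow_mul, ih, ← Nat.card_eq_fintype_card, ← hcardD,
        Nat.card_eq_fintype_card, FiniteField.pow_card]
  have hdeg : 0 < (minpoly F a).natDegree := minpoly.natDegree_pos hint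
  -- A high power of Frobenius makes the nilpotent f(θ₀) vanish. The exponent is a multiple of the
  -- degree of f, so the residue a of θ₀ is unchanged.
  refine ⟨minpoly F a, θ₀ ^ (Fintype.card F ^ ((minpoly F a).natDegree * n)),
    minpoly.monic hint, minpoly.irreducible hint, ?_, fun g => ?_, D, _, ρ, hρ, hker, hcardD⟩
  · rw [aeval_pow_card_pow]
    refine pow_eq_zero_of_le ?_ hn
    exact (Nat.le_mul_of_pos_left n hdeg).trans (Nat.lt_pow_self Fintype.one_lt_card).le
  · have hmem : ρ g ∈ Algebra.adjoin F {a} := by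
      rw [← IntermediateField.adjoin_simple_toSubalgebra_of_isAlgebraic hint.isAlgebraic, ha]
      trivial
    rw [Algebra.adjoin_singleton_eq_range_aeval] at hmem
    obtain ⟨p, hp⟩ := hmem
    refine ⟨p, ?_⟩
    rw [← hker, map_sub, ← hρ' (aeval _ p), ← Polynomial.aeval_algHom_apply, map_pow, hρ', hθ₀, hpow,
      sub_eq_zero]
    exact hp.symm

theorem isNilpotent_mul_of_local {R : Type*} [Ring R] [Finite R]
    (h : ∀ e : R, IsIdempotentElem e → e = 0 ∨ e = 1) {x : R} (hx : IsNilpotent x) (a : R) :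
    IsNilpotent (a * x) ∧ IsNilpotent (x * a) := by
  rcases subsingleton_or_nontrivial R with hs | hs
  · exact ⟨⟨1, Subsingleton.elim _ _⟩, ⟨1, Subsingleton.elim _ _⟩⟩
  obtain ⟨D, _, _, ρ, -, hker⟩ := exists_residueField h
  constructor <;> rw [← hker, map_mul, (hker x).2 hx] <;> simp

/-- The nilpotent elements of a finite local ring form a nilpotent ideal. -/
theorem exists_setOf_isNilpotent_pow {R : Type*} [Ring R] [Finite R]
    (h : ∀ e : R, IsIdempotentElem e → e = 0 ∨ e = 1) :
    ∃ N : ℕ, {x : R | IsNilpotent x} ^ N ⊆ {0} := by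
  obtain ⟨N, hN⟩ := IsSemiprimaryRing.isNilpotent (R := R)
  have hsub : {x : R | IsNilpotent x} ⊆ Ring.jacobson R := by
    intro x hx
    rw [← Ideal.jacobson_bot, SetLike.mem_coe, Ideal.mem_jacobson_iff]
    intro y
    obtain ⟨u, hu⟩ := ((isNilpotent_mul_of_local h hx y).1).isUnit_one_add
    refine ⟨↑u⁻¹, ?_⟩
    have h1 : (↑u⁻¹ : R) * (1 + y * x) = 1 := by rw [← hu, Units.inv_mul]
    rw [mul_add, mul_one, ← mul_assoc] at h1
    rw [Ideal.mem_bot, sub_eq_zero, add_comm]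
    exact h1
  have hpow : ∀ n, {x : R | IsNilpotent x} ^ n ⊆ ((Ring.jacobson R) ^ n : Ideal R) := by
    intro n
    induction n with
    | zero => simp [Submodule.pow_zero, Ideal.one_eq_top]
    | succ n ih =>
      rw [pow_succ, Submodule.pow_succ]
      rintro _ ⟨x, hx, y, hy, rfl⟩
      exact Submodule.mul_mem_mul (ih hx) (hsub hy)
  refine ⟨N, fun x hx => ?_⟩
  have := hpow N hx
  rw [hN] at this
  exact this

variable {F : Type*} [Field F] {R : Type*} [Ring R] [Algebra F R] {A : Type*} [Field A]
  [Algebra F A] {C : Type*} [Ring C] [Algebra A C]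

/-- The span of the images of the nilpotent elements. -/
def nilSpan (A : Type*) [Field A] {C : Type*} [Ring C] [Algebra A C] (φ : R →+* C) :
    Submodule A C :=
  Submodule.span A (φ '' {x | IsNilpotent x})

theorem mul_mem_nilSpan [Finite R] (h : ∀ e : R, IsIdempotentElem e → e = 0 ∨ e = 1) {φ : R →+* C}
    (hφ : Submodule.span A (Set.range φ) = ⊤) {x : C} (hx : x ∈ nilSpan A φ) (c : C) :
    c * x ∈ nilSpan A φ ∧ x * c ∈ nilSpan A φ := by
  have hc : c ∈ Submodule.span A (Set.range φ) := hφ ▸ Submodule.mem_top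
  constructor
  · have h1 : c * x ∈ Submodule.span A (Set.range φ) * nilSpan A φ := Submodule.mul_mem_mul hc hx
    rw [nilSpan, Submodule.span_mul_span] at h1
    refine Submodule.span_mono ?_ h1
    rintro _ ⟨_, ⟨a, rfl⟩, _, ⟨b, hb, rfl⟩, rfl⟩
    exact ⟨a * b, (isNilpotent_mul_of_local h hb a).1, map_mul _ _ _⟩
  · have h1 : x * c ∈ nilSpan A φ * Submodule.span A (Set.range φ) := Submodule.mul_mem_mul hx hc
    rw [nilSpan, Submodule.span_mul_span] at h1
    refine Submodule.span_mono ?_ h1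
    rintro _ ⟨_, ⟨b, hb, rfl⟩, _, ⟨a, rfl⟩, rfl⟩
    exact ⟨b * a, (isNilpotent_mul_of_local h hb a).2, map_mul _ _ _⟩

/-- A product of sufficiently many nilpotents of R is 0, and so is a product of as many elements of
the span of their images. -/
theorem isNilpotent_of_mem_nilSpan [Finite R] (h : ∀ e : R, IsIdempotentElem e → e = 0 ∨ e = 1)
    {φ : R →+* C} {x : C} (hx : x ∈ nilSpan A φ) : IsNilpotent x := by
  obtain ⟨N, hN⟩ := exists_setOf_isNilpotent_pow h
  refine ⟨N, ?_⟩
  have h1 : x ^ N ∈ nilSpan A φ ^ N := Submodule.pow_mem_pow _ hx N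
  rw [nilSpan, Submodule.span_pow, ← Set.image_pow] at h1
  have h2 := Submodule.span_mono (Set.image_mono (f := φ) hN) h1
  simpa using h2

theorem aeval_map_eq {φ : R →+* C}
    (hφ : ∀ c, φ (algebraMap F R c) = algebraMap A C (algebraMap F A c)) (θ : R) (p : F[X]) :
    aeval (φ θ) (p.map (algebraMap F A)) = φ (aeval θ p) := by
  rw [aeval_def, eval₂_map, aeval_def, hom_eval₂]
  congr 1
  ext c
  exact (hφ c).symm

/-- Modulo the nilpotent ideal the extended algebra consists of the polynomials in φ(θ). -/
theorem exists_aeval_sub_mem {φ : R →+* C}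
    (hφ : ∀ c, φ (algebraMap F R c) = algebraMap A C (algebraMap F A c))
    (hspan : Submodule.span A (Set.range φ) = ⊤) {θ : R}
    (hθ : ∀ g, ∃ p : F[X], IsNilpotent (g - aeval θ p)) (c : C) :
    ∃ p : A[X], c - aeval (φ θ) p ∈ nilSpan A φ := by
  have hc : c ∈ Submodule.span A (Set.range φ) := hspan ▸ Submodule.mem_top
  induction hc using Submodule.span_induction with
  | mem x hx =>
    obtain ⟨g, rfl⟩ := hx
    obtain ⟨p, hp⟩ := hθ g
    refine ⟨p.map (algebraMap F A), ?_⟩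
    rw [aeval_map_eq hφ, ← map_sub]
    exact Submodule.subset_span ⟨_, hp, rfl⟩
  | zero => exact ⟨0, by simp⟩
  | add x y _ _ hx hy =>
    obtain ⟨p, hp⟩ := hx
    obtain ⟨q, hq⟩ := hy
    refine ⟨p + q, ?_⟩
    rw [map_add, add_sub_add_comm]
    exact Submodule.add_mem _ hp hq
  | smul a x _ hx =>
    obtain ⟨p, hp⟩ := hx
    refine ⟨a • p, ?_⟩
    rw [map_smul, ← smul_sub]
    exact Submodule.smul_mem _ a hp

/-! ### Projections to eigenspaces -/

theorem aeval_eq_of_eval_eq {S : Finset A} {t : C} (ht : aeval t (∏ ρ ∈ S, (X - Polynomial.C ρ)) = 0)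
    {g g' : A[X]} (h : ∀ ρ ∈ S, eval ρ g = eval ρ g') : aeval t g = aeval t g' := by
  rw [← sub_eq_zero, ← map_sub]
  have h1 : ∏ ρ ∈ S, (X - Polynomial.C ρ) ∣ g - g' := by
    refine Finset.prod_dvd_of_coprime (fun a _ b _ hab => isCoprime_X_sub_C_of_isUnit_sub ?_)
      fun ρ hρ => ?_
    · exact (sub_ne_zero.2 hab).isUnit
    · rw [dvd_iff_isRoot, IsRoot, eval_sub, h ρ hρ, sub_self]
  obtain ⟨k, hk⟩ := h1
  rw [hk, map_mul, ht, zero_mul]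

variable [DecidableEq A]

/-- The projection to the eigenspace of `t` for the eigenvalue `ρ`, if the roots of the minimal
polynomial of `t` are simple and belong to `S`. -/
noncomputable def eigenProj (t : C) (S : Finset A) (ρ : A) : C := aeval t (Lagrange.basis S id ρ)

theorem aeval_mul_eigenProj {S : Finset A} {t : C}
    (ht : aeval t (∏ ρ ∈ S, (X - Polynomial.C ρ)) = 0) (g : A[X]) {ρ : A} (hρ : ρ ∈ S) :
    aeval t g * eigenProj t S ρ = eval ρ g • eigenProj t S ρ := by
  rw [eigenProj, ← map_mul, ← map_smul]
  refine aeval_eq_of_eval_eq ht fun ρ' hρ' => ?_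
  rw [eval_mul, eval_smul, smul_eq_mul]
  by_cases hne : ρ = ρ'
  · rw [hne]
  · have := Lagrange.eval_basis_of_ne (v := (id : A → A)) hne hρ'
    rw [id] at this
    rw [this, mul_zero, mul_zero]

theorem eigenProj_mul_aeval {S : Finset A} {t : C}
    (ht : aeval t (∏ ρ ∈ S, (X - Polynomial.C ρ)) = 0) (g : A[X]) {ρ : A} (hρ : ρ ∈ S) :
    eigenProj t S ρ * aeval t g = eval ρ g • eigenProj t S ρ := by
  rw [← aeval_mul_eigenProj ht g hρ, eigenProj, ← map_mul, ← map_mul, mul_comm]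

theorem eval_eigenProj_self {S : Finset A} {ρ : A} (hρ : ρ ∈ S) :
    eval ρ (Lagrange.basis S id ρ) = 1 :=
  Lagrange.eval_basis_self (v := (id : A → A)) Function.injective_id.injOn hρ

theorem eigenProj_mul_self {S : Finset A} {t : C}
    (ht : aeval t (∏ ρ ∈ S, (X - Polynomial.C ρ)) = 0) {ρ : A} (hρ : ρ ∈ S) :
    IsIdempotentElem (eigenProj t S ρ) := by
  have := aeval_mul_eigenProj ht (Lagrange.basis S id ρ) hρ
  rw [eval_eigenProj_self hρ, one_smul] at this
  exact this

theorem sum_eigenProj {S : Finset A} {t : C}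
    (ht : aeval t (∏ ρ ∈ S, (X - Polynomial.C ρ)) = 0) : ∑ ρ ∈ S, eigenProj t S ρ = 1 := by
  simp only [eigenProj]
  rw [← map_sum, ← map_one (aeval (R := A) t)]
  refine aeval_eq_of_eval_eq ht fun ρ hρ => ?_
  rw [Lagrange.sum_basis Function.injective_id.injOn ⟨ρ, hρ⟩]

/-! ### Algebras with residue field the base field -/

/-- Every element of the algebra is the sum of a scalar and a nilpotent element. -/
def IsSplitLocal (F R : Type*) [Field F] [Ring R] [Algebra F R] : Prop :=
  ∀ g : R, ∃ c : F, IsNilpotent (g - algebraMap F R c)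

/-- The idempotent e is a scalar plus a nilpotent. It is nilpotent if the scalar is 0, and a unit
otherwise. -/
theorem IsSplitLocal.eq_zero_or_one (h : IsSplitLocal F R) (e : R) (he : IsIdempotentElem e) :
    e = 0 ∨ e = 1 := by
  obtain ⟨c, n, hn⟩ := h e
  by_cases hc : c = 0
  · left
    rw [hc, map_zero, sub_zero] at hn
    rw [← he.pow_succ_eq n, pow_succ, hn, zero_mul]
  · right
    have hcu : IsUnit (algebraMap F R c) := (isUnit_iff_ne_zero.2 hc).map _
    have hu : IsUnit (e - algebraMap F R c + algebraMap F R c) :=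
      IsNilpotent.isUnit_add_right_of_commute ⟨n, hn⟩ hcu (Algebra.commute_algebraMap_right c _)
    rw [sub_add_cancel] at hu
    exact hu.mul_left_cancel (by rw [he.eq, mul_one])

/-- The residue homomorphism of a finite local algebra whose residue field is the base field. -/
theorem IsSplitLocal.exists_algHom [Finite R] [Nontrivial R] (h : IsSplitLocal F R) :
    ∃ ε : R →ₐ[F] F, ∀ x, ε x = 0 ↔ IsNilpotent x := by
  obtain ⟨D, _, _, ρ, hρ, hker⟩ := exists_residueField h.eq_zero_or_one
  have hbij : Function.Bijective (ρ.comp (algebraMap F R)) := by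
    refine ⟨(ρ.comp (algebraMap F R)).injective, fun d => ?_⟩
    obtain ⟨x, rfl⟩ := hρ d
    obtain ⟨c, hc⟩ := h x
    refine ⟨c, ?_⟩
    rw [← hker, map_sub, sub_eq_zero] at hc
    exact hc.symm
  let E := RingEquiv.ofBijective _ hbij
  refine ⟨{ (E.symm : D →+* F).comp ρ with
    commutes' := fun c => E.symm_apply_apply c }, fun x => ?_⟩
  rw [← hker]
  exact map_eq_zero_iff E.symm E.symm.injective

end LocalAlgebra
end Hua

namespace Hua

set_option linter.unusedSectionVars false

open Finset Module CategoryTheory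

/-! ### Extension of scalars of morphisms -/

section BaseChange

variable {F : Type w} [Field F] {V : Type u} [Quiver.{v + 1} V] {M N P : QuiverRep F V}
  (A : Type w) [Field A] [Algebra F A]

/-- The extension of scalars of a morphism. -/
noncomputable def bcMap (f : M ⟶ N) : M.baseChange A ⟶ N.baseChange A :=
  homMk (fun i => (app f i).baseChange A) fun i j e x => by
    have h : (app f j).baseChange A ∘ₗ (M.map e).baseChange A =
        (N.map e).baseChange A ∘ₗ (app f i).baseChange A := by
      rw [← LinearMap.baseChange_comp, ← LinearMap.baseChange_comp]
      congr 1
      exact LinearMap.ext (app_map f e)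
    exact LinearMap.congr_fun h x

/-- The component of a morphism between extensions of scalars. -/
noncomputable def bcApp (φ : M.baseChange A ⟶ N.baseChange A) (i : V) : A ⊗[F] M.obj i →ₗ[A] A ⊗[F] N.obj i :=
  app φ i

theorem bcApp_sum {ι : Type*} (s : Finset ι) (f : ι → (M.baseChange A ⟶ N.baseChange A)) (i : V) :
    bcApp A (∑ t ∈ s, f t) i = ∑ t ∈ s, bcApp A (f t) i := app_sum s f i

theorem baseChange_hom_ext {f g : M.baseChange A ⟶ N.baseChange A}
    (h : ∀ i (x : M.obj i), app f i ((1 : A) ⊗ₜ[F] x) = app g i ((1 : A) ⊗ₜ[F] x)) : f = g := by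
  have h2 : ∀ i, bcApp A f i = bcApp A g i := fun i =>
    TensorProduct.AlgebraTensorModule.curry_injective
      (LinearMap.ext_ring (LinearMap.ext fun x => h i x))
  exact rep_hom_ext fun i x => LinearMap.congr_fun (h2 i) x

theorem bcMap_comp (f : M ⟶ N) (g : N ⟶ P) : bcMap A (f ≫ g) = bcMap A f ≫ bcMap A g :=
  baseChange_hom_ext A fun _ _ => rfl

theorem bcMap_id : bcMap A (𝟙 M) = 𝟙 _ := baseChange_hom_ext A fun _ _ => rfl

theorem bcMap_add (f g : M ⟶ N) : bcMap A (f + g) = bcMap A f + bcMap A g :=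
  baseChange_hom_ext A fun i x => TensorProduct.tmul_add _ _ _

theorem bcMap_zero : bcMap A (0 : M ⟶ N) = 0 :=
  baseChange_hom_ext A fun i x => TensorProduct.tmul_zero _ _

theorem bcMap_sum {ι : Type*} (s : Finset ι) (f : ι → (M ⟶ N)) :
    bcMap A (∑ t ∈ s, f t) = ∑ t ∈ s, bcMap A (f t) := by
  classical
  induction s using Finset.induction_on with
  | empty => simp [bcMap_zero]
  | insert t s ht ih => rw [Finset.sum_insert ht, Finset.sum_insert ht, bcMap_add, ih]

variable (M) in
/-- The extension of scalars on endomorphism rings. -/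
noncomputable def bcHom : CategoryTheory.End M →+* CategoryTheory.End (M.baseChange A) where
  toFun f := bcMap A f
  map_one' := bcMap_id A
  map_mul' f g := bcMap_comp A g f
  map_zero' := bcMap_zero A
  map_add' f g := bcMap_add A f g

theorem bcHom_algebraMap (c : F) : bcHom M A (algebraMap F _ c) =
    algebraMap A _ (algebraMap F A c) := by
  refine baseChange_hom_ext A fun i x => ?_
  change (1 : A) ⊗ₜ[F] (c • x) = (algebraMap F A c) • ((1 : A) ⊗ₜ[F] x)
  rw [TensorProduct.tmul_smul, algebraMap_smul]

theorem one_tmul_injective (W : Type*) [AddCommGroup W] [Module F W] :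
    Function.Injective fun x : W => (1 : A) ⊗ₜ[F] x :=
  Module.FaithfullyFlat.tensorProduct_mk_injective W

theorem bcMap_injective : Function.Injective (bcMap A : (M ⟶ N) → _) := by
  intro f g h
  refine rep_hom_ext fun i x => one_tmul_injective (F := F) A (N.obj i) ?_
  exact LinearMap.congr_fun (congrArg (app · i) h) ((1 : A) ⊗ₜ[F] x)

theorem baseChange_hasDim {α : V →₀ ℕ} (hM : M.HasDim α) : (M.baseChange A).HasDim α := fun i => by
  have := (hM i).1
  exact ⟨inferInstanceAs (Module.Finite A (A ⊗[F] M.obj i)),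
    (Module.finrank_baseChange (R := A) (S := F)).trans (hM i).2⟩

/-- Expand φ(1 ⊗ x) in a basis of A over F: the coordinates are morphisms M → N. Only finitely many
are nonzero since M is finite dimensional, although A may have infinite degree. -/
theorem mem_span_range_bcMap [Finite V] {α : V →₀ ℕ} (hM : M.HasDim α)
    (φ : M.baseChange A ⟶ N.baseChange A) : φ ∈ Submodule.span A (Set.range (bcMap A (M := M) (N := N))) := by
  classical
  have := Fintype.ofFinite V
  let b := Basis.ofVectorSpace F A
  let E := fun i => TensorProduct.equivFinsuppOfBasisLeft (N := N.obj i) b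
  have hmap : ∀ i j (e : i ⟶ j) t (y : A ⊗[F] N.obj i),
      E j ((N.map e).baseChange A y) t = N.map e (E i y t) := by
    intro i j e t y
    induction y with
    | zero => simp
    | add x y hx hy => rw [map_add, map_add, map_add, Finsupp.add_apply, hx, hy, Finsupp.add_apply, map_add]
    | tmul a x =>
      rw [LinearMap.baseChange_tmul, TensorProduct.equivFinsuppOfBasisLeft_apply_tmul_apply,
        TensorProduct.equivFinsuppOfBasisLeft_apply_tmul_apply, map_smul]
  let g : ∀ i, M.obj i →ₗ[F] A ⊗[F] N.obj i := fun i =>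
    (bcApp A φ i).restrictScalars F ∘ₗ TensorProduct.mk F A (M.obj i) 1
  have hg : ∀ i x, g i x = bcApp A φ i ((1 : A) ⊗ₜ[F] x) := fun _ _ => rfl
  let f : Basis.ofVectorSpaceIndex F A → (M ⟶ N) := fun t =>
    homMk (fun i => Finsupp.lapply t ∘ₗ (E i).toLinearMap ∘ₗ g i) fun i j e x => by
      change E j (g j (M.map e x)) t = N.map e (E i (g i x) t)
      rw [← hmap, hg, hg]
      congr 2
      exact app_map φ e ((1 : A) ⊗ₜ[F] x)
  have hf : ∀ t i x, app (f t) i x = E i (g i x) t := fun _ _ _ => rfl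
  have hS : ∀ i, ∃ S : Finset (Basis.ofVectorSpaceIndex F A), ∀ t ∉ S, ∀ x, app (f t) i x = 0 := by
    intro i
    have := (hM i).1
    let c := Module.finBasis F (M.obj i)
    refine ⟨Finset.univ.biUnion fun k => (E i (g i (c k))).support, fun t ht => ?_⟩
    have h0 : app (f t) i = 0 := c.ext fun k => by
      rw [hf, LinearMap.zero_apply]
      by_contra hne
      exact ht (Finset.mem_biUnion.2 ⟨k, Finset.mem_univ _, Finsupp.mem_support_iff.2 hne⟩)
    exact fun x => LinearMap.congr_fun h0 x
  choose S hS using hS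
  have hφ : φ = ∑ t ∈ Finset.univ.biUnion S, b t • bcMap A (f t) := by
    refine baseChange_hom_ext A fun i x => ?_
    change g i x = bcApp A (∑ t ∈ Finset.univ.biUnion S, b t • bcMap A (f t)) i ((1 : A) ⊗ₜ[F] x)
    rw [bcApp_sum, LinearMap.sum_apply]
    conv_lhs => rw [← (E i).symm_apply_apply (g i x),
      TensorProduct.equivFinsuppOfBasisLeft_symm_apply]
    rw [Finsupp.sum_of_support_subset (s := Finset.univ.biUnion S)]
    · refine Finset.sum_congr rfl fun t _ => ?_
      change _ = b t • ((1 : A) ⊗ₜ[F] app (f t) i x)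
      rw [TensorProduct.smul_tmul', smul_eq_mul, mul_one]
      rfl
    · intro t ht
      by_contra hn
      rw [Finsupp.mem_support_iff] at ht
      refine ht (hS i t (fun h => hn ?_) x)
      exact Finset.mem_biUnion.2 ⟨i, Finset.mem_univ _, h⟩
    · simp
  rw [hφ]
  exact Submodule.sum_mem _ fun t _ => Submodule.smul_mem _ _ (Submodule.subset_span ⟨f t, rfl⟩)

theorem span_range_bcHom [Finite V] {α : V →₀ ℕ} (hM : M.HasDim α) :
    Submodule.span A (Set.range (bcHom M A)) = ⊤ :=
  eq_top_iff.2 fun φ _ => mem_span_range_bcMap A hM φ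

end BaseChange
end Hua

namespace Hua

set_option linter.unusedSectionVars false

open Finset Module CategoryTheory

/-! ### Absolutely indecomposable representations -/

section Absolute

open Polynomial

variable {F : Type w} [Field F] {V : Type u} [Quiver.{v + 1} V] {M N : QuiverRep F V}
  {A : Type w} [Field A] [Algebra F A]

/-- The endomorphism `θ` is a root of the irreducible polynomial `f` and generates the endomorphism
ring up to nilpotent endomorphisms. -/
structure RootData (M : QuiverRep F V) (f : F[X]) (θ : CategoryTheory.End M) : Prop where
  monic : f.Monic
  irreducible : Irreducible f
  aeval_eq_zero : aeval θ f = 0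
  exists_aeval : ∀ g, ∃ p : F[X], IsNilpotent (g - aeval θ p)

theorem exists_rootData [Finite F] [Finite V] (h : M.IsIndecomposable)
    {α : V →₀ ℕ} (hM : M.HasDim α) :
    ∃ f θ, RootData M f θ ∧ resCard M = Nat.card F ^ f.natDegree := by
  have h1 := isIndecomposable_iff.1 h
  have := h1.1
  have hfin : Finite (CategoryTheory.End M) := finite_hom hM hM
  obtain ⟨f, θ, hf, hirr, h0, hg, D, _, ρ, hρ, hker, hD⟩ := exists_root_generating (F := F) h1.2
  exact ⟨f, θ, ⟨hf, hirr, h0, hg⟩, (resCard_eq ρ hρ hker).trans hD⟩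

theorem prod_aroots [Finite F] [DecidableEq A] {f : F[X]} (hf : f.Monic) (hirr : Irreducible f)
    (hs : (f.map (algebraMap F A)).Splits) :
    ∏ ρ ∈ (f.aroots A).toFinset, (X - Polynomial.C ρ) = f.map (algebraMap F A) := by
  have hnd : (f.aroots A).Nodup := nodup_roots (PerfectField.separable_of_irreducible hirr).map
  rw [hs.eq_prod_roots_of_monic (hf.map _), Finset.prod, Multiset.toFinset_val, hnd.dedup]

theorem RootData.aeval_prod_eq_zero [Finite F] [DecidableEq A] {f : F[X]} {θ : CategoryTheory.End M}
    (h : RootData M f θ) (hs : (f.map (algebraMap F A)).Splits) :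
    aeval (bcHom M A θ) (∏ ρ ∈ (f.aroots A).toFinset, (X - Polynomial.C ρ)) = 0 := by
  rw [prod_aroots h.monic h.irreducible hs, aeval_map_eq (bcHom_algebraMap A), h.aeval_eq_zero,
    map_zero]

theorem IsSplitLocal.baseChange [Finite F] [Finite V] {α : V →₀ ℕ} (hM : M.HasDim α)
    (h : IsSplitLocal F (CategoryTheory.End M)) (A : Type w) [Field A] [Algebra F A] :
    IsSplitLocal A (CategoryTheory.End (M.baseChange A)) := by
  have hfin : Finite (CategoryTheory.End M) := finite_hom hM hM
  intro g
  -- With generator 0, polynomials in it are the scalars.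
  obtain ⟨p, hp⟩ := exists_aeval_sub_mem (bcHom_algebraMap A) (span_range_bcHom A hM) (θ := 0)
    (fun g => by
      obtain ⟨c, hc⟩ := h g
      exact ⟨Polynomial.C c, by rwa [aeval_C]⟩) g
  refine ⟨p.coeff 0, ?_⟩
  rw [map_zero, ← coeff_zero_eq_aeval_zero'] at hp
  exact isNilpotent_of_mem_nilSpan h.eq_zero_or_one hp

/-- Over the algebraic closure the eigenprojections of θ sum to 1, so if M stays indecomposable one
of them is 1 and θ becomes a scalar. As θ generates End M modulo nilpotents, the residue field is F.
The converse is `IsSplitLocal.baseChange`. -/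
theorem isAbsolutelyIndecomposable_iff [Finite F] [Finite V] {α : V →₀ ℕ} (hM : M.HasDim α) :
    M.IsAbsolutelyIndecomposable ↔
      Nontrivial (CategoryTheory.End M) ∧ IsSplitLocal F (CategoryTheory.End M) := by
  classical
  rw [QuiverRep.IsAbsolutelyIndecomposable, isIndecomposable_iff]
  set L := AlgebraicClosure F
  have hinj : Function.Injective (bcHom M L) := bcMap_injective L
  constructor
  · rintro ⟨hnt, hidem⟩
    have hnt' : Nontrivial (CategoryTheory.End M) := (bcHom M L).domain_nontrivial
    have hind : M.IsIndecomposable := by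
      refine isIndecomposable_iff.2 ⟨hnt', fun e he => ?_⟩
      rcases hidem _ (he.map (bcHom M L)) with h0 | h0
      · exact Or.inl (hinj (h0.trans (map_zero _).symm))
      · exact Or.inr (hinj (h0.trans (map_one _).symm))
    refine ⟨hnt', ?_⟩
    obtain ⟨f, θ, hd, -⟩ := exists_rootData hind hM
    have ht := hd.aeval_prod_eq_zero (A := L) (IsAlgClosed.splits _)
    obtain ⟨ρ, hρ, hP⟩ : ∃ ρ ∈ (f.aroots L).toFinset,
        eigenProj (bcHom M L θ) (f.aroots L).toFinset ρ = 1 := by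
      by_contra! hne
      have := sum_eigenProj ht
      rw [Finset.sum_eq_zero fun ρ hρ => (hidem _ (eigenProj_mul_self ht hρ)).resolve_right
        (hne ρ hρ)] at this
      exact zero_ne_one this
    have hθ := aeval_mul_eigenProj ht X hρ
    rw [hP, mul_one, eval_X, aeval_X] at hθ
    -- Applying an F-linear retraction L → F to 1 ⊗ θ(x) = ρ ⊗ x shows that θ is the scalar l(ρ)
    -- over F itself.
    obtain ⟨l, hl⟩ := (Algebra.linearMap F L).exists_leftInverse_of_injective
      (LinearMap.ker_eq_bot.2 (algebraMap F L).injective)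
    have hl1 : l 1 = 1 := by
      have := LinearMap.congr_fun hl 1
      simpa using this
    have hθs : θ = algebraMap F _ (l ρ) := by
      refine rep_hom_ext fun i x => ?_
      have h1 : (1 : L) ⊗ₜ[F] app θ i x = ρ • ((1 : L) ⊗ₜ[F] x) :=
        LinearMap.congr_fun (congrArg (bcApp L · i) hθ) ((1 : L) ⊗ₜ[F] x)
      have h2 := congrArg (fun y => TensorProduct.lid F (M.obj i) (l.rTensor (M.obj i) y)) h1
      simp only [TensorProduct.smul_tmul', smul_eq_mul, mul_one, LinearMap.rTensor_tmul,
        TensorProduct.lid_tmul, hl1, one_smul] at h2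
      exact h2
    intro g
    obtain ⟨p, hp⟩ := hd.exists_aeval g
    rw [hθs, aeval_algebraMap_apply] at hp
    exact ⟨_, hp⟩
  · rintro ⟨hnt, hs⟩
    exact ⟨hinj.nontrivial, (hs.baseChange hM L).eq_zero_or_one⟩

/-! ### The summands of the extension of scalars -/

open Classical in
/-- The eigenspace of `θ` for the eigenvalue `ρ`, as a summand of the extension of scalars. -/
noncomputable def eigenRep (A : Type w) [Field A] [Algebra F A] (f : F[X]) (θ : CategoryTheory.End M)
    (ρ : A) : QuiverRep A V :=
  imageRep (eigenProj (bcHom M A θ) (f.aroots A).toFinset ρ)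

open Classical in
/-- The inclusion of the eigenspace of `θ`. -/
noncomputable def eigenIncl (A : Type w) [Field A] [Algebra F A] (f : F[X])
    (θ : CategoryTheory.End M) (ρ : A) : eigenRep A f θ ρ ⟶ M.baseChange A :=
  imageIncl (eigenProj (bcHom M A θ) (f.aroots A).toFinset ρ)

open Classical in
/-- The projection to the eigenspace of `θ`. -/
noncomputable def eigenRetr (A : Type w) [Field A] [Algebra F A] (f : F[X])
    (θ : CategoryTheory.End M) (ρ : A) : M.baseChange A ⟶ eigenRep A f θ ρ :=
  imageProj (eigenProj (bcHom M A θ) (f.aroots A).toFinset ρ)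

theorem isNilpotent_comp_comm {C : Type*} [Category C] [Preadditive C] {X Y : C} (a : X ⟶ Y)
    (b : Y ⟶ X) (h : IsNilpotent (CategoryTheory.End.of (a ≫ b))) :
    IsNilpotent (CategoryTheory.End.of (b ≫ a)) := by
  obtain ⟨n, hn⟩ := h
  have h1 : ∀ n : ℕ, ((CategoryTheory.End.of (b ≫ a)) ^ (n + 1)).asHom =
      b ≫ ((CategoryTheory.End.of (a ≫ b)) ^ n).asHom ≫ a := by
    intro n
    induction n with
    | zero =>
      rw [zero_add, pow_one, pow_zero]
      exact congrArg (b ≫ ·) (Category.id_comp a).symm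
    | succ n ih =>
      rw [pow_succ (CategoryTheory.End.of (a ≫ b)), pow_succ]
      change (b ≫ a) ≫ ((CategoryTheory.End.of (b ≫ a)) ^ (n + 1)).asHom =
        b ≫ ((a ≫ b) ≫ ((CategoryTheory.End.of (a ≫ b)) ^ n).asHom) ≫ a
      rw [ih]
      simp only [Category.assoc]
  refine ⟨n + 1, ?_⟩
  have h2 := h1 n
  rw [hn] at h2
  refine h2.trans ?_
  change b ≫ (0 : X ⟶ X) ≫ a = 0
  rw [Limits.zero_comp, Limits.comp_zero]

/-- Rotating the composition to x ≫ p ≫ s puts it into the nilpotent ideal; rotation preserves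
nilpotency. -/
theorem isNilpotent_comp_of_mem_nilSpan [Finite (CategoryTheory.End M)]
    (h : ∀ e : CategoryTheory.End M, IsIdempotentElem e → e = 0 ∨ e = 1)
    (hspan : Submodule.span A (Set.range (bcHom M A)) = ⊤)
    {x : CategoryTheory.End (M.baseChange A)} (hx : x ∈ nilSpan A (bcHom M A))
    {N : QuiverRep A V} (s : N ⟶ M.baseChange A) (p : M.baseChange A ⟶ N) :
    IsNilpotent (CategoryTheory.End.of (s ≫ x.asHom ≫ p)) := by
  rw [← Category.assoc]
  refine isNilpotent_comp_comm p (s ≫ x.asHom) ?_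
  rw [← Category.assoc]
  exact isNilpotent_of_mem_nilSpan h
    (mul_mem_nilSpan h hspan hx (CategoryTheory.End.of (p ≫ s))).2

variable [Finite F] [Finite V] {α : V →₀ ℕ} {f : F[X]} {θ : CategoryTheory.End M}

theorem RootData.eigenIncl_retr (h : RootData M f θ) (hs : (f.map (algebraMap F A)).Splits) {ρ : A}
    (hρ : ρ ∈ f.aroots A) : eigenIncl A f θ ρ ≫ eigenRetr A f θ ρ = 𝟙 _ := by
  classical
  exact imageIncl_proj (eigenProj_mul_self (h.aeval_prod_eq_zero hs) (Multiset.mem_toFinset.2 hρ))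

theorem RootData.aeval_comp_retr (h : RootData M f θ) (hs : (f.map (algebraMap F A)).Splits) {ρ : A}
    (hρ : ρ ∈ f.aroots A) (r : A[X]) : (aeval (bcHom M A θ) r).asHom ≫ eigenRetr A f θ ρ =
      eval ρ r • eigenRetr A f θ ρ := by
  classical
  have h1 : (aeval (bcHom M A θ) r).asHom ≫ eigenRetr A f θ ρ ≫ eigenIncl A f θ ρ =
      eval ρ r • (eigenRetr A f θ ρ ≫ eigenIncl A f θ ρ) :=
    eigenProj_mul_aeval (h.aeval_prod_eq_zero hs) r (Multiset.mem_toFinset.2 hρ)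
  have h2 : eigenRetr A f θ ρ = (eigenRetr A f θ ρ ≫ eigenIncl A f θ ρ) ≫ eigenRetr A f θ ρ := by
    rw [Category.assoc, h.eigenIncl_retr hs hρ, Category.comp_id]
  rw [h2, ← Category.assoc, h1, Linear.smul_comp]

theorem RootData.eigenIncl_retr_of_ne (h : RootData M f θ) (hs : (f.map (algebraMap F A)).Splits)
    {ρ ρ' : A} (hρ : ρ ∈ f.aroots A) (hρ' : ρ' ∈ f.aroots A) (hne : ρ ≠ ρ') :
    eigenIncl A f θ ρ ≫ eigenRetr A f θ ρ' = 0 := by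
  classical
  have hPP := h.eigenIncl_retr hs hρ
  have h1 : (eigenRetr A f θ ρ ≫ eigenIncl A f θ ρ) ≫ eigenRetr A f θ ρ' =
      eval ρ' (Lagrange.basis (f.aroots A).toFinset id ρ) • eigenRetr A f θ ρ' :=
    h.aeval_comp_retr hs hρ' _
  have h2 := Lagrange.eval_basis_of_ne (v := (id : A → A)) hne (Multiset.mem_toFinset.2 hρ')
  rw [id] at h2
  rw [h2, zero_smul, Category.assoc] at h1
  rw [← Category.id_comp (eigenIncl A f θ ρ), ← hPP, Category.assoc, Category.assoc, h1,
    Limits.comp_zero]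

/-- An endomorphism of the eigenspace, extended by 0, is a polynomial r in θ modulo the nilpotent
ideal, and r(θ) acts on the eigenspace as the scalar r(ρ). -/
theorem RootData.isSplitLocal_eigenRep (h : RootData M f θ) (hM : M.HasDim α)
    (hind : M.IsIndecomposable) (hs : (f.map (algebraMap F A)).Splits) {ρ : A}
    (hρ : ρ ∈ f.aroots A) : IsSplitLocal A (CategoryTheory.End (eigenRep A f θ ρ)) := by
  have hfin : Finite (CategoryTheory.End M) := finite_hom hM hM
  have hspan := span_range_bcHom A hM
  have hPP := h.eigenIncl_retr hs hρ
  intro g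
  obtain ⟨r, hr⟩ := exists_aeval_sub_mem (bcHom_algebraMap A) hspan h.exists_aeval
    (CategoryTheory.End.of (eigenRetr A f θ ρ ≫ g.asHom ≫ eigenIncl A f θ ρ))
  refine ⟨eval ρ r, ?_⟩
  have h5 : g - algebraMap A _ (eval ρ r) = CategoryTheory.End.of (eigenIncl A f θ ρ ≫
      (CategoryTheory.End.of (eigenRetr A f θ ρ ≫ g.asHom ≫ eigenIncl A f θ ρ) -
        aeval (bcHom M A θ) r).asHom ≫ eigenRetr A f θ ρ) := by
    change g.asHom - eval ρ r • 𝟙 _ = eigenIncl A f θ ρ ≫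
      ((eigenRetr A f θ ρ ≫ g.asHom ≫ eigenIncl A f θ ρ) - (aeval (bcHom M A θ) r).asHom) ≫
        eigenRetr A f θ ρ
    rw [Preadditive.sub_comp, h.aeval_comp_retr hs hρ, Preadditive.comp_sub, Linear.comp_smul, hPP,
      Category.assoc, Category.assoc, hPP, Category.comp_id, ← Category.assoc, hPP,
      Category.id_comp]
  rw [h5]
  exact isNilpotent_comp_of_mem_nilSpan (isIndecomposable_iff.1 hind).2 hspan hr _ _

/-- A factorization of the identity of a nonzero object through an element of the ideal spanned by
the nilpotent endomorphisms is impossible. -/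
theorem subsingleton_of_mem_nilSpan [Finite (CategoryTheory.End M)]
    (h : ∀ e : CategoryTheory.End M, IsIdempotentElem e → e = 0 ∨ e = 1)
    (hspan : Submodule.span A (Set.range (bcHom M A)) = ⊤)
    {x : CategoryTheory.End (M.baseChange A)} (hx : x ∈ nilSpan A (bcHom M A))
    {N : QuiverRep A V} {s : N ⟶ M.baseChange A} {p : M.baseChange A ⟶ N}
    (hsp : s ≫ x.asHom ≫ p = 𝟙 N) : ¬ Nontrivial (CategoryTheory.End N) := by
  intro hn
  have h1 := isNilpotent_comp_of_mem_nilSpan h hspan hx s p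
  rw [hsp] at h1
  exact not_isNilpotent_one h1

/-- A polynomial in θ has no component between different eigenspaces, so an isomorphism between them
would come from the nilpotent ideal. -/
theorem RootData.eq_of_iso (h : RootData M f θ) (hM : M.HasDim α)
    (hind : M.IsIndecomposable) (hs : (f.map (algebraMap F A)).Splits) {ρ ρ' : A}
    (hρ : ρ ∈ f.aroots A) (hρ' : ρ' ∈ f.aroots A)
    (hnt : Nontrivial (CategoryTheory.End (eigenRep A f θ ρ)))
    (e : eigenRep A f θ ρ ≅ eigenRep A f θ ρ') : ρ = ρ' := by
  by_contra hne
  have hfin : Finite (CategoryTheory.End M) := finite_hom hM hM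
  have hspan := span_range_bcHom A hM
  have hloc := (isIndecomposable_iff.1 hind).2
  have hPP := h.eigenIncl_retr hs hρ
  have hPP' := h.eigenIncl_retr hs hρ'
  obtain ⟨r, hr⟩ := exists_aeval_sub_mem (bcHom_algebraMap A) hspan h.exists_aeval
    (CategoryTheory.End.of (eigenRetr A f θ ρ ≫ e.hom ≫ eigenIncl A f θ ρ'))
  refine subsingleton_of_mem_nilSpan hloc hspan hr (s := eigenIncl A f θ ρ)
    (p := eigenRetr A f θ ρ' ≫ e.inv) ?_ hnt
  have h0 := h.eigenIncl_retr_of_ne hs hρ hρ' hne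
  change eigenIncl A f θ ρ ≫ ((eigenRetr A f θ ρ ≫ e.hom ≫ eigenIncl A f θ ρ') -
    (aeval (bcHom M A θ) r).asHom) ≫ eigenRetr A f θ ρ' ≫ e.inv = 𝟙 _
  rw [← Category.assoc (_ - _), Preadditive.sub_comp, h.aeval_comp_retr hs hρ', Preadditive.sub_comp,
    Preadditive.comp_sub, Linear.smul_comp, Linear.comp_smul, ← Category.assoc (eigenIncl A f θ ρ)
    (eigenRetr A f θ ρ'), h0, Limits.zero_comp, smul_zero, sub_zero, Category.assoc, Category.assoc,
    Category.assoc, ← Category.assoc (eigenIncl A f θ ρ'), hPP', Category.id_comp, e.hom_inv_id,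
    Category.comp_id, hPP]

end Absolute
end Hua

namespace Hua

set_option linter.unusedSectionVars false

open Finset Module CategoryTheory

/-! ### Comparison of eigenspaces and their dimensions -/

section Galois

open Polynomial

variable {F : Type w} [Field F] [Finite F] {V : Type u} [Quiver.{v + 1} V] [Finite V]
  {M M' : QuiverRep F V} {A : Type w} [Field A] [Algebra F A] {α α' : V →₀ ℕ} {f f' : F[X]}
  {θ : CategoryTheory.End M} {θ' : CategoryTheory.End M'}

theorem comp_mem_nilSpan (hM : M.HasDim α) (hM' : M'.HasDim α')
    (h : ∀ (f : M ⟶ M') (g : M' ⟶ M), IsNilpotent (CategoryTheory.End.of (f ≫ g)))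
    (a : M.baseChange A ⟶ M'.baseChange A) (b : M'.baseChange A ⟶ M.baseChange A) :
    CategoryTheory.End.of (a ≫ b) ∈ nilSpan A (bcHom M A) := by
  have ha := mem_span_range_bcMap A hM a
  have hb := mem_span_range_bcMap A hM' b
  induction ha using Submodule.span_induction with
  | zero =>
    have : (0 : M.baseChange A ⟶ M'.baseChange A) ≫ b = 0 := Limits.zero_comp
    rw [this]
    exact Submodule.zero_mem _
  | add x y _ _ hx hy =>
    rw [Preadditive.add_comp]
    exact Submodule.add_mem _ hx hy
  | smul c x _ hx =>
    rw [Linear.smul_comp]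
    exact Submodule.smul_mem _ c hx
  | mem x hx =>
    obtain ⟨x, rfl⟩ := hx
    induction hb using Submodule.span_induction with
    | zero =>
      have : bcMap A x ≫ (0 : M'.baseChange A ⟶ M.baseChange A) = 0 := Limits.comp_zero
      rw [this]
      exact Submodule.zero_mem _
    | add y z _ _ hy hz =>
      rw [Preadditive.comp_add]
      exact Submodule.add_mem _ hy hz
    | smul c y _ hy =>
      rw [Linear.comp_smul]
      exact Submodule.smul_mem _ c hy
    | mem y hy =>
      obtain ⟨y, rfl⟩ := hy
      exact Submodule.subset_span ⟨CategoryTheory.End.of (x ≫ y), h x y, bcMap_comp A x y⟩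

/-- Eigenspaces for non-isomorphic indecomposable representations are not isomorphic. -/
theorem RootData.nonempty_iso_of_iso (h : RootData M f θ) (h' : RootData M' f' θ')
    (hM : M.HasDim α) (hM' : M'.HasDim α') (hind : M.IsIndecomposable)
    (hind' : M'.IsIndecomposable) (hs : (f.map (algebraMap F A)).Splits)
    (hs' : (f'.map (algebraMap F A)).Splits) {ρ ρ' : A} (hρ : ρ ∈ f.aroots A)
    (hρ' : ρ' ∈ f'.aroots A) (hnt : Nontrivial (CategoryTheory.End (eigenRep A f θ ρ)))
    (e : eigenRep A f θ ρ ≅ eigenRep A f' θ' ρ') : Nonempty (M ≅ M') := by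
  by_contra hne
  have hfin : Finite (CategoryTheory.End M) := finite_hom hM hM
  have hi := isIndecomposable_iff.1 hind
  have hnil : ∀ (f : M ⟶ M') (g : M' ⟶ M), IsNilpotent (CategoryTheory.End.of (f ≫ g)) := by
    intro f g
    refine (isUnit_or_isNilpotent_of_finite hi.2 _).resolve_left fun hu => hne ?_
    obtain ⟨w, hw, -⟩ := isUnit_iff_exists.1 hu
    exact isIso_of_retract hind' hi.1 (w.asHom ≫ f) g ((Category.assoc _ _ _).trans hw)
  refine subsingleton_of_mem_nilSpan hi.2 (span_range_bcHom A hM) (comp_mem_nilSpan hM hM' hnil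
    (eigenRetr A f θ ρ ≫ e.hom ≫ eigenIncl A f' θ' ρ')
    (eigenRetr A f' θ' ρ' ≫ e.inv ≫ eigenIncl A f θ ρ)) (s := eigenIncl A f θ ρ)
    (p := eigenRetr A f θ ρ) ?_ hnt
  have hPP := h.eigenIncl_retr hs hρ
  have hPP' := h'.eigenIncl_retr hs' hρ'
  change eigenIncl A f θ ρ ≫ ((eigenRetr A f θ ρ ≫ e.hom ≫ eigenIncl A f' θ' ρ') ≫
    (eigenRetr A f' θ' ρ' ≫ e.inv ≫ eigenIncl A f θ ρ)) ≫ eigenRetr A f θ ρ = 𝟙 _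
  simp only [Category.assoc]
  rw [hPP, Category.comp_id, ← Category.assoc (eigenIncl A f' θ' ρ'), hPP', Category.id_comp,
    e.hom_inv_id, Category.comp_id, hPP]

/-! ### Dimensions of the eigenspaces -/

/-- The decomposition of an object into retracts. -/
def Decomposition.ofRetracts {C : Type*} [Category C] [Preadditive C] {J : Type*} [Fintype J]
    [DecidableEq J] {X : J → C} {M : C} (i : ∀ j, X j ⟶ M) (p : ∀ j, M ⟶ X j)
    (h₁ : ∀ j, i j ≫ p j = 𝟙 _) (h₂ : ∀ j k, j ≠ k → i j ≫ p k = 0)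
    (h₃ : ∑ j, p j ≫ i j = 𝟙 M) : Decomposition X (fun _ => 1) M where
  i j _ := i j
  p j _ := p j
  i_p j a b := by rw [if_pos (Subsingleton.elim a b), h₁]
  i_p_ne j k _ _ hjk := h₂ j k hjk
  total := by
    rw [Fintype.sum_sigma, ← h₃]
    simp

theorem mem_eigenRep_iff [DecidableEq A] (h : RootData M f θ) (hs : (f.map (algebraMap F A)).Splits)
    {ρ : A} (hρ : ρ ∈ f.aroots A) (i : V) (x : A ⊗[F] M.obj i) :
    x ∈ LinearMap.range (bcApp A (eigenProj (bcHom M A θ) (f.aroots A).toFinset ρ).asHom i) ↔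
      (app θ i).baseChange A x = ρ • x := by
  have ht := h.aeval_prod_eq_zero hs
  have hρ' := Multiset.mem_toFinset.2 hρ
  constructor
  · rintro ⟨y, rfl⟩
    have h1 := aeval_mul_eigenProj ht X hρ'
    rw [aeval_X, eval_X] at h1
    exact LinearMap.congr_fun (congrArg (bcApp A · i) h1) y
  · intro hx
    refine ⟨x, ?_⟩
    have h1 : bcApp A (eigenProj (bcHom M A θ) (f.aroots A).toFinset ρ).asHom i =
        aeval ((app θ i).baseChange A) (Lagrange.basis (f.aroots A).toFinset id ρ) :=
      (Polynomial.aeval_algHom_apply (appHom (M.baseChange A) i) (bcHom M A θ) _).symm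
    rw [h1]
    by_cases hx0 : x = 0
    · rw [hx0, map_zero]
    · have := Module.End.aeval_apply_of_hasEigenvector (p := Lagrange.basis (f.aroots A).toFinset id ρ)
        (Module.End.hasEigenvector_iff.2 ⟨Module.End.mem_eigenspace_iff.2 hx, hx0⟩)
      rw [this, eval_eigenProj_self hρ', one_smul]

/-- An automorphism σ of A over F with σ(ρ) = ρ' induces σ ⊗ id, which carries one eigenspace to the
other. It is only semilinear over A, so cardinalities are compared first. -/
theorem RootData.finrank_eigenRep_eq [Finite A] (h : RootData M f θ) (hM : M.HasDim α)
    (hs : (f.map (algebraMap F A)).Splits) {ρ ρ' : A} (hρ : ρ ∈ f.aroots A)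
    (hρ' : ρ' ∈ f.aroots A) (i : V) : finrank A ((eigenRep A f θ ρ).obj i) =
      finrank A ((eigenRep A f θ ρ').obj i) := by
  classical
  have hmin : minpoly F ρ' = f :=
    (minpoly.eq_of_irreducible_of_monic h.irreducible (mem_aroots.1 hρ').2 h.monic).symm
  obtain ⟨σ, hσ⟩ := minpoly.exists_algEquiv_of_root (K := F) (x := ρ) (y := ρ')
    (Algebra.IsAlgebraic.isAlgebraic ρ') (by rw [hmin]; exact (mem_aroots.1 hρ).2)
  have := (hM i).1
  let τ : A ⊗[F] M.obj i ≃ₗ[F] A ⊗[F] M.obj i :=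
    TensorProduct.congr σ.toLinearEquiv (LinearEquiv.refl F (M.obj i))
  have hτθ : ∀ x, τ ((app θ i).baseChange A x) = (app θ i).baseChange A (τ x) := by
    intro x
    induction x with
    | zero => simp
    | add x y hx hy => simp only [map_add, hx, hy]
    | tmul a x => rfl
  have hτs : ∀ (a : A) x, τ (a • x) = σ a • τ x := by
    intro a x
    induction x with
    | zero => simp
    | add x y hx hy => simp only [smul_add, map_add, hx, hy]
    | tmul b x =>
      change (σ (a * b)) ⊗ₜ[F] x = σ a • ((σ b) ⊗ₜ[F] x)
      rw [map_mul, TensorProduct.smul_tmul', smul_eq_mul]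
  have hcard : Nat.card ((eigenRep A f θ ρ).obj i) = Nat.card ((eigenRep A f θ ρ').obj i) := by
    refine Nat.card_congr (τ.toEquiv.subtypeEquiv fun x => ?_)
    refine (mem_eigenRep_iff h hs hρ i x).trans (Iff.trans ?_ (mem_eigenRep_iff h hs hρ' i (τ x)).symm)
    rw [← hσ, ← hτθ, ← hτs]
    exact τ.injective.eq_iff.symm
  have hfin : ∀ ρ, Module.Finite A ((eigenRep A f θ ρ).obj i) := fun ρ =>
    inferInstanceAs (Module.Finite A (LinearMap.range
      (bcApp A (eigenProj (bcHom M A θ) (f.aroots A).toFinset ρ).asHom i)))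
  have := hfin ρ
  have := hfin ρ'
  rw [Module.natCard_eq_pow_finrank (K := A) (V := (eigenRep A f θ ρ).obj i),
    Module.natCard_eq_pow_finrank (K := A) (V := (eigenRep A f θ ρ').obj i)] at hcard
  exact Nat.pow_right_injective (Finite.one_lt_card (α := A)) hcard

theorem RootData.card_aroots (h : RootData M f θ) [DecidableEq A]
    (hs : (f.map (algebraMap F A)).Splits) : (f.aroots A).toFinset.card = f.natDegree := by
  have hnd : (f.aroots A).Nodup :=
    nodup_roots (PerfectField.separable_of_irreducible h.irreducible).map
  rw [Multiset.toFinset_card_of_nodup hnd, aroots, ← hs.natDegree_eq_card_roots, natDegree_map]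

theorem RootData.exists_decomposition_eigenRep (h : RootData M f θ)
    (hs : (f.map (algebraMap F A)).Splits) :
    ∃ r : Fin f.natDegree → A, (∀ j, r j ∈ f.aroots A) ∧
      Nonempty (Decomposition (fun j => eigenRep A f θ (r j)) (fun _ => 1) (M.baseChange A)) := by
  classical
  have E := (f.aroots A).toFinset.equivFinOfCardEq (h.card_aroots hs)
  obtain ⟨r, hr, hmap⟩ : ∃ r : Fin f.natDegree → A, ∃ hr : Function.Injective r,
      univ.map ⟨r, hr⟩ = (f.aroots A).toFinset := by
    refine ⟨fun j => (E.symm j : A), Subtype.val_injective.comp E.symm.injective, ?_⟩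
    ext ρ
    rw [Finset.mem_map]
    exact ⟨fun ⟨j, _, hj⟩ => hj ▸ (E.symm j).2,
      fun hρ => ⟨E ⟨ρ, hρ⟩, Finset.mem_univ _, congrArg Subtype.val (E.symm_apply_apply _)⟩⟩
  have hmem : ∀ j, r j ∈ f.aroots A := fun j => by
    rw [← Multiset.mem_toFinset, ← hmap]
    exact Finset.mem_map.2 ⟨j, Finset.mem_univ _, rfl⟩
  have hsum : ∑ j, eigenProj (bcHom M A θ) (f.aroots A).toFinset (r j) = 1 := by
    have h1 := sum_eigenProj (h.aeval_prod_eq_zero hs)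
    conv_lhs at h1 => rw [← hmap, Finset.sum_map]
    rw [← h1]
    simp only [Function.Embedding.coeFn_mk, hmap]
  exact ⟨r, hmem, ⟨Decomposition.ofRetracts (fun j => eigenIncl A f θ (r j))
    (fun j => eigenRetr A f θ (r j)) (fun j => h.eigenIncl_retr hs (hmem j))
    (fun j k hjk => h.eigenIncl_retr_of_ne hs (hmem j) (hmem k) fun heq => hjk (hr heq)) hsum⟩⟩

theorem RootData.exists_hasDim_eigenRep [Finite A] (h : RootData M f θ) (hM : M.HasDim α)
    (hs : (f.map (algebraMap F A)).Splits) :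
    ∃ β, α = f.natDegree • β ∧ ∀ ρ ∈ f.aroots A, (eigenRep A f θ ρ).HasDim β := by
  classical
  obtain ⟨r, hr, ⟨d⟩⟩ := h.exists_decomposition_eigenRep (A := A) hs
  let ρ₀ := r ⟨0, h.irreducible.natDegree_pos⟩
  let β : V →₀ ℕ := Finsupp.equivFunOnFinite.symm fun i => finrank A ((eigenRep A f θ ρ₀).obj i)
  have hβ : ∀ ρ ∈ f.aroots A, (eigenRep A f θ ρ).HasDim β := fun ρ hρ i => by
    have := (hM i).1
    exact ⟨inferInstanceAs (Module.Finite A (LinearMap.range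
      (bcApp A (eigenProj (bcHom M A θ) (f.aroots A).toFinset ρ).asHom i))),
      h.finrank_eigenRep_eq hM hs hρ (hr _) i⟩
  refine ⟨β, ?_, hβ⟩
  have h1 := hasDim_of_iso ((dirSumDecomposition _ _).iso d) (dirSum_hasDim (fun j => hβ _ (hr j)) _)
  rw [hasDim_unique (baseChange_hasDim A hM) h1, Finset.sum_const, Finset.card_univ,
    Fintype.card_fin, one_smul]

end Galois
end Hua

namespace Hua

set_option linter.unusedSectionVars false

open Finset Module CategoryTheory

section Restriction

open Polynomial

variable {F : Type w} [Field F] {V : Type u} [Quiver.{v + 1} V] {A : Type w} [Field A] [Algebra F A]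

/-! ### Restriction of scalars -/

variable (F) in
/-- The restriction of scalars of a representation. -/
def resRep (N : QuiverRep A V) [∀ i, Module F (N.obj i)] [∀ i, IsScalarTower F A (N.obj i)] :
    QuiverRep F V where
  obj i := N.obj i
  map e := (N.map e).restrictScalars F

section Res

variable {N : QuiverRep A V} [∀ i, Module F (N.obj i)] [∀ i, IsScalarTower F A (N.obj i)]

theorem resRep_hasDim [Module.Finite F A] {α : V →₀ ℕ} (hN : N.HasDim α) :
    (resRep F N).HasDim (finrank F A • α) := fun i => by
  have : Module.Finite A (N.obj i) := (hN i).1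
  refine ⟨Module.Finite.trans (R := F) A (N.obj i), ?_⟩
  refine (finrank_mul_finrank F A (N.obj i)).symm.trans ?_
  exact congrArg (finrank F A * ·) (hN i).2

/-- A representation is a retract of the extension of its restriction of scalars. -/
theorem exists_retract_resRep [Module.Finite F A] [Algebra.IsSeparable F A] :
    ∃ (s : N ⟶ (resRep F N).baseChange A) (p : (resRep F N).baseChange A ⟶ N), s ≫ p = 𝟙 N := by
  -- The separability element of A over F gives a natural section of the multiplication A ⊗ N → N.
  have := Algebra.FormallyUnramified.of_isSeparable F A
  let s : ∀ i, N.obj i →ₗ[A] A ⊗[F] N.obj i :=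
    fun i => Algebra.FormallyUnramified.sec F A (N.obj i)
  let p : ∀ i, A ⊗[F] N.obj i →ₗ[A] N.obj i :=
    fun i => TensorProduct.AlgebraTensorModule.lift
      ((Algebra.lsmul A A (N.obj i)).toLinearMap.flip.restrictScalars F).flip
  have hp : ∀ i a (x : N.obj i), p i (a ⊗ₜ x) = a • x := fun i a x => rfl
  have hsec : ∀ i j (φ : N.obj i →ₗ[A] N.obj j) x,
      s j (φ x) = (φ.restrictScalars F).baseChange A (s i x) := by
    intro i j φ x
    change TensorProduct.AlgebraTensorModule.map LinearMap.id _ _ =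
      (φ.restrictScalars F).baseChange A (TensorProduct.AlgebraTensorModule.map LinearMap.id _ _)
    induction Algebra.FormallyUnramified.elem F A with
    | zero => simp
    | add y z hy hz => rw [map_add, hy, hz, map_add, map_add]
    | tmul a b =>
      change a ⊗ₜ[F] (b • φ x) = a ⊗ₜ[F] φ (b • x)
      rw [map_smul]
  have hlift : ∀ i j (φ : N.obj i →ₗ[A] N.obj j) x,
      p j ((φ.restrictScalars F).baseChange A x) = φ (p i x) := by
    intro i j φ x
    induction x with
    | zero => simp
    | add y z hy hz => simp only [map_add, hy, hz]
    | tmul a x => exact (map_smul φ a x).symm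
  exact ⟨homMk s fun i j e x => hsec i j (N.map e) x, homMk p fun i j e x => hlift i j (N.map e) x,
    rep_hom_ext fun i x => LinearMap.congr_fun
      (Algebra.FormallyUnramified.comp_sec F A (N.obj i)) x⟩

end Res

variable [Finite F] [Finite V] [Finite A]

/-- N is a retract of the extension of its restriction to F. Decomposing that restriction writes the
identity of N as a sum of endomorphisms factoring through the extensions of the X j; as End N is
local, one of them is invertible. -/
theorem exists_retract_baseChange {J : Type} [Fintype J] [DecidableEq J] {X : J → QuiverRep F V}
    {γ : J → V →₀ ℕ} {D : ℕ} (hX : IndecFamily X γ D) {N : QuiverRep A V} {α : V →₀ ℕ}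
    (hN : N.HasDim α) (hnt : Nontrivial (CategoryTheory.End N))
    (hsl : IsSplitLocal A (CategoryTheory.End N)) (hD : (finrank F A • α).degree ≤ D) :
    ∃ (j : J) (s : N ⟶ (X j).baseChange A) (p : (X j).baseChange A ⟶ N), s ≫ p = 𝟙 N := by
  have hfin : Finite (CategoryTheory.End N) := finite_hom hN hN
  let _ : ∀ i, Module F (N.obj i) := fun i => Module.restrictScalars F A (N.obj i)
  have : ∀ i, IsScalarTower F A (N.obj i) := fun i => IsScalarTower.restrictScalars F A (N.obj i)
  obtain ⟨n, ⟨d⟩⟩ := exists_decomposition hX.exists_iso _ _ _ rfl hD (resRep_hasDim (F := F) hN)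
  obtain ⟨s, p, hsp⟩ := exists_retract_resRep (F := F) (N := N)
  obtain ⟨ε, hε⟩ := hsl.exists_algHom
  have h1 : ∑ t : Σ j, Fin (n j), s ≫ (bcMap A (d.p t.1 t.2) ≫ bcMap A (d.i t.1 t.2)) ≫ p = 𝟙 N := by
    rw [← Preadditive.comp_sum, ← Preadditive.sum_comp]
    simp only [← bcMap_comp]
    rw [← bcMap_sum, d.total, bcMap_id, Category.id_comp, hsp]
  obtain ⟨t, ht⟩ : ∃ t : Σ j, Fin (n j), ε (CategoryTheory.End.of
      (s ≫ (bcMap A (d.p t.1 t.2) ≫ bcMap A (d.i t.1 t.2)) ≫ p)) ≠ 0 := by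
    by_contra! h0
    have h2 := congrArg ε h1
    refine zero_ne_one (α := A) (Eq.trans ?_ (h2.trans (map_one ε)))
    exact ((map_sum ε _ _).trans (Finset.sum_eq_zero fun t _ => h0 t)).symm
  rw [Ne, hε] at ht
  obtain ⟨w, hw, -⟩ := isUnit_iff_exists.1
    ((isUnit_or_isNilpotent_of_finite hsl.eq_zero_or_one _).resolve_right ht)
  refine ⟨t.1, w.asHom ≫ s ≫ bcMap A (d.p t.1 t.2), bcMap A (d.i t.1 t.2) ≫ p, ?_⟩
  have hw' : w.asHom ≫ s ≫ (bcMap A (d.p t.1 t.2) ≫ bcMap A (d.i t.1 t.2)) ≫ p = 𝟙 N := hw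
  simpa only [Category.assoc] using hw'

variable {M : QuiverRep F V} {α : V →₀ ℕ} {f : F[X]} {θ : CategoryTheory.End M}

theorem RootData.splits_of_mem (h : RootData M f θ) {ρ : A} (hρ : ρ ∈ f.aroots A) :
    (f.map (algebraMap F A)).Splits := by
  have hmin : minpoly F ρ = f :=
    (minpoly.eq_of_irreducible_of_monic h.irreducible (mem_aroots.1 hρ).2 h.monic).symm
  rw [← hmin]
  exact Normal.splits inferInstance ρ

theorem RootData.nontrivial_end_eigenRep (h : RootData M f θ) (hM : M.HasDim α)
    (hind : M.IsIndecomposable) {ρ : A} (hρ : ρ ∈ f.aroots A) :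
    Nontrivial (CategoryTheory.End (eigenRep A f θ ρ)) := by
  obtain ⟨β, hβ, hdim⟩ := h.exists_hasDim_eigenRep hM (h.splits_of_mem hρ)
  obtain ⟨i, hi⟩ := hind.1
  rw [nontrivial_end_iff]
  refine ⟨i, ?_⟩
  have := (hM i).1
  have h1 := (hM i).2
  have h2 := hdim ρ hρ i
  have := h2.1
  rw [← finrank_pos_iff (R := A), h2.2, Nat.pos_iff_ne_zero]
  intro h0
  rw [hβ, Finsupp.smul_apply, h0, smul_zero] at h1
  exact (finrank_pos_iff.2 hi).ne' h1

theorem RootData.isIndecomposable_eigenRep (h : RootData M f θ) (hM : M.HasDim α)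
    (hind : M.IsIndecomposable) {ρ : A} (hρ : ρ ∈ f.aroots A) :
    (eigenRep A f θ ρ).IsIndecomposable :=
  isIndecomposable_iff.2 ⟨h.nontrivial_end_eigenRep hM hind hρ,
    (h.isSplitLocal_eigenRep hM hind (h.splits_of_mem hρ) hρ).eq_zero_or_one⟩

/-- The residue τ of s ≫ x ≫ p is shown to satisfy τ(g(t)) = g(τ(t)) for the extension t of θ. So
τ(t) is a root of f, and the projection to its eigenspace has residue 1; hence N is a retract of
that eigenspace. -/
theorem RootData.exists_iso_eigenRep (h : RootData M f θ) (hM : M.HasDim α)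
    (hind : M.IsIndecomposable) {N : QuiverRep A V} [Finite (CategoryTheory.End N)]
    (hnt : Nontrivial (CategoryTheory.End N)) (hsl : IsSplitLocal A (CategoryTheory.End N))
    (s : N ⟶ M.baseChange A) (p : M.baseChange A ⟶ N) (hsp : s ≫ p = 𝟙 N) :
    ∃ ρ ∈ f.aroots A, Nonempty (N ≅ eigenRep A f θ ρ) := by
  classical
  have hfin : Finite (CategoryTheory.End M) := finite_hom hM hM
  have hspan := span_range_bcHom A hM
  have hloc := (isIndecomposable_iff.1 hind).2
  obtain ⟨ε, hε⟩ := hsl.exists_algHom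
  set t := bcHom M A θ
  let τ : CategoryTheory.End (M.baseChange A) → A := fun x =>
    ε (CategoryTheory.End.of (s ≫ x.asHom ≫ p))
  have hτsub : ∀ x y, τ (x - y) = τ x - τ y := fun x y => by
    have h1 : s ≫ (x.asHom - y.asHom) ≫ p = s ≫ x.asHom ≫ p - s ≫ y.asHom ≫ p := by
      rw [Preadditive.sub_comp, Preadditive.comp_sub]
    exact (congrArg ε h1).trans (map_sub ε _ _)
  have hτadd : ∀ x y, τ (x + y) = τ x + τ y := fun x y => by
    have h1 : s ≫ (x.asHom + y.asHom) ≫ p = s ≫ x.asHom ≫ p + s ≫ y.asHom ≫ p := by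
      rw [Preadditive.add_comp, Preadditive.comp_add]
    exact (congrArg ε h1).trans (map_add ε _ _)
  have hτsmul : ∀ (a : A) x, τ (a • x) = a * τ x := fun a x => by
    have h1 : s ≫ (a • x.asHom) ≫ p = a • (s ≫ x.asHom ≫ p) := by
      rw [Linear.smul_comp, Linear.comp_smul]
    exact (congrArg ε h1).trans (map_smul ε a (CategoryTheory.End.of (s ≫ x.asHom ≫ p)))
  have hτone : τ 1 = 1 := by
    have h1 : s ≫ 𝟙 _ ≫ p = 𝟙 N := by rw [Category.id_comp, hsp]
    exact (congrArg ε h1).trans (map_one ε)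
  have hτnil : ∀ x ∈ nilSpan A (bcHom M A), τ x = 0 := fun x hx =>
    (hε _).2 (isNilpotent_comp_of_mem_nilSpan hloc hspan hx s p)
  let E : CategoryTheory.End (M.baseChange A) := CategoryTheory.End.of (p ≫ s)
  have hτE : ∀ x, τ (E * x) = τ x := fun x => by
    have h1 : s ≫ (x.asHom ≫ p ≫ s) ≫ p = s ≫ x.asHom ≫ p := by
      simp only [Category.assoc]
      rw [hsp, Category.comp_id]
    exact congrArg ε h1
  have hτmulE : ∀ x y, τ (x * (E * y)) = τ x * τ y := fun x y => by
    have h1 : s ≫ ((y.asHom ≫ p ≫ s) ≫ x.asHom) ≫ p = (s ≫ y.asHom ≫ p) ≫ (s ≫ x.asHom ≫ p) := by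
      simp only [Category.assoc]
    exact (congrArg ε h1).trans (map_mul ε (CategoryTheory.End.of (s ≫ x.asHom ≫ p))
      (CategoryTheory.End.of (s ≫ y.asHom ≫ p)))
  obtain ⟨r, hr⟩ := exists_aeval_sub_mem (bcHom_algebraMap A) hspan h.exists_aeval E
  -- The idempotent E of the summand N is a polynomial in t modulo the nilpotent ideal, so it
  -- commutes with t there, and τ vanishes on that ideal.
  have hτt : ∀ y, τ (t * y) = τ t * τ y := fun y => by
    have h1 : t * (E * y) - E * (t * y) ∈ nilSpan A (bcHom M A) := by
      have h2 : t * (E * y) - E * (t * y) =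
          t * (E - aeval t r) * y - (E - aeval t r) * (t * y) := by
        have h3 : t * aeval t r = aeval t r * t := by
          have := congrArg (aeval t) (mul_comm X r)
          rwa [map_mul, map_mul, aeval_X] at this
        rw [mul_sub, sub_mul, sub_mul, ← mul_assoc (aeval t r), h3, mul_assoc t]
        abel
      rw [h2]
      exact Submodule.sub_mem _ (mul_mem_nilSpan hloc hspan (mul_mem_nilSpan hloc hspan hr t).1 y).2
        (mul_mem_nilSpan hloc hspan hr (t * y)).2
    have h2 := hτnil _ h1
    rw [hτsub, hτE, hτmulE, sub_eq_zero] at h2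
    exact h2.symm
  have hτpoly : ∀ g : A[X], τ (aeval t g) = eval (τ t) g := by
    intro g
    induction g using Polynomial.induction_on with
    | C a => rw [aeval_C, Algebra.algebraMap_eq_smul_one, hτsmul, hτone, eval_C, mul_one]
    | add g₁ g₂ h₁ h₂ => rw [map_add, hτadd, h₁, h₂, eval_add]
    | monomial n a ih =>
      have h1 : Polynomial.C a * X ^ (n + 1) = X * (Polynomial.C a * X ^ n) := by ring
      rw [h1, map_mul, aeval_X, hτt, ih, eval_mul (p := X), eval_X]
  have hτ0 : τ 0 = 0 := hτnil 0 (Submodule.zero_mem _)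
  have hroot : τ t ∈ f.aroots A := by
    rw [mem_aroots]
    refine ⟨h.monic.ne_zero, ?_⟩
    rw [← eval_map_algebraMap, ← hτpoly, aeval_map_eq (bcHom_algebraMap A), h.aeval_eq_zero,
      map_zero, hτ0]
  refine ⟨τ t, hroot, ?_⟩
  have h1 : τ (eigenProj t (f.aroots A).toFinset (τ t)) = 1 := by
    rw [eigenProj, hτpoly, eval_eigenProj_self (Multiset.mem_toFinset.2 hroot)]
  have h2 : ¬ IsNilpotent (CategoryTheory.End.of
      (s ≫ (eigenProj t (f.aroots A).toFinset (τ t)).asHom ≫ p)) := by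
    rw [← hε]
    exact fun h0 => one_ne_zero (h1.symm.trans h0)
  obtain ⟨w, hw, -⟩ := isUnit_iff_exists.1
    ((isUnit_or_isNilpotent_of_finite hsl.eq_zero_or_one _).resolve_right h2)
  have hw' : w.asHom ≫ s ≫ (eigenRetr A f θ (τ t) ≫ eigenIncl A f θ (τ t)) ≫ p = 𝟙 N := hw
  refine isIso_of_retract (h.isIndecomposable_eigenRep hM hind hroot) hnt
    (w.asHom ≫ s ≫ eigenRetr A f θ (τ t)) (eigenIncl A f θ (τ t) ≫ p) ?_
  simpa only [Category.assoc] using hw'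

end Restriction
end Hua

namespace Hua

set_option linter.unusedSectionVars false

open Finset Module CategoryTheory

/-! ### Counting absolutely indecomposable representations over extensions -/

section Count

open Polynomial

theorem exists_extension (F : Type w) [Field F] [Finite F] {k : ℕ} (hk : k ≠ 0) :
    ∃ (K : Type w) (_ : Field K) (_ : Finite K) (_ : Algebra F K), finrank F K = k := by
  obtain ⟨p, hp⟩ := CharP.exists F
  have : Fact p.Prime := ⟨CharP.char_is_prime F p⟩
  have : NeZero k := ⟨hk⟩
  have : Finite (FiniteField.Extension F p k) := Module.finite_of_finite F
  exact ⟨ULift.{w} (FiniteField.Extension F p k), inferInstance, inferInstance, inferInstance, by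
    rw [finrank_ulift, FiniteField.finrank_extension]⟩

variable {F : Type w} [Field F] [Finite F] {V : Type u} [Quiver.{v + 1} V] [Finite V]
  {M : QuiverRep F V} {K : Type w} [Field K] [Finite K] [Algebra F K] {f : F[X]}
  {θ : CategoryTheory.End M}

theorem RootData.natCard_roots (h : RootData M f θ) : Nat.card {ρ : K // ρ ∈ f.aroots K} =
    if f.natDegree ∣ finrank F K then f.natDegree else 0 := by
  classical
  split_ifs with hd
  · have : Fact (Irreducible f) := ⟨h.irreducible⟩
    have hfr : finrank F (AdjoinRoot f) = f.natDegree := by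
      rw [(AdjoinRoot.powerBasis h.monic.ne_zero).finrank, AdjoinRoot.powerBasis_dim]
    have : Module.Finite F (AdjoinRoot f) := (AdjoinRoot.powerBasis h.monic.ne_zero).finite
    have : Finite (AdjoinRoot f) := Module.finite_of_finite F
    obtain ⟨φ⟩ := FiniteField.nonempty_algHom_of_finrank_dvd (F := F) (K := AdjoinRoot f) (L := K)
      (by rwa [hfr])
    have hroot : φ (AdjoinRoot.root f) ∈ f.aroots K := by
      rw [mem_aroots]
      refine ⟨h.monic.ne_zero, ?_⟩
      rw [Polynomial.aeval_algHom_apply, AdjoinRoot.aeval_eq, AdjoinRoot.mk_self, map_zero]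
    rw [← h.card_aroots (h.splits_of_mem hroot), ← Nat.card_eq_finsetCard]
    exact Nat.card_congr (Equiv.subtypeEquivRight fun ρ => Multiset.mem_toFinset.symm)
  · have : IsEmpty {ρ : K // ρ ∈ f.aroots K} := ⟨fun ⟨ρ, hρ⟩ => hd ?_⟩
    · exact Nat.card_of_isEmpty
    · have hmin : minpoly F ρ = f :=
        (minpoly.eq_of_irreducible_of_monic h.irreducible (mem_aroots.1 hρ).2 h.monic).symm
      rw [← hmin]
      exact minpoly.degree_dvd (IsIntegral.of_finite F ρ)

/-- Over the extension of degree deg f there is a root, and M becomes a sum of deg f summands of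
equal dimension. -/
theorem RootData.natDegree_dvd_content (h : RootData M f θ) {α : V →₀ ℕ} (hM : M.HasDim α) :
    f.natDegree ∣ content α := by
  obtain ⟨K, _, _, _, hK⟩ := exists_extension F h.irreducible.natDegree_pos.ne'
  have h1 := h.natCard_roots (K := K)
  rw [hK, if_pos dvd_rfl] at h1
  have : Nonempty {ρ : K // ρ ∈ f.aroots K} := by
    by_contra hne
    rw [not_nonempty_iff] at hne
    rw [Nat.card_of_isEmpty] at h1
    exact h.irreducible.natDegree_pos.ne h1
  obtain ⟨ρ, hρ⟩ := this
  obtain ⟨β, hβ, -⟩ := h.exists_hasDim_eigenRep hM (h.splits_of_mem hρ)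
  rw [hβ]
  exact dvd_content_smul _ _

variable {J : Type} [Fintype J] [DecidableEq J] {X : J → QuiverRep F V}
    {γ : J → V →₀ ℕ} {D : ℕ}

/-- The absolutely indecomposable representations over an extension of the base field are the
eigenspaces of the indecomposable representations over the base field. -/
theorem IndecFamily.numAbsIndecReps_eq [DecidableEq V] (hX : IndecFamily X γ D) {f : J → F[X]}
    {θ : ∀ j, CategoryTheory.End (X j)} (h : ∀ j, RootData (X j) (f j) (θ j)) {α : V →₀ ℕ}
    (hD : (finrank F K • α).degree ≤ D) : QuiverRep.numAbsIndecReps K V α =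
      ∑ j, if (f j).natDegree ∣ finrank F K ∧ γ j = (f j).natDegree • α
        then (f j).natDegree else 0 := by
  classical
  let S := QuiverRep.isoSetoid fun M : QuiverRep K V => M.HasDim α ∧ M.IsAbsolutelyIndecomposable
  -- The pairs of j and a root index the classes; the second condition says that the eigenspaces
  -- have dimension α.
  let T : J → Type w := fun j => {ρ : K // ρ ∈ (f j).aroots K ∧ γ j = (f j).natDegree • α}
  have hdim : ∀ j (x : T j), (eigenRep K (f j) (θ j) x.1).HasDim α := fun j x => by
    obtain ⟨β, hβ, hd⟩ := (h j).exists_hasDim_eigenRep (hX.hasDim j) ((h j).splits_of_mem x.2.1)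
    have h1 : α = β := by
      have h2 := x.2.2.symm.trans hβ
      exact smul_right_injective _ (h j).irreducible.natDegree_pos.ne' h2
    have h2 := hd _ x.2.1
    rwa [← h1] at h2
  let Φ : (Σ j, T j) → Quotient S := fun x => Quotient.mk S
    ⟨eigenRep K (f x.1) (θ x.1) x.2.1, hdim _ _, (isAbsolutelyIndecomposable_iff (hdim _ _)).2
      ⟨(h _).nontrivial_end_eigenRep (hX.hasDim _) (hX.indec _) x.2.2.1,
        (h _).isSplitLocal_eigenRep (hX.hasDim _) (hX.indec _) ((h _).splits_of_mem x.2.2.1)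
          x.2.2.1⟩⟩
  have hΦ : Function.Bijective Φ := by
    constructor
    · rintro ⟨j, ρ, hρ, hj⟩ ⟨j', ρ', hρ', hj'⟩ heq
      obtain ⟨e⟩ := isIso_iff.1 (Quotient.exact heq)
      have hnt := (h j).nontrivial_end_eigenRep (hX.hasDim j) (hX.indec j) hρ
      obtain rfl := hX.eq_of_iso j j' ((h j).nonempty_iso_of_iso (h j') (hX.hasDim j) (hX.hasDim j')
        (hX.indec j) (hX.indec j') ((h j).splits_of_mem hρ) ((h j').splits_of_mem hρ') hρ hρ' hnt e)
      obtain rfl := (h j).eq_of_iso (hX.hasDim j) (hX.indec j) ((h j).splits_of_mem hρ) hρ hρ' hnt e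
      rfl
    · intro q
      induction q using Quotient.inductionOn with
      | h N =>
        obtain ⟨N, hN, hai⟩ := N
        obtain ⟨hnt, hsl⟩ := (isAbsolutelyIndecomposable_iff hN).1 hai
        have : Finite (CategoryTheory.End N) := finite_hom hN hN
        obtain ⟨j, s, p, hsp⟩ := exists_retract_baseChange hX hN hnt hsl hD
        obtain ⟨ρ, hρ, ⟨e⟩⟩ := (h j).exists_iso_eigenRep (hX.hasDim j) (hX.indec j) hnt hsl s p hsp
        obtain ⟨β, hβ, hd⟩ := (h j).exists_hasDim_eigenRep (hX.hasDim j) ((h j).splits_of_mem hρ)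
        have h1 : α = β := hasDim_unique (hasDim_of_iso e hN) (hd ρ hρ)
        exact ⟨⟨j, ρ, hρ, h1 ▸ hβ⟩, Quotient.sound (isIso_iff.2 ⟨e.symm⟩)⟩
  have hfin : ∀ j, Finite (T j) := fun j => inferInstanceAs (Finite {ρ : K // _})
  rw [QuiverRep.numAbsIndecReps, ← Nat.card_congr (Equiv.ofBijective Φ hΦ), Nat.card_sigma]
  refine Finset.sum_congr rfl fun j _ => ?_
  by_cases hj : γ j = (f j).natDegree • α
  · have h1 : Nat.card (T j) = Nat.card {ρ : K // ρ ∈ (f j).aroots K} :=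
      Nat.card_congr (Equiv.subtypeEquivRight fun ρ => and_iff_left hj)
    rw [h1, (h j).natCard_roots]
    simp only [hj, and_true]
  · have : IsEmpty (T j) := ⟨fun x => hj x.2.2⟩
    rw [Nat.card_of_isEmpty, if_neg fun h0 => hj h0.2]

end Count
end Hua

namespace Hua

set_option linter.unusedSectionVars false

open Finset Module CategoryTheory

/-! ### The identities at a fixed prime power -/

section Hua

theorem exists_algebra_of_natCard_eq {F K : Type w} [Field F] [Finite F] [Field K] [Finite K] {k : ℕ}
    (hk : k ≠ 0) (h : Nat.card K = Nat.card F ^ k) : ∃ _ : Algebra F K, finrank F K = k := by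
  obtain ⟨K', _, _, _, hK'⟩ := exists_extension F hk
  have := Fintype.ofFinite K
  have := Fintype.ofFinite K'
  have hcard : Fintype.card K' = Fintype.card K := by
    rw [← Nat.card_eq_fintype_card, ← Nat.card_eq_fintype_card, h,
      Module.natCard_eq_pow_finrank (K := F) (V := K'), hK']
  let e := FiniteField.ringEquivOfCardEq hcard
  let _ : Algebra F K := ((e : K' →+* K).comp (algebraMap F K')).toAlgebra
  refine ⟨inferInstance, ?_⟩
  rw [Module.natCard_eq_pow_finrank (K := F) (V := K)] at h
  exact Nat.pow_right_injective (Finite.one_lt_card (α := F)) h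

variable {V : Type u} [Quiver.{v + 1} V] [Fintype V] [DecidableEq V] [∀ i j : V, Finite (i ⟶ j)]

variable (V) in
theorem exists_indecFamily_numAbsIndecReps (F : Type w) [Field F] [Finite F] (D : ℕ) :
    ∃ (m : ℕ) (X : Fin m → QuiverRep F V) (γ : Fin m → V →₀ ℕ) (d : Fin m → ℕ),
      IndecFamily X γ D ∧ (∀ j, d j ∣ content (γ j)) ∧
      (∀ j, resCard (X j) = Nat.card F ^ d j) ∧
      ∀ k, k ≠ 0 → ∀ α, (k • α).degree ≤ D → ∀ (K : Type w) [Field K] [Finite K],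
        Nat.card K = Nat.card F ^ k → QuiverRep.numAbsIndecReps K V α =
          ∑ j, if d j ∣ k ∧ γ j = d j • α then d j else 0 := by
  obtain ⟨m, X, γ, hX⟩ := exists_indecFamily F V D
  choose f θ h hres using fun j => exists_rootData (hX.indec j) (hX.hasDim j)
  refine ⟨m, X, γ, fun j => (f j).natDegree, hX, fun j => (h j).natDegree_dvd_content (hX.hasDim j),
    hres, fun k hk α hα K _ _ hK => ?_⟩
  obtain ⟨_, hfr⟩ := exists_algebra_of_natCard_eq hk hK
  rw [hX.numAbsIndecReps_eq h (by rwa [hfr]), hfr]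

theorem numAbsIndecReps_zero (F : Type w) [Field F] [Finite F] :
    QuiverRep.numAbsIndecReps F V 0 = 0 := by
  obtain ⟨m, X, γ, d, hX, -, -, h⟩ := exists_indecFamily_numAbsIndecReps V F 0
  rw [h 1 one_ne_zero 0 (by simp) F (pow_one _).symm]
  refine Finset.sum_eq_zero fun j _ => if_neg fun h0 => hX.dim_ne_zero j ?_
  rw [h0.2, smul_zero]

variable (V) in
/-- The number of absolutely indecomposable representations depends only on the cardinality of the
field. -/
theorem exists_numAbsIndecReps_eq : ∃ av : ℕ → (V →₀ ℕ) → ℕ, ∀ (F : Type w) [Field F] [Finite F] α,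
    QuiverRep.numAbsIndecReps F V α = av (Nat.card F) α := by
  have : ∀ q : ℕ, ∃ a : (V →₀ ℕ) → ℕ, ∀ (F : Type w) [Field F] [Finite F], Nat.card F = q →
      ∀ α, QuiverRep.numAbsIndecReps F V α = a α := by
    intro q
    by_cases hq : ∃ (F : Type w) (_ : Field F) (_ : Finite F), Nat.card F = q
    · obtain ⟨F, _, _, hF⟩ := hq
      refine ⟨QuiverRep.numAbsIndecReps F V, fun F' _ _ hF' α => ?_⟩
      obtain ⟨m, X, γ, d, -, -, -, h⟩ := exists_indecFamily_numAbsIndecReps V F α.degree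
      have h1 := h 1 one_ne_zero α (by rw [one_smul])
      rw [h1 F (pow_one _).symm, h1 F' (by rw [hF', hF, pow_one])]
    · exact ⟨0, fun F hf hfin hF => (hq ⟨F, hf, hfin, hF⟩).elim⟩
  choose av hav using this
  exact ⟨av, fun F _ _ α => hav _ F rfl α⟩

theorem isLog_numReps {av : ℕ → (V →₀ ℕ) → ℕ} (hav : ∀ (F : Type w) [Field F] [Finite F] α,
    QuiverRep.numAbsIndecReps F V α = av (Nat.card F) α) (F : Type w) [Field F] [Finite F] :
    IsLog (fun α => (QuiverRep.numReps F V α : ℚ) : MvPowerSeries V ℚ)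
      (adamsSum fun k γ => (av (Nat.card F ^ k) γ : ℚ)) ∧
    IsLog (rValue V (Nat.card F) : MvPowerSeries V ℚ)
      (adamsSum fun k γ => (av (Nat.card F ^ k) γ : ℚ) / ((Nat.card F : ℚ) ^ k - 1)) := by
  have key : ∀ D : ℕ, ∃ (m : ℕ) (X : Fin m → QuiverRep F V) (γ : Fin m → V →₀ ℕ) (d : Fin m → ℕ),
      IndecFamily X γ D ∧ (∀ j, d j ∣ content (γ j)) ∧
      (∀ j, resCard (X j) = Nat.card F ^ d j) ∧ ∀ k, k ≠ 0 → ∀ α, (k • α).degree ≤ D →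
        av (Nat.card F ^ k) α = ∑ j, if d j ∣ k ∧ γ j = d j • α then d j else 0 := by
    intro D
    obtain ⟨m, X, γ, d, hX, hd, hres, h⟩ := exists_indecFamily_numAbsIndecReps V F D
    refine ⟨m, X, γ, d, hX, hd, hres, fun k hk α hα => ?_⟩
    obtain ⟨K, _, _, _, hK⟩ := exists_extension F hk
    have hcard : Nat.card K = Nat.card F ^ k := by
      rw [Module.natCard_eq_pow_finrank (K := F) (V := K), hK]
    rw [← hcard, ← hav K, h k hk α hα K hcard]
  constructor
  · refine isLog_of_forall_degree fun D => ?_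
    obtain ⟨m, X, γ, d, hX, hd, -, h⟩ := key D
    obtain ⟨f, g, hlog, hfg⟩ := hX.exists_isLog_numReps hd (A := fun k => av (Nat.card F ^ k)) h
    exact ⟨f, g, hlog, hfg⟩
  · refine isLog_of_forall_degree fun D => ?_
    obtain ⟨m, X, γ, d, hX, hd, hres, h⟩ := key D
    obtain ⟨f, g, hlog, hfg⟩ := hX.exists_isLog_rValue hd hres (A := fun k => av (Nat.card F ^ k)) h
    exact ⟨f, g, hlog, hfg⟩

end Hua
end Hua

theorem mainTheorem2 {V : Type u} [Fintype V] [DecidableEq V] [Quiver.{v + 1} V]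
    [∀ i j : V, Finite (i ⟶ j)] (hloops : ∀ i : V, IsEmpty (i ⟶ i)) :
    ∃ m a : (V →₀ ℕ) → Polynomial ℤ,
      (∀ (F : Type w) [Field F] [Finite F] (α : V →₀ ℕ),
        (m α).eval (Nat.card F : ℤ) = (QuiverRep.numReps F V α : ℤ) ∧
        (a α).eval (Nat.card F : ℤ) = (QuiverRep.numAbsIndecReps F V α : ℤ)) ∧
      Hua.genSeries a = Hua.qSubOne V * Hua.Log (Hua.rSeries V) ∧
      Hua.genSeries m = Hua.Pow (Hua.rSeries V) (Hua.qSubOne V) := by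
  classical
  obtain ⟨av, hav⟩ := Hua.exists_numAbsIndecReps_eq.{u, v, w} V
  have hmv : ∀ q : ℕ, ∃ b : (V →₀ ℕ) → ℕ, ∀ (F : Type w) [Field F] [Finite F], Nat.card F = q →
      ∀ α, QuiverRep.numReps F V α = b α := by
    intro q
    by_cases hq : ∃ (F : Type w) (_ : Field F) (_ : Finite F), Nat.card F = q
    · obtain ⟨F, _, _, hF⟩ := hq
      refine ⟨QuiverRep.numReps F V, fun F' _ _ hF' α => ?_⟩
      have h1 := (Hua.isLog_numReps hav F).1
      have h2 := (Hua.isLog_numReps hav F').1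
      rw [hF', ← hF] at h2
      -- The number of all representations depends only on q, because its series is determined by a
      -- logarithm that does.
      exact_mod_cast congrFun (h2.eq_of_log_eq h1) α
    · exact ⟨0, fun F hf hfin hF => (hq ⟨F, hf, hfin, hF⟩).elim⟩
  choose mv hmv using hmv
  let S : Set ℕ := {q | ∃ (F : Type w) (_ : Field F) (_ : Finite F), Nat.card F = q}
  have hpow : ∀ q ∈ S, ∀ k, k ≠ 0 → q ^ k ∈ S := by
    rintro _ ⟨F, _, _, rfl⟩ k hk
    obtain ⟨K, _, _, _, hK⟩ := Hua.exists_extension F hk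
    exact ⟨K, inferInstance, inferInstance, by
      rw [Module.natCard_eq_pow_finrank (K := F) (V := K), hK]⟩
  have hS2 : ∀ q ∈ S, 2 ≤ q := by
    rintro _ ⟨F, _, _, rfl⟩
    exact Finite.one_lt_card
  have h2S : 2 ∈ S := by
    have : Fact (Nat.Prime 2) := ⟨Nat.prime_two⟩
    exact ⟨ULift.{w} (ZMod 2), inferInstance, inferInstance, by simp⟩
  -- The powers of 2 already suffice to identify the polynomials.
  have hS : S.Infinite := Set.infinite_of_injective_forall_mem (f := fun k : ℕ => 2 ^ (k + 1))
    (fun a b h => Nat.succ_injective (Nat.pow_right_injective le_rfl h))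
    fun k => hpow 2 h2S _ k.succ_ne_zero
  obtain ⟨m, a, hval, ha, hm⟩ := Hua.exists_polynomials_of_counts
    (Hua.constantCoeff_rSeries (V := V)) (Hua.rSeries_mem_coeffsIn hloops) hS hS2 hpow av mv
    (by rintro _ ⟨F, _, _, rfl⟩; rw [← hav F, Hua.numAbsIndecReps_zero])
    (fun q => Hua.rValue V q) (fun q hq α => Hua.rSeries_mem_valSubring hloops (hS2 q hq) α)
    (by rintro _ ⟨F, _, _, rfl⟩; exact_mod_cast (Hua.isLog_numReps hav F).2)
    (by
      rintro _ ⟨F, _, _, rfl⟩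
      have h1 := (Hua.isLog_numReps hav F).1
      simp only [hmv _ F rfl] at h1
      exact_mod_cast h1)
  refine ⟨m, a, fun F _ _ α => ?_, ha, hm⟩
  rw [hav F, hmv _ F rfl]
  exact hval _ ⟨F, inferInstance, inferInstance, rfl⟩ α
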